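/- Let $d\ge 1$ and let $(J_{x,y})_{x,y\in\mathbb{Z}^d}$ be real coupling constants, $J_{x,y}=J_{y,x}$, which are translation invariant ($J_{x,y}=J_{0,y-x}$), ferromagnetic ($J_{x,y}\ge 0$), summable ($\sum_{x} J_{0,x}<\infty$) and aperiodic (for each $x\in\mathbb{Z}^d$ there are $0=x_0,x_1,\dots,x_m=x$ with $J_{x_{i},x_{i+1}}>0$ for all $0\le i<m$). Consider the Ising model at zero magnetic field: for finite $\Lambda\subset\mathbb{Z}^d$, inverse temperature $\beta$ and boundary condition $\tau\in\{-1,0,1\}^{\mathbb{Z}^d\setminus\Lambda}$, the finite-volume Gibbs measure gives $\sigma\in\{-1,1\}^\Lambda$ a probability proportional to $e^{-\beta H^\tau_\Lambda(\sigma)}$, where $$H_\Lambda^\tau(\sigma)=-\sum_{\{x,y\}\subset\Lambda,\,x\ne y}J_{x,y}\sigma_x\sigma_y-\sum_{x\in\Lambda,\,y\notin\Lambda}J_{x,y}\sigma_x\tau_y .$$ Let $\langle\cdot\rangle^0_\beta$ and $\langle\cdot\rangle^+_\beta$ be the limits, as $\Lambda\uparrow\mathbb{Z}^d$, of the finite-volume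 Gibbs expectations with the free ($\tau\equiv 0$) and plus ($\tau\equiv 1$) boundary conditions. Let $m^*(\beta)=\langle\sigma_0\rangle^+_\beta$ be the spontaneous magnetization, suppose that $m^*(\beta)>0$ for some $\beta>0$, and let $\beta_c=\inf\{\beta>0: m^*(\beta)>0\}$. Let $\widetilde M_{LRO}(\beta)\ge 0$ be given by $$\widetilde M_{LRO}(\beta)^2=\inf_{\emptyset\ne B\subset\mathbb{Z}^d,\ |B|<\infty}\ \frac1{|B|^2}\sum_{x,y\in B}\langle\sigma_x\sigma_y\rangle^0_\beta .$$ If $\widetilde M_{LRO}(\beta_c)=0$, then $m^*(\beta_c)=0$, and the model has exactly one Gibbs state at $\beta_c$, that is, exactly one probability measure on $\{-1,1\}^{\mathbb{Z}^d}$ satisfies the Dobrushin–Lanford–Ruelle equations at inverse temperature $\beta_c$ and zero magnetic field. -/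

import Mathlib

open Filter MeasureTheory

namespace IsingZd

/-- The sites of the lattice `ℤ^d`. -/
abbrev Site (d : ℕ) : Type := Fin d → ℤ

/-- Spin configurations `σ ∈ {-1,1}^{ℤ^d}`; the group `ℤˣ` is `{-1, 1}`. The type carries the product
σ-algebra. -/
abbrev Config (d : ℕ) : Type := Site d → ℤˣ

/-- The real value `±1` of a spin. -/
def spin (s : ℤˣ) : ℝ := ((s : ℤ) : ℝ)

/-- The assumptions on the coupling constants. As the couplings are attached to unordered pairs
`{x, y}`, they are symmetric. -/
structure Admissible {d : ℕ} (J : Site d → Site d → ℝ) : Prop where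
  /-- `J` is a function of unordered pairs -/
  symm : ∀ x y, J x y = J y x
  /-- translation invariant -/
  transl : ∀ x y, J x y = J 0 (y - x)
  /-- ferromagnetic -/
  ferro : ∀ x y, 0 ≤ J x y
  /-- locally finite -/
  summable : Summable (fun x => J 0 x)
  /-- aperiodic: every `x` is reached from `0` by finitely many steps along positive couplings -/
  aperiodic : ∀ x, Relation.ReflTransGen (fun a b => 0 < J a b) 0 x

noncomputable section

/-- The Hamiltonian (at zero magnetic field) in the finite volume `Λ` with boundary condition `τ`;
only the values of `τ` outside `Λ` matter. The first term is the sum over the unordered pairs of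
distinct sites of `Λ`, written as half of the sum over the ordered pairs. -/
def hamiltonian {d : ℕ} (J : Site d → Site d → ℝ) (Λ : Finset (Site d)) (τ : Site d → ℝ)
    (σ : Λ → ℤˣ) : ℝ :=
  - ((1 / 2 : ℝ) * ∑ x : Λ, ∑ y : Λ, if x = y then 0 else J x y * spin (σ x) * spin (σ y))
  - ∑ x : Λ, ∑' y : {y : Site d // y ∉ Λ}, J x y * spin (σ x) * τ y

/-- The finite volume Gibbs expectation `⟨f⟩` in `Λ` at inverse temperature `β` with boundary
condition `τ`. -/
def gibbsExp {d : ℕ} (J : Site d → Site d → ℝ) (β : ℝ) (Λ : Finset (Site d)) (τ : Site d → ℝ)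
    (f : (Λ → ℤˣ) → ℝ) : ℝ :=
  (∑ σ : Λ → ℤˣ, f σ * Real.exp (-β * hamiltonian J Λ τ σ)) /
    ∑ σ : Λ → ℤˣ, Real.exp (-β * hamiltonian J Λ τ σ)

open Classical in
/-- The configuration equal to `σ` in `Λ` and to `ω` outside `Λ`. -/
def glue {d : ℕ} (Λ : Finset (Site d)) (σ : Λ → ℤˣ) (ω : Config d) : Config d :=
  fun x => if h : x ∈ Λ then σ ⟨x, h⟩ else ω x

/-- The infinite volume expectation of a local observable `F` with boundary condition `τ`: the limit
of its finite volume expectations as the finite set `Λ` increases to `ℤ^d`. The all-plus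
configuration that completes `σ` is immaterial, as a local `F` depends only on the spins in `Λ` once
`Λ` is large. Used for the free and plus boundary conditions, for which the limit exists. -/
def infiniteExp {d : ℕ} (J : Site d → Site d → ℝ) (β : ℝ) (τ : Site d → ℝ) (F : Config d → ℝ) : ℝ :=
  limUnder atTop (fun Λ : Finset (Site d) => gibbsExp J β Λ τ (fun σ => F (glue Λ σ 1)))

/-- The free state `⟨F⟩⁰_β`: boundary condition `τ = 0`. -/
def freeExp {d : ℕ} (J : Site d → Site d → ℝ) (β : ℝ) (F : Config d → ℝ) : ℝ :=
  infiniteExp J β (fun _ => 0) F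

/-- The plus state `⟨F⟩⁺_β`: boundary condition `τ = 1`. -/
def plusExp {d : ℕ} (J : Site d → Site d → ℝ) (β : ℝ) (F : Config d → ℝ) : ℝ :=
  infiniteExp J β (fun _ => 1) F

/-- The spontaneous magnetization `m*(β) = ⟨σ_0⟩⁺_β`. -/
def spontaneousMagnetization {d : ℕ} (J : Site d → Site d → ℝ) (β : ℝ) : ℝ :=
  plusExp J β (fun ω => spin (ω 0))

/-- The long range order parameter `M̃_LRO(β)`, the nonnegative number whose square is the infimum over
the nonempty finite sets `B` of `|B|⁻² ∑_{x,y ∈ B} ⟨σ_x σ_y⟩⁰_β`. -/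
def modifiedLRO {d : ℕ} (J : Site d → Site d → ℝ) (β : ℝ) : ℝ :=
  √(⨅ B : {B : Finset (Site d) // B.Nonempty},
    (1 / (B.1.card : ℝ) ^ 2) *
      ∑ x ∈ B.1, ∑ y ∈ B.1, freeExp J β (fun ω => spin (ω x) * spin (ω y)))

/-- `βc` is the critical inverse temperature: the (finite) threshold above which the spontaneous
magnetization is positive. No real number qualifies if there is no phase transition. -/
def IsCriticalBeta {d : ℕ} (J : Site d → Site d → ℝ) (βc : ℝ) : Prop :=
  IsGLB {β : ℝ | 0 < β ∧ 0 < spontaneousMagnetization J β} βc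

/-- `μ` is a Gibbs state at inverse temperature `β`: it satisfies the Dobrushin–Lanford–Ruelle
equations, that is, resampling the spins in any finite `Λ` from the finite volume Gibbs measure whose
boundary condition is the configuration outside `Λ` leaves `μ` invariant. -/
def IsGibbsState {d : ℕ} (J : Site d → Site d → ℝ) (β : ℝ)
    (μ : ProbabilityMeasure (Config d)) : Prop :=
  ∀ (Λ : Finset (Site d)) (F : Config d → ℝ), Measurable F → (∃ C : ℝ, ∀ ω, |F ω| ≤ C) →
    ∫ ω, gibbsExp J β Λ (fun y => spin (ω y)) (fun σ => F (glue Λ σ ω)) ∂(μ : Measure (Config d))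
      = ∫ ω, F ω ∂(μ : Measure (Config d))

end

end IsingZd

/-! The proof is a finite-volume Burton–Keane argument, for a cluster representation of two
independent copies of the model: one with free boundary condition, `σ`, and one with plus boundary
condition, `s`, viewed as a nonnegative field `h`. It works at every `β ≥ 0` with vanishing
`modifiedLRO`.

Representation. With `τ = s σ`, the joint weight of a pair of sites is `exp (K s_x s_y (1 + τ_x
τ_y))`, which is `1` unless `τ_x = τ_y`. Expanding over sets `ω` of open pairs and open field terms
(`boltzmann_mul_boltzmann`) makes `τ` constant on the clusters of `ω`. The remaining sums over `s`
are nonnegative by Griffiths' first inequality, so `mass` is a percolation measure up to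
normalization. In it: • `x` and `y` are connected with probability `⟨σ_x σ_y⟩⁰ ⟨σ_x σ_y⟩⁺`
(`sum_mass_conn`); • the difference `⟨σ_x σ_y⟩⁺ - ⟨σ_x σ_y⟩⁰` is carried by the `ω` in which `x` and
`y` are not connected but `x` is connected to the field (`sum_not_conn`,
`connField_of_expansionWeight_ne_zero`); • the field term at `x` is open with probability at most `h
x` (`sum_mass_field_le`); • opening finitely many positive couplings costs a bounded factor
(`mass_union_ge`).

Contradiction. Suppose `m* > 0`. Griffiths' second inequality gives `⟨σ_x σ_y⟩⁺ ≥ m*²`, while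
vanishing long range order gives a `z` with `⟨σ_0 σ_z⟩⁰ < m*²`. Sites well inside the volume are
then connected to the field with probability at least some fixed `p > 0` (`sum_mass_connField_ge`).
In a finite set `S` with small average free correlation few pairs are connected, so with probability
at least `p / 4` the set meets three distinct clusters reaching the field
(`sum_mass_meetsThree_ge`). Opening a connected block around `S` turns this into a trifurcation.
Disjoint trifurcations are no more numerous than open field terms (`card_trifurcation_le`), so their
expected number is at most `∑ h x`. This sum is `o(N^d)` in the cube of side `N` because `J` is
summable, whereas disjoint translates of the block give order `N^d` trifurcations.

Uniqueness. When `m* = 0`, Holley's inequality bounds the influence of any boundary condition on the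
event "plus on `A`" by the sum over `A` of the finite-volume plus magnetizations, which tends to
`0`; the DLR equations then determine the state. Existence follows from compactness and the
continuity of the finite-volume kernels. -/

namespace IsingZd

/-! ### Arithmetic of spins -/

section Spin

lemma spin_one : spin 1 = 1 := by simp [spin]

lemma spin_neg (a : ℤˣ) : spin (-a) = -spin a := by simp [spin]

lemma spin_mul (a b : ℤˣ) : spin (a * b) = spin a * spin b := by simp [spin]

lemma spin_eq (a : ℤˣ) : spin a = 1 ∨ spin a = -1 := by
  rcases Int.units_eq_one_or a with rfl | rfl <;> simp [spin]

lemma spin_mul_self (a : ℤˣ) : spin a * spin a = 1 := by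
  rcases spin_eq a with h | h <;> simp [h]

lemma abs_spin (a : ℤˣ) : |spin a| = 1 := by
  rcases spin_eq a with h | h <;> simp [h]

lemma spin_le_one (a : ℤˣ) : spin a ≤ 1 := by
  rcases spin_eq a with h | h <;> simp [h]

lemma spin_eq_spin_mul_of_ne {a b : ℤˣ} : spin a * spin b = if a = b then 1 else -1 := by
  rcases Int.units_eq_one_or a with rfl | rfl <;> rcases Int.units_eq_one_or b with rfl | rfl <;>
    simp [spin]

end Spin

/-! ### Griffiths' inequalities for spin systems on a finite abelian group -/

section Griffiths

variable {G : Type*} [CommGroup G]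

/-- The cone of the functions that are polynomials with nonnegative coefficients in the
`±1`-valued characters of `G`. -/
inductive GriffithsCone : (G → ℝ) → Prop
  | char (φ : G →* ℤˣ) : GriffithsCone fun g => spin (φ g)
  | smul {c : ℝ} (hc : 0 ≤ c) {f : G → ℝ} (hf : GriffithsCone f) : GriffithsCone fun g => c * f g
  | add {f f' : G → ℝ} (hf : GriffithsCone f) (hf' : GriffithsCone f') :
      GriffithsCone fun g => f g + f' g
  | mul {f f' : G → ℝ} (hf : GriffithsCone f) (hf' : GriffithsCone f') :
      GriffithsCone fun g => f g * f' g

namespace GriffithsCone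

lemma one : GriffithsCone fun _ : G => (1 : ℝ) := by
  simpa [spin_one] using char (1 : G →* ℤˣ)

lemma const {c : ℝ} (hc : 0 ≤ c) : GriffithsCone fun _ : G => c := by
  simpa using smul hc (one (G := G))

lemma prod {ι : Type*} (s : Finset ι) {f : ι → G → ℝ} (hf : ∀ i ∈ s, GriffithsCone (f i)) :
    GriffithsCone fun g => ∏ i ∈ s, f i g := by
  classical
  induction s using Finset.induction_on with
  | empty => simpa using one
  | insert a s ha ih =>
    simp only [Finset.prod_insert ha]
    exact mul (hf a (by simp)) (ih fun i hi => hf i (by simp [hi]))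

lemma exp_spin_eq (c : ℝ) (a : ℤˣ) :
    Real.exp (c * spin a) = Real.cosh c + Real.sinh c * spin a := by
  rcases spin_eq a with h | h <;> rw [h]
  · simp [Real.cosh_add_sinh]
  · simp [← Real.cosh_sub_sinh, sub_eq_add_neg]

/-- Since the character is `±1`-valued, the function is `(cosh c - 1) + sinh c · spin`. The
subtracted `1` is harmless because `cosh c ≥ 1`; this is what makes the weights of the cluster
expansion nonnegative. -/
lemma exp_sub_one {c : ℝ} (hc : 0 ≤ c) (φ : G →* ℤˣ) :
    GriffithsCone fun g => Real.exp (c * spin (φ g)) - 1 := by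
  have : (fun g => Real.exp (c * spin (φ g)) - 1)
      = fun g => (Real.cosh c - 1) + Real.sinh c * spin (φ g) := by
    ext g; rw [exp_spin_eq]; ring
  rw [this]
  exact add (const (by linarith [Real.one_le_cosh c])) (smul (Real.sinh_nonneg_iff.2 hc) (char φ))

lemma exp {c : ℝ} (hc : 0 ≤ c) (φ : G →* ℤˣ) :
    GriffithsCone fun g => Real.exp (c * spin (φ g)) := by
  simpa using add (exp_sub_one hc φ) one

/-- A nontrivial character sums to zero: translation by a point where it equals `-1` reverses the
sign of the sum. -/
lemma sum_char_nonneg [Fintype G] (φ : G →* ℤˣ) : 0 ≤ ∑ g, spin (φ g) := by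
  by_cases h : ∀ g, φ g = 1
  · simp [h, spin_one]
  · push Not at h
    obtain ⟨t, ht⟩ := h
    have h1 : φ t = -1 := (Int.units_eq_one_or _).resolve_left ht
    have h2 : ∑ g, spin (φ (t * g)) = ∑ g, spin (φ g) :=
      Equiv.sum_comp (Equiv.mulLeft t) fun g => spin (φ g)
    simp only [map_mul, h1, spin_mul, ← Finset.mul_sum] at h2
    have : spin (-1) = -1 := by simp [spin]
    rw [this] at h2
    linarith

/-- **Griffiths' first inequality.** -/
lemma sum_nonneg [Fintype G] {f : G → ℝ} (hf : GriffithsCone f) : 0 ≤ ∑ g, f g := by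
  -- The induction needs a property stable under products: multiplication by `f` preserves
  -- nonnegativity of all the sums against characters. The claim is the case `h = 1`.
  have key : ∀ h : G → ℝ, (∀ φ : G →* ℤˣ, 0 ≤ ∑ g, spin (φ g) * h g) →
      ∀ φ : G →* ℤˣ, 0 ≤ ∑ g, spin (φ g) * (f g * h g) := by
    induction hf with
    | char ψ =>
      intro h hh φ
      refine (hh (φ * ψ)).trans_eq (Finset.sum_congr rfl fun g _ => ?_)
      rw [MonoidHom.mul_apply, spin_mul]; ring
    | smul hc _ ih =>
      rename_i c f _
      intro h hh φ
      refine (mul_nonneg hc (ih h hh φ)).trans_eq ?_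
      rw [Finset.mul_sum]
      exact Finset.sum_congr rfl fun g _ => by ring
    | add _ _ ih ih' =>
      intro h hh φ
      refine (add_nonneg (ih h hh φ) (ih' h hh φ)).trans_eq ?_
      rw [← Finset.sum_add_distrib]
      exact Finset.sum_congr rfl fun g _ => by ring
    | mul _ _ ih ih' =>
      intro h hh φ
      refine (ih _ (ih' h hh) φ).trans_eq ?_
      exact Finset.sum_congr rfl fun g _ => by ring
  have := key (fun _ => 1) (fun φ => by simpa using sum_char_nonneg φ) 1
  simpa [spin_one] using this

end GriffithsCone

variable {ι : Type*} [Fintype ι]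

/-- The Boltzmann weight of the spin system on `G` with couplings `K` to the characters `χ`. -/
noncomputable def boltzmann (χ : ι → G →* ℤˣ) (K : ι → ℝ) (g : G) : ℝ :=
  Real.exp (∑ i, K i * spin (χ i g))

lemma boltzmann_pos (χ : ι → G →* ℤˣ) (K : ι → ℝ) (g : G) : 0 < boltzmann χ K g := Real.exp_pos _

lemma griffithsCone_boltzmann (χ : ι → G →* ℤˣ) {K : ι → ℝ} (hK : ∀ i, 0 ≤ K i) :
    GriffithsCone (boltzmann χ K) := by
  have : boltzmann χ K = fun g => ∏ i, Real.exp (K i * spin (χ i g)) := by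
    ext g; rw [boltzmann, Real.exp_sum]
  rw [this]
  exact GriffithsCone.prod _ fun i _ => GriffithsCone.exp (hK i) _

variable [Fintype G]

/-- The expectation in the spin system on `G` with couplings `K` to the characters `χ`. -/
noncomputable def expect (χ : ι → G →* ℤˣ) (K : ι → ℝ) (f : G → ℝ) : ℝ :=
  (∑ g, f g * boltzmann χ K g) / ∑ g, boltzmann χ K g

lemma sum_boltzmann_pos (χ : ι → G →* ℤˣ) (K : ι → ℝ) : 0 < ∑ g, boltzmann χ K g :=
  Finset.sum_pos (fun g _ => boltzmann_pos χ K g) ⟨1, Finset.mem_univ _⟩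

lemma expect_char_nonneg (χ : ι → G →* ℤˣ) {K : ι → ℝ} (hK : ∀ i, 0 ≤ K i) (φ : G →* ℤˣ) :
    0 ≤ expect χ K fun g => spin (φ g) :=
  div_nonneg ((GriffithsCone.char φ).mul (griffithsCone_boltzmann χ hK)).sum_nonneg
    (sum_boltzmann_pos χ K).le

/-- The duplicate variable inequality behind Griffiths' second inequality. -/
lemma sum_duplicate_nonneg (χ : ι → G →* ℤˣ) {K K' : ι → ℝ} (hK : ∀ i, |K' i| ≤ K i)
    (φ ψ : G →* ℤˣ) :
    (∑ g, spin (ψ g) * boltzmann χ K g) * ∑ g, spin (φ g) * boltzmann χ K' g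
      ≤ (∑ g, spin (φ g) * spin (ψ g) * boltzmann χ K g) * ∑ g, boltzmann χ K' g := by
  have h0 : (∑ g, spin (φ g) * spin (ψ g) * boltzmann χ K g) * (∑ g, boltzmann χ K' g)
      - (∑ g, spin (ψ g) * boltzmann χ K g) * ∑ g, spin (φ g) * boltzmann χ K' g
      = ∑ g, ∑ g', spin (ψ g) * (spin (φ g) - spin (φ g')) *
        (boltzmann χ K g * boltzmann χ K' g') := by
    simp only [Finset.sum_mul_sum, ← Finset.sum_sub_distrib]
    exact Finset.sum_congr rfl fun g _ => Finset.sum_congr rfl fun g' _ => by ring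
  -- Ginibre's substitution `g' = g t`: for fixed `t`, the two weights merge into one Boltzmann
  -- weight in `g` with couplings `K i + K' i * spin (χ i t)`, which are nonnegative because `|K' i|
  -- ≤ K i`.
  have h1 : ∀ g, ∑ g', spin (ψ g) * (spin (φ g) - spin (φ g')) *
      (boltzmann χ K g * boltzmann χ K' g') = ∑ t, (1 - spin (φ t)) * (spin ((ψ * φ) g) *
        boltzmann χ (fun i => K i + K' i * spin (χ i t)) g) := by
    intro g
    rw [← Equiv.sum_comp (Equiv.mulLeft g)]
    refine Finset.sum_congr rfl fun t _ => ?_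
    have : boltzmann χ K g * boltzmann χ K' (g * t)
        = boltzmann χ (fun i => K i + K' i * spin (χ i t)) g := by
      rw [boltzmann, boltzmann, boltzmann, ← Real.exp_add, ← Finset.sum_add_distrib]
      congr 1
      refine Finset.sum_congr rfl fun i _ => ?_
      rw [map_mul, spin_mul]; ring
    rw [Equiv.coe_mulLeft, this, map_mul, spin_mul, MonoidHom.mul_apply, spin_mul]; ring
  rw [← sub_nonneg, h0, Finset.sum_congr rfl fun g _ => h1 g, Finset.sum_comm]
  refine Finset.sum_nonneg fun t _ => ?_
  rw [← Finset.mul_sum]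
  refine mul_nonneg (by linarith [spin_le_one (φ t)]) ?_
  refine ((GriffithsCone.char _).mul (griffithsCone_boltzmann χ fun i => ?_)).sum_nonneg
  have h2 : |K' i * spin (χ i t)| ≤ K i := by rw [abs_mul, abs_spin, mul_one]; exact hK i
  linarith [neg_abs_le (K' i * spin (χ i t))]

/-- Correlations increase with the couplings, also compared with couplings of either sign. -/
lemma expect_char_le (χ : ι → G →* ℤˣ) {K K' : ι → ℝ} (hK : ∀ i, |K' i| ≤ K i) (φ : G →* ℤˣ) :
    (expect χ K' fun g => spin (φ g)) ≤ expect χ K fun g => spin (φ g) := by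
  have := sum_duplicate_nonneg χ hK φ 1
  simp only [MonoidHom.one_apply, spin_one, one_mul, mul_one] at this
  rw [expect, expect, div_le_div_iff₀ (sum_boltzmann_pos χ K') (sum_boltzmann_pos χ K), mul_comm]
  exact this

/-- **Griffiths' second inequality.** -/
lemma expect_mul_le (χ : ι → G →* ℤˣ) {K : ι → ℝ} (hK : ∀ i, 0 ≤ K i) (φ ψ : G →* ℤˣ) :
    (expect χ K fun g => spin (φ g)) * (expect χ K fun g => spin (ψ g))
      ≤ expect χ K fun g => spin (φ g) * spin (ψ g) := by
  have := sum_duplicate_nonneg χ (K := K) (K' := K) (fun i => (abs_of_nonneg (hK i)).le) φ ψ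
  rw [expect, expect, expect, div_mul_div_comm,
    div_le_div_iff₀ (mul_pos (sum_boltzmann_pos χ K) (sum_boltzmann_pos χ K))
      (sum_boltzmann_pos χ K), ← mul_assoc]
  refine mul_le_mul_of_nonneg_right ?_ (sum_boltzmann_pos χ K).le
  rw [mul_comm]
  exact this

end Griffiths

/-! ### Cluster expansion of the duplicated Ising model -/

section Double

open scoped Classical

/-- The interaction terms of an Ising model on `V`: the (ordered) pairs of sites and, for the
external field, the sites. -/
abbrev Bond (V : Type*) : Type _ := (V × V) ⊕ V

variable {V : Type*}

/-- The character of spin configurations given by the spin at `x`. -/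
def siteChar (x : V) : (V → ℤˣ) →* ℤˣ := Pi.evalMonoidHom (fun _ => ℤˣ) x

/-- The product of the spins that enter an interaction term. -/
def bondChar : Bond V → ((V → ℤˣ) →* ℤˣ)
  | Sum.inl p => siteChar p.1 * siteChar p.2
  | Sum.inr x => siteChar x

/-- The couplings with pair interaction `K` and field `h`. -/
def bondCoupling (K : V → V → ℝ) (h : V → ℝ) : Bond V → ℝ
  | Sum.inl p => K p.1 p.2
  | Sum.inr x => h x

@[simp] lemma siteChar_apply (x : V) (s : V → ℤˣ) : siteChar x s = s x := rfl

@[simp] lemma bondChar_inl_apply (p : V × V) (s : V → ℤˣ) :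
    bondChar (Sum.inl p) s = s p.1 * s p.2 := rfl

@[simp] lemma bondChar_inr_apply (x : V) (s : V → ℤˣ) : bondChar (Sum.inr x) s = s x := rfl

lemma bondCoupling_nonneg {K : V → V → ℝ} {h : V → ℝ} (hK : ∀ x y, 0 ≤ K x y) (hh : ∀ x, 0 ≤ h x) :
    ∀ i, 0 ≤ bondCoupling K h i
  | Sum.inl p => hK p.1 p.2
  | Sum.inr x => hh x

/-- Connection of sites through the pairs in `ω`. -/
def Conn (ω : Finset (Bond V)) (x y : V) : Prop :=
  Relation.EqvGen (fun a b => Sum.inl (a, b) ∈ ω) x y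

/-- Connection of a site, through the pairs in `ω`, to a site where the field term is in `ω`. -/
def ConnField (ω : Finset (Bond V)) (x : V) : Prop := ∃ v, Conn ω x v ∧ Sum.inr v ∈ ω

lemma Conn.refl {ω : Finset (Bond V)} (x : V) : Conn ω x x := Relation.EqvGen.refl x

lemma Conn.symm {ω : Finset (Bond V)} {x y : V} (h : Conn ω x y) : Conn ω y x :=
  Relation.EqvGen.symm _ _ h

lemma Conn.trans {ω : Finset (Bond V)} {x y z : V} (h : Conn ω x y) (h' : Conn ω y z) :
    Conn ω x z := Relation.EqvGen.trans _ _ _ h h'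

lemma Conn.of_mem {ω : Finset (Bond V)} {x y : V} (h : Sum.inl (x, y) ∈ ω) : Conn ω x y :=
  Relation.EqvGen.rel _ _ h

lemma Conn.mono {ω ω' : Finset (Bond V)} (h : ω ⊆ ω') {x y : V} (hxy : Conn ω x y) :
    Conn ω' x y := Relation.EqvGen.mono (fun _ _ hab => h hab) _ _ hxy

lemma ConnField.mono {ω ω' : Finset (Bond V)} (h : ω ⊆ ω') {x : V} (hx : ConnField ω x) :
    ConnField ω' x := by
  obtain ⟨v, hv, hv'⟩ := hx
  exact ⟨v, hv.mono h, h hv'⟩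

/-- A property that is preserved along the pairs in `ω` is preserved under connection. -/
lemma Conn.iff_of_forall {ω : Finset (Bond V)} {α : Type*} {p : V → α}
    (hp : ∀ a b, Sum.inl (a, b) ∈ ω → p a = p b) {x y : V} (h : Conn ω x y) : p x = p y := by
  induction h with
  | rel _ _ h => exact hp _ _ h
  | refl _ => rfl
  | symm _ _ _ ih => exact ih.symm
  | trans _ _ _ _ _ ih ih' => exact ih.trans ih'

/-- The indicator that `τ` agrees on the two sites of a pair. -/
noncomputable def agreeAt (τ : V → ℤˣ) : Bond V → ℝ
  | Sum.inl p => if τ p.1 = τ p.2 then 1 else 0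
  | Sum.inr _ => 1

/-- The indicator that `τ` is constant on the clusters of `ω`. -/
noncomputable def agree (ω : Finset (Bond V)) (τ : V → ℤˣ) : ℝ := ∏ i ∈ ω, agreeAt τ i

lemma agreeAt_nonneg (τ : V → ℤˣ) (i : Bond V) : 0 ≤ agreeAt τ i := by
  rcases i with p | x <;> simp only [agreeAt]
  · split_ifs <;> norm_num
  · norm_num

lemma agree_nonneg (ω : Finset (Bond V)) (τ : V → ℤˣ) : 0 ≤ agree ω τ :=
  Finset.prod_nonneg fun i _ => agreeAt_nonneg τ i

lemma eq_of_agree_ne_zero {ω : Finset (Bond V)} {τ : V → ℤˣ} (h : agree ω τ ≠ 0) {x y : V}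
    (hxy : Conn ω x y) : τ x = τ y := by
  refine hxy.iff_of_forall fun a b hab => ?_
  by_contra hne
  exact h (Finset.prod_eq_zero hab (by simp [agreeAt, hne]))

/-- The configuration that flips the spins of the cluster of `x`. -/
noncomputable def clusterFlip (ω : Finset (Bond V)) (x : V) : V → ℤˣ :=
  fun v => if Conn ω x v then -1 else 1

lemma clusterFlip_eq {ω : Finset (Bond V)} (x : V) {a b : V} (h : Sum.inl (a, b) ∈ ω) :
    clusterFlip ω x a = clusterFlip ω x b := by
  have : Conn ω x a ↔ Conn ω x b :=
    ⟨fun h' => h'.trans (Conn.of_mem h), fun h' => h'.trans (Conn.of_mem h).symm⟩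
  simp [clusterFlip, this]

variable [Fintype V] [DecidableEq V]

/-- The expectation in the Ising model with pair interaction `K` and field `h`. -/
noncomputable def isingExpect (K : V → V → ℝ) (h : V → ℝ) (f : (V → ℤˣ) → ℝ) : ℝ :=
  expect bondChar (bondCoupling K h) f

/-- The number of configurations that are constant on the clusters of `ω`, weighted with `g`. -/
noncomputable def agreeSum (ω : Finset (Bond V)) (g : (V → ℤˣ) → ℝ) : ℝ :=
  ∑ τ, g τ * agree ω τ

/-- The weight of `ω` in the expansion of the Boltzmann weight with couplings `c` and with the
character `φ` inserted. -/
noncomputable def expansionWeight (c : Bond V → ℝ) (ω : Finset (Bond V)) (φ : (V → ℤˣ) →* ℤˣ) : ℝ :=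
  ∑ s, spin (φ s) * ∏ i ∈ ω, (Real.exp (c i * spin (bondChar i s)) - 1)

lemma expansionWeight_nonneg {c : Bond V → ℝ} (hc : ∀ i, 0 ≤ c i) (ω : Finset (Bond V))
    (φ : (V → ℤˣ) →* ℤˣ) : 0 ≤ expansionWeight c ω φ :=
  ((GriffithsCone.char φ).mul
    (GriffithsCone.prod ω fun i _ => GriffithsCone.exp_sub_one (hc i) (bondChar i))).sum_nonneg

lemma agreeSum_one_nonneg (ω : Finset (Bond V)) : 0 ≤ agreeSum ω fun _ => 1 :=
  Finset.sum_nonneg fun τ _ => mul_nonneg zero_le_one (agree_nonneg ω τ)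

lemma agreeSum_pair_of_conn {ω : Finset (Bond V)} {x y : V} (h : Conn ω x y) :
    (agreeSum ω fun τ => spin (τ x) * spin (τ y)) = agreeSum ω fun _ => 1 := by
  refine Finset.sum_congr rfl fun τ _ => ?_
  by_cases h0 : agree ω τ = 0
  · simp [h0]
  · simp only [eq_of_agree_ne_zero h0 h, spin_mul_self]

/-- Flipping `τ` on the cluster of `x` preserves `agree` and reverses the sign of `τ x` alone among
the two spins. -/
lemma agreeSum_pair_of_not_conn {ω : Finset (Bond V)} {x y : V} (h : ¬ Conn ω x y) :
    (agreeSum ω fun τ => spin (τ x) * spin (τ y)) = 0 := by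
  have h1 := Equiv.sum_comp (Equiv.mulLeft (clusterFlip ω x))
    fun τ => (spin (τ x) * spin (τ y)) * agree ω τ
  have h2 : ∀ τ, agree ω (clusterFlip ω x * τ) = agree ω τ := by
    intro τ
    refine Finset.prod_congr rfl fun i hi => ?_
    rcases i with p | v
    · simp only [agreeAt, Pi.mul_apply, clusterFlip_eq x hi, mul_right_inj]
    · rfl
  have h3 : clusterFlip ω x x = -1 := by simp [clusterFlip, Conn.refl]
  have h4 : clusterFlip ω x y = 1 := by simp [clusterFlip, h]
  simp only [Equiv.coe_mulLeft, h2, Pi.mul_apply, h3, h4, neg_mul, one_mul, spin_neg,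
    Finset.sum_neg_distrib] at h1
  rw [agreeSum]
  linarith

lemma agreeSum_pair_nonneg (ω : Finset (Bond V)) (x y : V) :
    0 ≤ agreeSum ω fun τ => spin (τ x) * spin (τ y) := by
  by_cases h : Conn ω x y
  · rw [agreeSum_pair_of_conn h]; exact agreeSum_one_nonneg ω
  · rw [agreeSum_pair_of_not_conn h]

/-- The agreement indicator of a pair is `(1 + τ_x τ_y) / 2`, and the pair sums are nonnegative.
Hence a new pair at most halves the count; a field term does not change it. -/
lemma agreeSum_le_two_mul_insert (ω : Finset (Bond V)) (i : Bond V) :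
    (agreeSum ω fun _ => 1) ≤ 2 * agreeSum (insert i ω) fun _ => 1 := by
  by_cases hi : i ∈ ω
  · rw [Finset.insert_eq_of_mem hi]; linarith [agreeSum_one_nonneg ω]
  · rcases i with p | x
    · have : 2 * (agreeSum (insert (Sum.inl p) ω) fun _ => 1) = (agreeSum ω fun _ => 1) +
          agreeSum ω fun τ => spin (τ p.1) * spin (τ p.2) := by
        rw [agreeSum, agreeSum, agreeSum, Finset.mul_sum, ← Finset.sum_add_distrib]
        refine Finset.sum_congr rfl fun τ _ => ?_
        rw [agree, Finset.prod_insert hi, agreeAt, spin_eq_spin_mul_of_ne, ← agree]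
        split_ifs <;> ring
      rw [this]
      linarith [agreeSum_pair_nonneg ω p.1 p.2]
    · have : (agreeSum (insert (Sum.inr x) ω) fun _ => 1) = agreeSum ω fun _ => 1 := by
        refine Finset.sum_congr rfl fun τ _ => ?_
        rw [agree, Finset.prod_insert hi, agreeAt, ← agree, one_mul]
      rw [this]; linarith [agreeSum_one_nonneg ω]

/-- A pair of sites in different clusters contributes only if both clusters meet the field. -/
lemma connField_of_expansionWeight_ne_zero {c : Bond V → ℝ} {ω : Finset (Bond V)} {x y : V}
    (hxy : ¬ Conn ω x y) (h : expansionWeight c ω (siteChar x * siteChar y) ≠ 0) :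
    ConnField ω x := by
  by_contra hx
  apply h
  -- If no field term is open in the cluster of `x`, flipping this cluster fixes every factor of the
  -- product and reverses the sign of the source.
  have h1 := Equiv.sum_comp (Equiv.mulLeft (clusterFlip ω x))
    fun s => spin ((siteChar x * siteChar y) s) *
      ∏ i ∈ ω, (Real.exp (c i * spin (bondChar i s)) - 1)
  have h2 : ∀ s, ∏ i ∈ ω, (Real.exp (c i * spin (bondChar i (clusterFlip ω x * s))) - 1)
      = ∏ i ∈ ω, (Real.exp (c i * spin (bondChar i s)) - 1) := by
    intro s
    refine Finset.prod_congr rfl fun i hi => ?_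
    have : bondChar i (clusterFlip ω x) = 1 := by
      rcases i with p | v
      · rw [bondChar_inl_apply, clusterFlip_eq x hi, Int.units_mul_self]
      · have : ¬ Conn ω x v := fun hv => hx ⟨v, hv, hi⟩
        simp [clusterFlip, this]
    rw [map_mul, this, one_mul]
  have h3 : clusterFlip ω x x = -1 := by simp [clusterFlip, Conn.refl]
  have h4 : clusterFlip ω x y = 1 := by simp [clusterFlip, hxy]
  simp only [Equiv.coe_mulLeft, h2] at h1
  simp only [map_mul, MonoidHom.mul_apply, siteChar_apply, h3, h4, neg_mul,
    one_mul, spin_neg, Finset.sum_neg_distrib, mul_one] at h1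
  rw [expansionWeight]
  simp only [MonoidHom.mul_apply, siteChar_apply]
  linarith

lemma expansionWeight_insert {c : Bond V → ℝ} {ω : Finset (Bond V)} {i : Bond V} (hi : i ∉ ω)
    (φ : (V → ℤˣ) →* ℤˣ) :
    expansionWeight c (insert i ω) φ = (Real.cosh (c i) - 1) * expansionWeight c ω φ
      + Real.sinh (c i) * expansionWeight c ω (φ * bondChar i) := by
  rw [expansionWeight, expansionWeight, expansionWeight, Finset.mul_sum, Finset.mul_sum,
    ← Finset.sum_add_distrib]
  refine Finset.sum_congr rfl fun s _ => ?_
  rw [Finset.prod_insert hi, GriffithsCone.exp_spin_eq, MonoidHom.mul_apply, spin_mul]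
  ring

/-- The constant in the insertion of a bond. -/
noncomputable def insertConst (k : ℝ) : ℝ := min 1 (Real.cosh k - 1)

lemma insertConst_pos {k : ℝ} (hk : 0 < k) : 0 < insertConst k := by
  have : 1 < Real.cosh k := Real.one_lt_cosh.2 hk.ne'
  exact lt_min one_pos (by linarith)

/-- A new bond multiplies the weight by at least `cosh - 1`, since the `sinh` term is nonnegative by
Griffiths; a bond already present leaves the weight unchanged, hence the minimum with `1`. -/
lemma insertConst_mul_expansionWeight_le {c : Bond V → ℝ} (hc : ∀ i, 0 ≤ c i)
    (ω : Finset (Bond V)) (i : Bond V) (φ : (V → ℤˣ) →* ℤˣ) :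
    insertConst (c i) * expansionWeight c ω φ ≤ expansionWeight c (insert i ω) φ := by
  have h0 := expansionWeight_nonneg hc ω φ
  by_cases hi : i ∈ ω
  · rw [Finset.insert_eq_of_mem hi]
    exact mul_le_of_le_one_left h0 (min_le_left _ _)
  · rw [expansionWeight_insert hi]
    have h1 := mul_nonneg (Real.sinh_nonneg_iff.2 (hc i))
      (expansionWeight_nonneg hc ω (φ * bondChar i))
    have h2 : insertConst (c i) * expansionWeight c ω φ
        ≤ (Real.cosh (c i) - 1) * expansionWeight c ω φ :=
      mul_le_mul_of_nonneg_right (min_le_right _ _) h0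
    linarith

/-- The constant in the comparison of the weights with and without a source at a bond. -/
noncomputable def sourceConst (k : ℝ) : ℝ :=
  (Real.sinh k)⁻¹ + (Real.cosh k - 1) / Real.sinh k + Real.sinh k / (Real.cosh k - 1)

lemma sourceConst_nonneg {k : ℝ} (hk : 0 < k) : 0 ≤ sourceConst k := by
  have : 1 < Real.cosh k := Real.one_lt_cosh.2 hk.ne'
  have h1 : 0 < Real.cosh k - 1 := by linarith
  have h2 : 0 < Real.sinh k := Real.sinh_pos_iff.2 hk
  unfold sourceConst; positivity

/-- Opening a bond produces both a term without and a term with the source at that bond, so the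
weight of the enlarged set dominates the weight with the source. Sources can thus be traded for open
bonds. -/
lemma expansionWeight_mul_bondChar_le {c : Bond V → ℝ} (hc : ∀ i, 0 ≤ c i)
    (ω : Finset (Bond V)) {i : Bond V} (hi0 : 0 < c i) (φ : (V → ℤˣ) →* ℤˣ) :
    expansionWeight c ω (φ * bondChar i)
      ≤ sourceConst (c i) * expansionWeight c (insert i ω) φ := by
  have hcosh : 1 < Real.cosh (c i) := Real.one_lt_cosh.2 hi0.ne'
  have ha : 0 < Real.cosh (c i) - 1 := by linarith
  have hb : 0 < Real.sinh (c i) := Real.sinh_pos_iff.2 hi0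
  have key : ∀ A B : ℝ, 0 ≤ A → 0 ≤ B →
      B ≤ sourceConst (c i) * ((Real.cosh (c i) - 1) * A + Real.sinh (c i) * B) ∧
      (Real.cosh (c i) - 1) * B + Real.sinh (c i) * A
        ≤ sourceConst (c i) * ((Real.cosh (c i) - 1) * A + Real.sinh (c i) * B) := by
    intro A B hA hB
    unfold sourceConst
    generalize Real.cosh (c i) - 1 = a at ha
    generalize Real.sinh (c i) = b at hb
    -- The three summands of `sourceConst` produce, in turn, the terms `B`, `a * B` and `b * A`; all
    -- other terms are nonnegative. The first serves a new bond, the other two a bond already open.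
    have e : (b⁻¹ + a / b + b / a) * (a * A + b * B)
        = B + (a * B + b * A) + (a / b * A + a * (a / b) * A + b * (b / a) * B) := by
      field_simp; ring
    have h1 : 0 ≤ a / b * A + a * (a / b) * A + b * (b / a) * B := by positivity
    have h2 : 0 ≤ a * B + b * A := by positivity
    rw [e]
    constructor <;> linarith
  by_cases hi : i ∈ ω
  · rw [Finset.insert_eq_of_mem hi, ← Finset.insert_erase hi,
      expansionWeight_insert (Finset.notMem_erase i ω),
      expansionWeight_insert (Finset.notMem_erase i ω)]
    have : φ * bondChar i * bondChar i = φ := by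
      ext s
      simp [mul_assoc, Int.units_mul_self]
    rw [this]
    exact (key _ _ (expansionWeight_nonneg hc _ _) (expansionWeight_nonneg hc _ _)).2
  · rw [expansionWeight_insert hi]
    exact (key _ _ (expansionWeight_nonneg hc _ _) (expansionWeight_nonneg hc _ _)).1

/-- For a path from `x` to `y` the product of the bond characters is `siteChar x * siteChar y`, so
opening the path removes this pair of sources. -/
lemma expansionWeight_mul_prod_le {c : Bond V → ℝ} (hc : ∀ i, 0 ≤ c i) (ω : Finset (Bond V)) :
    ∀ (l : List (Bond V)), (∀ i ∈ l, 0 < c i) → ∀ φ : (V → ℤˣ) →* ℤˣ,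
      expansionWeight c ω (φ * (l.map bondChar).prod)
        ≤ (l.map fun i => sourceConst (c i)).prod * expansionWeight c (ω ∪ l.toFinset) φ
  | [], _, φ => by simp
  | i :: l, hl, φ => by
    have hi : 0 < c i := hl i (by simp)
    have hl' : ∀ j ∈ l, 0 < c j := fun j hj => hl j (by simp [hj])
    have h1 := expansionWeight_mul_prod_le hc ω l hl' (φ * bondChar i)
    have h2 := expansionWeight_mul_bondChar_le hc (ω ∪ l.toFinset) hi φ
    have h3 : 0 ≤ (l.map fun i => sourceConst (c i)).prod := by
      refine List.prod_nonneg fun a ha => ?_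
      obtain ⟨j, hj, rfl⟩ := List.mem_map.1 ha
      exact sourceConst_nonneg (hl' j hj)
    rw [List.map_cons, List.prod_cons, ← mul_assoc, List.map_cons, List.prod_cons,
      List.toFinset_cons, Finset.union_insert]
    calc _ ≤ _ := h1
      _ ≤ _ := mul_le_mul_of_nonneg_left h2 h3
      _ = _ := by ring

/-- The weight of `ω` in the expansion of the partition function of the duplicated model. -/
noncomputable def mass (c : Bond V → ℝ) (ω : Finset (Bond V)) : ℝ :=
  (agreeSum ω fun _ => 1) * expansionWeight c ω 1

lemma mass_nonneg {c : Bond V → ℝ} (hc : ∀ i, 0 ≤ c i) (ω : Finset (Bond V)) : 0 ≤ mass c ω :=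
  mul_nonneg (agreeSum_one_nonneg ω) (expansionWeight_nonneg hc ω 1)

lemma agreeSum_le_union (ω E : Finset (Bond V)) :
    (agreeSum ω fun _ => 1) ≤ 2 ^ E.card * agreeSum (ω ∪ E) fun _ => 1 := by
  induction E using Finset.induction_on with
  | empty => simp
  | insert i E hi ih =>
    rw [Finset.card_insert_of_notMem hi, Finset.union_insert]
    refine ih.trans ?_
    rw [pow_succ, mul_assoc]
    exact mul_le_mul_of_nonneg_left (agreeSum_le_two_mul_insert _ i) (by positivity)

/-- Insertion tolerance: each bond costs the factor `insertConst` in the expansion weight and `1 /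
2` in the number of agreeing `τ`. -/
lemma mass_union_ge {c : Bond V → ℝ} (hc : ∀ i, 0 ≤ c i) (ω E : Finset (Bond V)) :
    (∏ i ∈ E, insertConst (c i) / 2) * mass c ω ≤ mass c (ω ∪ E) := by
  have hnn : ∀ k : ℝ, 0 ≤ insertConst k := fun k => le_min zero_le_one (by
    linarith [Real.one_le_cosh k])
  induction E using Finset.induction_on with
  | empty => simp
  | insert i E hi ih =>
    rw [Finset.prod_insert hi, Finset.union_insert]
    have h1 : insertConst (c i) / 2 * mass c (ω ∪ E) ≤ mass c (insert i (ω ∪ E)) := by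
      have h2 := agreeSum_le_two_mul_insert (ω ∪ E) i
      have h3 := insertConst_mul_expansionWeight_le hc (ω ∪ E) i 1
      have h4 := mul_le_mul h2 h3 (mul_nonneg (hnn _) (expansionWeight_nonneg hc _ _))
        (mul_nonneg zero_le_two (agreeSum_one_nonneg _))
      unfold mass
      linarith
    calc _ = insertConst (c i) / 2 * ((∏ i ∈ E, insertConst (c i) / 2) * mass c ω) := by ring
      _ ≤ insertConst (c i) / 2 * mass c (ω ∪ E) :=
        mul_le_mul_of_nonneg_left ih (by linarith [hnn (c i)])
      _ ≤ _ := h1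

/-- The map `ω ↦ ω ∪ E` is at most `2 ^ E.card` to one, as `ω` is determined by `ω ∪ E` and `ω ∩ E`.
-/
lemma sum_union_le {α : Type*} [Fintype α] [DecidableEq α] {g : Finset α → ℝ} (hg : ∀ ω, 0 ≤ g ω)
    (E : Finset α) : ∑ ω, g (ω ∪ E) ≤ 2 ^ E.card * ∑ ω, g ω := by
  rw [← Finset.sum_fiberwise Finset.univ (fun ω => ω ∪ E), Finset.mul_sum]
  refine Finset.sum_le_sum fun ω' _ => ?_
  have h1 : ∀ ω ∈ Finset.univ.filter (fun ω : Finset α => ω ∪ E = ω'), g (ω ∪ E) = g ω' :=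
    fun ω hω => by rw [(Finset.mem_filter.1 hω).2]
  rw [Finset.sum_congr rfl h1, Finset.sum_const, nsmul_eq_mul]
  refine mul_le_mul_of_nonneg_right ?_ (hg ω')
  have h2 : (Finset.univ.filter fun ω : Finset α => ω ∪ E = ω').card ≤ E.powerset.card := by
    refine Finset.card_le_card_of_injOn (fun ω => ω ∩ E) (fun ω _ => by simp) ?_
    intro ω hω ω₂ hω₂ h
    simp only [Finset.coe_filter, Finset.mem_univ, true_and, Set.mem_ofPred_eq] at hω hω₂
    simp only at h
    have : ∀ ω : Finset α, ω = ((ω ∪ E) \ E) ∪ (ω ∩ E) := fun ω => by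
      ext a; simp only [Finset.mem_union, Finset.mem_sdiff, Finset.mem_inter]; tauto
    rw [this ω, this ω₂, hω, hω₂, h]
  rw [Finset.card_powerset] at h2
  exact_mod_cast h2

/-- The free copy is `s * τ`. A pair has total exponent `K s_x s_y (1 + τ_x τ_y)`, equal to `2 K s_x
s_y` if `τ` agrees and to `0` otherwise. Its factor is therefore `1` plus the agreement indicator
times `exp (2 K s_x s_y) - 1`, and the product over all terms is expanded. -/
lemma boltzmann_mul_boltzmann (K : V → V → ℝ) (h : V → ℝ) (s τ : V → ℤˣ) :
    boltzmann bondChar (bondCoupling K 0) (s * τ) * boltzmann bondChar (bondCoupling K h) s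
      = ∑ ω, agree ω τ * ∏ i ∈ ω,
        (Real.exp (bondCoupling (fun x y => 2 * K x y) h i * spin (bondChar i s)) - 1) := by
  rw [boltzmann, boltzmann, ← Real.exp_add, ← Finset.sum_add_distrib, Real.exp_sum]
  simp only [agree, ← Finset.prod_mul_distrib]
  rw [← Finset.powerset_univ, ← Finset.prod_one_add]
  refine Finset.prod_congr rfl fun i _ => ?_
  rcases i with ⟨x, y⟩ | x
  · simp only [bondCoupling, bondChar_inl_apply, Pi.mul_apply, agreeAt, spin_mul]
    have := spin_eq_spin_mul_of_ne (a := τ x) (b := τ y)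
    split_ifs at this ⊢ with hxy
    · rw [show K x y * (spin (s x) * spin (τ x) * (spin (s y) * spin (τ y)))
        + K x y * (spin (s x) * spin (s y)) = K x y * (spin (s x) * spin (s y))
          * (spin (τ x) * spin (τ y) + 1) by ring, this]
      ring_nf
    · rw [show K x y * (spin (s x) * spin (τ x) * (spin (s y) * spin (τ y)))
        + K x y * (spin (s x) * spin (s y)) = K x y * (spin (s x) * spin (s y))
          * (spin (τ x) * spin (τ y) + 1) by ring, this]
      simp
  · simp [bondCoupling, agreeAt]

/-- The expansion of the duplicated Ising model, without and with the field, in clusters. -/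
lemma sum_duplicate_eq (K : V → V → ℝ) (h : V → ℝ) (g : (V → ℤˣ) → ℝ) (φ : (V → ℤˣ) →* ℤˣ) :
    ∑ s, ∑ σ, g (s * σ) * spin (φ s) * (boltzmann bondChar (bondCoupling K 0) σ *
      boltzmann bondChar (bondCoupling K h) s)
      = ∑ ω, agreeSum ω g * expansionWeight (bondCoupling (fun x y => 2 * K x y) h) ω φ := by
  have h1 : ∀ s, ∑ σ, g (s * σ) * spin (φ s) * (boltzmann bondChar (bondCoupling K 0) σ *
      boltzmann bondChar (bondCoupling K h) s) = ∑ ω, ∑ τ, (g τ * agree ω τ) * (spin (φ s) *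
        ∏ i ∈ ω, (Real.exp (bondCoupling (fun x y => 2 * K x y) h i * spin (bondChar i s)) - 1)) := by
    intro s
    rw [← Equiv.sum_comp (Equiv.mulLeft s), Finset.sum_comm]
    refine Finset.sum_congr rfl fun τ _ => ?_
    have : s * (s * τ) = τ := by
      rw [← mul_assoc]; ext v; simp [Int.units_mul_self]
    rw [Equiv.coe_mulLeft, this, boltzmann_mul_boltzmann, Finset.mul_sum]
    exact Finset.sum_congr rfl fun ω _ => by ring
  rw [Finset.sum_congr rfl fun s _ => h1 s, Finset.sum_comm]
  refine Finset.sum_congr rfl fun ω _ => ?_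
  rw [agreeSum, expansionWeight, Finset.sum_mul_sum, Finset.sum_comm]

/-- The partition function of the duplicated Ising model. -/
noncomputable def duplicateZ (K : V → V → ℝ) (h : V → ℝ) : ℝ :=
  (∑ σ, boltzmann bondChar (bondCoupling K 0) σ) * ∑ s, boltzmann bondChar (bondCoupling K h) s

lemma duplicateZ_pos (K : V → V → ℝ) (h : V → ℝ) : 0 < duplicateZ K h :=
  mul_pos (sum_boltzmann_pos _ _) (sum_boltzmann_pos _ _)

lemma sum_mass (K : V → V → ℝ) (h : V → ℝ) :
    ∑ ω, mass (bondCoupling (fun x y => 2 * K x y) h) ω = duplicateZ K h := by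
  have := sum_duplicate_eq K h (fun _ => 1) 1
  simp only [MonoidHom.one_apply, spin_one, one_mul] at this
  simp only [mass]
  rw [← this, duplicateZ, mul_comm, Finset.sum_mul_sum]
  exact Finset.sum_congr rfl fun s _ => Finset.sum_congr rfl fun σ _ => mul_comm _ _

/-- Inserting `τ_x τ_y` in the expansion keeps exactly the `ω` connecting `x` and `y`; in the
original spins the inserted factor is `σ_x σ_y s_x s_y`, whose expectation factorizes over the two
independent copies. -/
lemma sum_mass_conn (K : V → V → ℝ) (h : V → ℝ) (x y : V) :
    ∑ ω, (if Conn ω x y then mass (bondCoupling (fun x y => 2 * K x y) h) ω else 0)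
      = duplicateZ K h * ((isingExpect K 0 fun σ => spin (σ x) * spin (σ y))
        * isingExpect K h fun σ => spin (σ x) * spin (σ y)) := by
  have := sum_duplicate_eq K h (fun τ => spin (τ x) * spin (τ y)) 1
  have h1 : ∀ ω, (if Conn ω x y then mass (bondCoupling (fun x y => 2 * K x y) h) ω else 0)
      = (agreeSum ω fun τ => spin (τ x) * spin (τ y))
        * expansionWeight (bondCoupling (fun x y => 2 * K x y) h) ω 1 := by
    intro ω
    split_ifs with hxy
    · rw [agreeSum_pair_of_conn hxy, mass]
    · rw [agreeSum_pair_of_not_conn hxy, zero_mul]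
  rw [Finset.sum_congr rfl fun ω _ => h1 ω, ← this, duplicateZ, isingExpect, isingExpect, expect,
    expect, div_mul_div_comm, mul_div_cancel₀ _
      (mul_pos (sum_boltzmann_pos _ _) (sum_boltzmann_pos _ _)).ne', mul_comm (∑ g, _),
    Finset.sum_mul_sum]
  refine Finset.sum_congr rfl fun s _ => Finset.sum_congr rfl fun σ _ => ?_
  simp only [MonoidHom.one_apply, spin_one, Pi.mul_apply, spin_mul]
  ring

/-- The difference of the pair correlations with and without the field. -/
lemma sum_not_conn (K : V → V → ℝ) (h : V → ℝ) (x y : V) :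
    ∑ ω, (if Conn ω x y then 0 else (agreeSum ω fun _ => 1) *
        expansionWeight (bondCoupling (fun x y => 2 * K x y) h) ω (siteChar x * siteChar y))
      = duplicateZ K h * ((isingExpect K h fun σ => spin (σ x) * spin (σ y))
        - isingExpect K 0 fun σ => spin (σ x) * spin (σ y)) := by
  -- The observable `(1 - τ_x τ_y) s_x s_y` equals `s_x s_y - σ_x σ_y`, and its first factor
  -- suppresses the `ω` that connect `x` and `y`.
  have := sum_duplicate_eq K h (fun τ => 1 - spin (τ x) * spin (τ y)) (siteChar x * siteChar y)
  have h1 : ∀ ω, (if Conn ω x y then 0 else (agreeSum ω fun _ => 1) *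
        expansionWeight (bondCoupling (fun x y => 2 * K x y) h) ω (siteChar x * siteChar y))
      = (agreeSum ω fun τ => 1 - spin (τ x) * spin (τ y))
        * expansionWeight (bondCoupling (fun x y => 2 * K x y) h) ω (siteChar x * siteChar y) := by
    intro ω
    have h2 : (agreeSum ω fun τ => 1 - spin (τ x) * spin (τ y))
        = (agreeSum ω fun _ => 1) - agreeSum ω fun τ => spin (τ x) * spin (τ y) := by
      rw [agreeSum, agreeSum, agreeSum, ← Finset.sum_sub_distrib]
      exact Finset.sum_congr rfl fun τ _ => by ring
    split_ifs with hxy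
    · rw [h2, agreeSum_pair_of_conn hxy, sub_self, zero_mul]
    · rw [h2, agreeSum_pair_of_not_conn hxy, sub_zero]
  have hZ := sum_boltzmann_pos bondChar (bondCoupling K 0)
  have hZ' := sum_boltzmann_pos bondChar (bondCoupling K h)
  have h3 : duplicateZ K h * ((isingExpect K h fun σ => spin (σ x) * spin (σ y))
        - isingExpect K 0 fun σ => spin (σ x) * spin (σ y))
      = (∑ s, spin (s x) * spin (s y) * boltzmann bondChar (bondCoupling K h) s) *
          (∑ σ, boltzmann bondChar (bondCoupling K 0) σ)
        - (∑ s, boltzmann bondChar (bondCoupling K h) s) *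
          ∑ σ, spin (σ x) * spin (σ y) * boltzmann bondChar (bondCoupling K 0) σ := by
    rw [duplicateZ, isingExpect, isingExpect, expect, expect]
    field_simp
  rw [Finset.sum_congr rfl fun ω _ => h1 ω, ← this, h3, Finset.sum_mul_sum, Finset.sum_mul_sum,
    ← Finset.sum_sub_distrib]
  refine Finset.sum_congr rfl fun s _ => ?_
  rw [← Finset.sum_sub_distrib]
  refine Finset.sum_congr rfl fun σ _ => ?_
  simp only [MonoidHom.mul_apply, siteChar_apply, Pi.mul_apply, spin_mul]
  linear_combination (-spin (σ x) * spin (σ y) * boltzmann bondChar (bondCoupling K 0) σ *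
      boltzmann bondChar (bondCoupling K h) s) * ((spin (s x) * spin (s x)) * spin_mul_self (s y) +
        spin_mul_self (s x))

/-- The probability that the field term at `x` is open is small. -/
lemma sum_mass_field_le (K : V → V → ℝ) {h : V → ℝ} (hh : ∀ x, 0 ≤ h x) (x : V) :
    ∑ ω, (if Sum.inr x ∈ ω then mass (bondCoupling (fun x y => 2 * K x y) h) ω else 0)
      ≤ h x * duplicateZ K h := by
  set c := bondCoupling (fun x y => 2 * K x y) h with hc
  have hpt : ∀ s τ : V → ℤˣ,
      ∑ ω, (if Sum.inr x ∈ ω then agree ω τ * ∏ i ∈ ω, (Real.exp (c i * spin (bondChar i s)) - 1)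
        else 0) ≤ h x * (boltzmann bondChar (bondCoupling K 0) (s * τ) *
          boltzmann bondChar (bondCoupling K h) s) := by
    intro s τ
    set W := boltzmann bondChar (bondCoupling K 0) (s * τ) *
          boltzmann bondChar (bondCoupling K h) s with hW
    have hWpos : 0 < W := mul_pos (boltzmann_pos _ _ _) (boltzmann_pos _ _ _)
    set f : Bond V → ℝ := fun i => agreeAt τ i * (Real.exp (c i * spin (bondChar i s)) - 1) with hf
    have e0 : ∀ ω, agree ω τ * ∏ i ∈ ω, (Real.exp (c i * spin (bondChar i s)) - 1)
        = ∏ i ∈ ω, f i := fun ω => by rw [agree, ← Finset.prod_mul_distrib]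
    have e1 : W = ∏ i, (1 + f i) := by
      rw [hW, boltzmann_mul_boltzmann, Finset.prod_one_add, Finset.powerset_univ]
      exact Finset.sum_congr rfl fun ω _ => e0 ω
    have e2 : ∏ i ∈ Finset.univ.erase (Sum.inr x), (1 + f i)
        = ∑ ω, if Sum.inr x ∈ ω then 0 else ∏ i ∈ ω, f i := by
      simp only [← ite_not (Sum.inr x ∈ _)]
      rw [Finset.prod_one_add, ← Finset.sum_filter]
      refine Finset.sum_congr ?_ fun _ _ => rfl
      ext ω
      simp [Finset.subset_erase]
    have e3 : W = Real.exp (h x * spin (s x)) *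
        ∏ i ∈ Finset.univ.erase (Sum.inr x), (1 + f i) := by
      rw [e1, ← Finset.mul_prod_erase _ _ (Finset.mem_univ (Sum.inr x))]
      congr 1
      simp [hf, agreeAt, hc, bondCoupling]
    have e4 : W = (∑ ω, if Sum.inr x ∈ ω then ∏ i ∈ ω, f i else 0)
        + ∏ i ∈ Finset.univ.erase (Sum.inr x), (1 + f i) := by
      rw [e2, ← Finset.sum_add_distrib, e1, Finset.prod_one_add, Finset.powerset_univ]
      exact Finset.sum_congr rfl fun ω _ => by split_ifs <;> simp
    simp only [e0]
    -- For fixed `s` and `τ`, the configurations with the field term closed carry `exp (-h_x s_x)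
    -- W`. Those with it open carry the rest, at most `h_x W`.
    have e5 : ∏ i ∈ Finset.univ.erase (Sum.inr x), (1 + f i)
        = Real.exp (-(h x * spin (s x))) * W := by
      rw [e3, ← mul_assoc, ← Real.exp_add]; simp
    have e6 : 1 - h x ≤ Real.exp (-(h x * spin (s x))) := by
      have := Real.add_one_le_exp (-(h x * spin (s x)))
      nlinarith [hh x, spin_le_one (s x)]
    nlinarith [mul_le_mul_of_nonneg_right e6 hWpos.le]
  have h1 : ∑ ω, (if Sum.inr x ∈ ω then mass c ω else 0) = ∑ s, ∑ τ, ∑ ω,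
      (if Sum.inr x ∈ ω then agree ω τ * ∏ i ∈ ω, (Real.exp (c i * spin (bondChar i s)) - 1)
        else 0) := by
    have : ∀ s : V → ℤˣ, ∑ τ, ∑ ω, (if Sum.inr x ∈ ω then agree ω τ * ∏ i ∈ ω,
        (Real.exp (c i * spin (bondChar i s)) - 1) else 0) = ∑ ω, ∑ τ, (if Sum.inr x ∈ ω then
          agree ω τ * ∏ i ∈ ω, (Real.exp (c i * spin (bondChar i s)) - 1) else 0) :=
      fun s => Finset.sum_comm
    rw [Finset.sum_congr rfl fun s _ => this s, Finset.sum_comm]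
    refine Finset.sum_congr rfl fun ω _ => ?_
    split_ifs with hx
    · simp only [mass, agreeSum, expansionWeight, MonoidHom.one_apply, spin_one, one_mul]
      rw [Finset.sum_mul_sum, Finset.sum_comm]
    · simp
  have h2 : duplicateZ K h = ∑ s, ∑ τ, boltzmann bondChar (bondCoupling K 0) (s * τ) *
          boltzmann bondChar (bondCoupling K h) s := by
    rw [duplicateZ, mul_comm, Finset.sum_mul_sum]
    refine Finset.sum_congr rfl fun s _ => ?_
    rw [← Equiv.sum_comp (Equiv.mulLeft s)]
    exact Finset.sum_congr rfl fun τ _ => mul_comm _ _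
  rw [h1, h2, Finset.mul_sum]
  refine Finset.sum_le_sum fun s _ => ?_
  rw [Finset.mul_sum]
  exact Finset.sum_le_sum fun τ _ => hpt s τ

end Double

/-! ### Counting disjoint trifurcations by orthogonal vectors -/

section Trifurcation

open scoped Classical

lemma card_le_of_pairwise_orthogonal {β V : Type*} [Fintype V] (T : Finset β) (f : β → V → ℝ)
    (hne : ∀ t ∈ T, f t ≠ 0) (ho : ∀ s ∈ T, ∀ t ∈ T, s ≠ t → ∑ v, f s v * f t v = 0) :
    T.card ≤ Fintype.card V := by
  let F : T → EuclideanSpace ℝ V := fun t => WithLp.toLp 2 (f t)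
  have hli : LinearIndependent ℝ F := by
    refine linearIndependent_of_ne_zero_of_inner_eq_zero (𝕜 := ℝ) (fun t h0 => hne t t.2 ?_) ?_
    · funext v
      exact congrArg (fun g : EuclideanSpace ℝ V => g v) h0
    · intro s t hst
      have := ho t t.2 s s.2 fun h => hst (Subtype.ext h.symm)
      rw [PiLp.inner_apply]
      simpa [F, mul_comm] using this
  simpa using hli.fintype_card_le_finrank

variable {V : Type*} [DecidableEq V] {ω : Finset (Bond V)}

/-- Removing one block does not disconnect the parts that do not meet that block. -/
lemma conn_sdiff_of_away {Rs Rt : Finset (Bond V)} {Bt : Set V}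
    (hRt : ∀ x y, Sum.inl (x, y) ∈ Rt → x ∈ Bt ∧ y ∈ Bt) {a v : V}
    (haway : ∀ b ∈ Bt, ¬ Conn (ω \ Rs) a b) (h : Conn (ω \ Rs) a v) : Conn (ω \ Rt) a v := by
  have key := h.iff_of_forall (p := fun v => Conn (ω \ Rs) a v → Conn (ω \ Rt) a v) ?_
  · exact (eq_iff_iff.1 key).1 (fun _ => Conn.refl a) h
  · intro u w huw
    have h1 : Conn (ω \ Rs) a u ↔ Conn (ω \ Rs) a w :=
      ⟨fun h => h.trans (Conn.of_mem huw), fun h => h.trans (Conn.of_mem huw).symm⟩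
    refine propext ⟨fun hp hw => ?_, fun hp hu => ?_⟩
    · have hu := h1.2 hw
      have : Sum.inl (u, w) ∈ ω \ Rt := Finset.mem_sdiff.2 ⟨(Finset.mem_sdiff.1 huw).1,
        fun hR => haway u (hRt u w hR).1 hu⟩
      exact (hp hu).trans (Conn.of_mem this)
    · have hw := h1.1 hu
      have : Sum.inl (u, w) ∈ ω \ Rt := Finset.mem_sdiff.2 ⟨(Finset.mem_sdiff.1 huw).1,
        fun hR => haway u (hRt u w hR).1 hu⟩
      exact (hp hw).trans (Conn.of_mem this).symm

/-- A site connected to one of two blocks is connected to one of them without using the other. -/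
lemma conn_sdiff_or {Rs Rt : Finset (Bond V)} {Bs Bt : Set V}
    (hRs : ∀ x y, Sum.inl (x, y) ∈ Rs → x ∈ Bs ∧ y ∈ Bs)
    (hRt : ∀ x y, Sum.inl (x, y) ∈ Rt → x ∈ Bt ∧ y ∈ Bt) {r b : V} (hb : b ∈ Bt)
    (h : Conn ω b r) : (∃ u ∈ Bt, Conn (ω \ Rs) r u) ∨ ∃ u ∈ Bs, Conn (ω \ Rt) r u := by
  have key := h.iff_of_forall
    (p := fun r => (∃ u ∈ Bt, Conn (ω \ Rs) r u) ∨ ∃ u ∈ Bs, Conn (ω \ Rt) r u) ?_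
  · exact (eq_iff_iff.1 key).1 (Or.inl ⟨b, hb, Conn.refl b⟩)
  · intro x y hxy
    by_cases hs : Sum.inl (x, y) ∈ Rs
    · exact propext (iff_of_true (Or.inr ⟨x, (hRs x y hs).1, Conn.refl x⟩)
        (Or.inr ⟨y, (hRs x y hs).2, Conn.refl y⟩))
    by_cases ht : Sum.inl (x, y) ∈ Rt
    · exact propext (iff_of_true (Or.inl ⟨x, (hRt x y ht).1, Conn.refl x⟩)
        (Or.inl ⟨y, (hRt x y ht).2, Conn.refl y⟩))
    have h1 : Conn (ω \ Rs) x y := Conn.of_mem (Finset.mem_sdiff.2 ⟨hxy, hs⟩)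
    have h2 : Conn (ω \ Rt) x y := Conn.of_mem (Finset.mem_sdiff.2 ⟨hxy, ht⟩)
    refine propext (or_congr ?_ ?_)
    · exact ⟨fun ⟨u, hu, h⟩ => ⟨u, hu, h1.symm.trans h⟩, fun ⟨u, hu, h⟩ => ⟨u, hu, h1.trans h⟩⟩
    · exact ⟨fun ⟨u, hu, h⟩ => ⟨u, hu, h2.symm.trans h⟩, fun ⟨u, hu, h⟩ => ⟨u, hu, h2.trans h⟩⟩

/-- The block `B` (connected through `R`) is a trifurcation of `ω`: without the pairs in `R`, it
meets three distinct clusters that are connected to the field. -/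
def Trifurcation (ω R : Finset (Bond V)) (B : Set V) : Prop :=
  ∃ x₁ ∈ B, ∃ x₂ ∈ B, ∃ x₃ ∈ B, ¬ Conn (ω \ R) x₁ x₂ ∧ ¬ Conn (ω \ R) x₁ x₃ ∧
    ¬ Conn (ω \ R) x₂ x₃ ∧ ConnField (ω \ R) x₁ ∧ ConnField (ω \ R) x₂ ∧ ConnField (ω \ R) x₃

/-- There are at most as many disjoint trifurcations as there are sites with an open field term. -/
lemma card_trifurcation_le [Fintype V] {β : Type*} (T : Finset β) (B : β → Set V)
    (R : β → Finset (Bond V))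
    (hRB : ∀ t ∈ T, ∀ x y, Sum.inl (x, y) ∈ R t → x ∈ B t ∧ y ∈ B t)
    (hRF : ∀ t ∈ T, ∀ x, Sum.inr x ∉ R t)
    (hconn : ∀ t ∈ T, ∀ x ∈ B t, ∀ y ∈ B t, Conn (R t) x y)
    (hdisj : ∀ s ∈ T, ∀ t ∈ T, s ≠ t → Disjoint (B s) (B t))
    (hR : ∀ t ∈ T, R t ⊆ ω) (htri : ∀ t ∈ T, Trifurcation ω (R t) (B t)) :
    T.card ≤ (Finset.univ.filter fun v => Sum.inr v ∈ ω).card := by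
  have hsub : ∀ s ∈ T, ∀ t ∈ T, s ≠ t → R t ⊆ ω \ R s := by
    intro s hs t ht hst i hi
    refine Finset.mem_sdiff.2 ⟨hR t ht hi, fun his => ?_⟩
    rcases i with ⟨x, y⟩ | x
    · exact Set.disjoint_left.1 (hdisj s hs t ht hst) (hRB s hs x y his).1 (hRB t ht x y hi).1
    · exact hRF t ht x hi
  -- A root is fixed in each cluster of `ω`. At most one of the three branches at a trifurcation
  -- contains the root, and `htwo` keeps two branches that do not.
  have hrep : ∃ rep : V → V, (∀ a, Conn ω a (rep a)) ∧ ∀ a b, Conn ω a b → rep a = rep b := by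
    let S : Setoid V := ⟨Conn ω, ⟨Conn.refl, Conn.symm, Conn.trans⟩⟩
    refine ⟨fun a => (Quotient.mk S a).out, fun a => ?_, fun a b hab => ?_⟩
    · exact (Quotient.exact (s := S) (Quotient.out_eq (Quotient.mk S a))).symm
    · exact congrArg Quotient.out (Quotient.sound (s := S) hab)
  obtain ⟨rep, hrep1, hrep2⟩ := hrep
  have htwo : ∀ t ∈ T, ∃ y : Bool → V, (∀ i, y i ∈ B t) ∧ ¬ Conn (ω \ R t) (y true) (y false) ∧
      (∀ i, ConnField (ω \ R t) (y i)) ∧ ∀ i, ¬ Conn (ω \ R t) (y i) (rep (y i)) := by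
    intro t ht
    obtain ⟨x₁, h₁, x₂, h₂, x₃, h₃, h12, h13, h23, f1, f2, f3⟩ := htri t ht
    have hr : ∀ x ∈ B t, rep x = rep x₁ := fun x hx =>
      hrep2 _ _ ((hconn t ht x hx x₁ h₁).mono (hR t ht))
    have key : ∀ a ∈ B t, ∀ b ∈ B t, ¬ Conn (ω \ R t) a b → ConnField (ω \ R t) a →
        ConnField (ω \ R t) b → ¬ Conn (ω \ R t) a (rep x₁) → ¬ Conn (ω \ R t) b (rep x₁) →
        ∃ y : Bool → V, (∀ i, y i ∈ B t) ∧ ¬ Conn (ω \ R t) (y true) (y false) ∧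
      (∀ i, ConnField (ω \ R t) (y i)) ∧ ∀ i, ¬ Conn (ω \ R t) (y i) (rep (y i)) := by
      intro a ha b hb hab fa fb ra rb
      refine ⟨fun i => if i then a else b, ?_, by simpa using hab, ?_, ?_⟩
      · rintro (_ | _) <;> simp [ha, hb]
      · rintro (_ | _) <;> simp [fa, fb]
      · rintro (_ | _)
        · simpa [hr b hb] using rb
        · simpa [hr a ha] using ra
    by_cases r1 : Conn (ω \ R t) x₁ (rep x₁)
    · exact key x₂ h₂ x₃ h₃ h23 f2 f3 (fun h => h12 (r1.trans h.symm))
        fun h => h13 (r1.trans h.symm)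
    by_cases r2 : Conn (ω \ R t) x₂ (rep x₁)
    · exact key x₁ h₁ x₃ h₃ h13 f1 f3 r1 fun h => h23 (r2.trans h.symm)
    · exact key x₁ h₁ x₂ h₂ h12 f1 f2 r1 r2
  rcases T.eq_empty_or_nonempty with rfl | ⟨t₀, ht₀⟩
  · simp
  have : Nonempty V := (htwo t₀ ht₀).nonempty.map (· true)
  choose! y hyB hyne hyF hyrep using htwo
  let D : β → Bool → {v // Sum.inr v ∈ ω} → ℝ := fun t i v =>
    if Conn (ω \ R t) (y t i) v then 1 else 0
  have hDpos : ∀ t ∈ T, ∀ i, 0 < ∑ v, D t i v := by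
    intro t ht i
    obtain ⟨v, hv, hv'⟩ := hyF t ht i
    refine Finset.sum_pos' (fun v _ => by simp only [D]; split_ifs <;> norm_num)
      ⟨⟨v, (Finset.mem_sdiff.1 hv').1⟩, Finset.mem_univ _, by simp [D, hv]⟩
  -- To `t` corresponds the uniform distribution on the open field sites of one branch minus that of
  -- the other: a nonzero vector of total sum zero. Pairwise orthogonality then bounds the number of
  -- trifurcations by the dimension.
  let f : β → {v // Sum.inr v ∈ ω} → ℝ := fun t v =>
    D t true v / ∑ w, D t true w - D t false v / ∑ w, D t false w
  have hfsum : ∀ t ∈ T, ∑ v, f t v = 0 := by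
    intro t ht
    simp only [f, Finset.sum_sub_distrib, ← Finset.sum_div]
    rw [div_self (hDpos t ht true).ne', div_self (hDpos t ht false).ne', sub_self]
  have hfne : ∀ t ∈ T, f t ≠ 0 := by
    intro t ht h0
    obtain ⟨v, hv, hv'⟩ := hyF t ht true
    have h1 := congrFun h0 ⟨v, (Finset.mem_sdiff.1 hv').1⟩
    have h2 : ¬ Conn (ω \ R t) (y t false) v := fun h => hyne t ht (hv.trans h.symm)
    have h3 : f t ⟨v, (Finset.mem_sdiff.1 hv').1⟩ = 1 / ∑ w, D t true w := by
      simp [f, D, hv, h2]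
    rw [h3] at h1
    exact (one_div_pos.2 (hDpos t ht true)).ne' h1
  -- If the chosen branches of `s` avoid the block of `t`, they remain joined to each other through
  -- the block of `s` without `R t`. So `f t` is constant on the support of `f s`, and `∑ f s = 0`
  -- gives orthogonality.
  have horth : ∀ s ∈ T, ∀ t ∈ T, s ≠ t → (∀ i, ∀ b ∈ B t, ¬ Conn (ω \ R s) (y s i) b) →
      ∑ v, f s v * f t v = 0 := by
    intro s hs t ht hst haway
    have hc : ∀ v : {v // Sum.inr v ∈ ω}, ∀ i, Conn (ω \ R s) (y s i) v →
        Conn (ω \ R t) (y s true) v := by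
      intro v i hv
      refine Conn.trans ?_ (conn_sdiff_of_away (hRB t ht) (haway i) hv)
      exact (hconn s hs _ (hyB s hs true) _ (hyB s hs i)).mono (hsub t ht s hs hst.symm)
    have hft : ∀ v w : {v // Sum.inr v ∈ ω}, Conn (ω \ R t) v w → f t v = f t w := by
      intro v w hvw
      have : ∀ i, Conn (ω \ R t) (y t i) v ↔ Conn (ω \ R t) (y t i) w :=
        fun i => ⟨fun h => h.trans hvw, fun h => h.trans hvw.symm⟩
      simp only [f, D, this]
    obtain ⟨v₀, hv₀, hv₀'⟩ := hyF s hs true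
    set w₀ : {v // Sum.inr v ∈ ω} := ⟨v₀, (Finset.mem_sdiff.1 hv₀').1⟩
    have hmul : ∀ v, f s v * f t v = f s v * f t w₀ := by
      intro v
      by_cases hv : ∃ i, Conn (ω \ R s) (y s i) v
      · obtain ⟨i, hi⟩ := hv
        rw [hft v w₀ ((hc v i hi).symm.trans (hc w₀ true hv₀))]
      · push Not at hv
        have : f s v = 0 := by simp [f, D, hv]
        rw [this, zero_mul, zero_mul]
    rw [Finset.sum_congr rfl fun v _ => hmul v, ← Finset.sum_mul, hfsum s hs, zero_mul]
  have := card_le_of_pairwise_orthogonal T f hfne ?_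
  · rwa [Fintype.card_subtype] at this
  intro s hs t ht hst
  by_cases h1 : ∀ i, ∀ b ∈ B t, ¬ Conn (ω \ R s) (y s i) b
  · exact horth s hs t ht hst h1
  by_cases h2 : ∀ i, ∀ b ∈ B s, ¬ Conn (ω \ R t) (y t i) b
  · rw [← horth t ht s hs hst.symm h2]
    exact Finset.sum_congr rfl fun v _ => mul_comm _ _
  -- Otherwise a chosen branch of `s` meets the block of `t` and vice versa, so both blocks lie in
  -- one cluster. Its root reaches one block without using the bonds of the other and hence lies in
  -- a chosen branch, a contradiction.
  exfalso
  push Not at h1 h2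
  obtain ⟨i, b, hb, hib⟩ := h1
  obtain ⟨j, b', hb', hjb'⟩ := h2
  have hr : rep (y s i) = rep b := hrep2 _ _ (hib.mono Finset.sdiff_subset)
  have hr' : rep (y t j) = rep b :=
    hrep2 _ _ ((hconn t ht _ (hyB t ht j) b hb).mono (hR t ht))
  rcases conn_sdiff_or (hRB s hs) (hRB t ht) hb (hrep1 b) with ⟨u, hu, hru⟩ | ⟨u, hu, hru⟩
  · refine hyrep s hs i ?_
    rw [hr]
    exact hib.trans (((hconn t ht b hb u hu).mono (hsub s hs t ht hst)).trans hru.symm)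
  · refine hyrep t ht j ?_
    rw [hr']
    exact hjb'.trans (((hconn s hs b' hb' u hu).mono (hsub t ht s hs hst.symm)).trans hru.symm)

end Trifurcation

/-! ### Trifurcations have positive probability -/

section Blocks

open scoped Classical

/-- The set `S` meets three distinct clusters of `ω` that are connected to the field. -/
def MeetsThree {V : Type*} (ω : Finset (Bond V)) (S : Finset V) : Prop :=
  ∃ x₁ ∈ S, ∃ x₂ ∈ S, ∃ x₃ ∈ S, ¬ Conn ω x₁ x₂ ∧ ¬ Conn ω x₁ x₃ ∧ ¬ Conn ω x₂ x₃ ∧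
    ConnField ω x₁ ∧ ConnField ω x₂ ∧ ConnField ω x₃

/-- Take `y` to be the last visit to `B` of a path from `x` to `v`: since the pairs of `R` lie in
`B`, none is used afterwards. -/
lemma exists_conn_sdiff {V : Type*} [DecidableEq V] {ω R : Finset (Bond V)} {B : Set V}
    (hRB : ∀ x y, Sum.inl (x, y) ∈ R → x ∈ B ∧ y ∈ B) {x v : V} (hx : x ∈ B) (h : Conn ω x v) :
    ∃ y ∈ B, Conn (ω \ R) y v ∧ Conn ω x y := by
  have key := h.iff_of_forall (p := fun v => ∃ y ∈ B, Conn (ω \ R) y v ∧ Conn ω x y) ?_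
  · exact (eq_iff_iff.1 key).1 ⟨x, hx, Conn.refl x, Conn.refl x⟩
  · have step : ∀ a b, Conn ω a b → (Conn (ω \ R) a b ∨ b ∈ B) →
        (∃ y ∈ B, Conn (ω \ R) y a ∧ Conn ω x y) → ∃ y ∈ B, Conn (ω \ R) y b ∧ Conn ω x y := by
      rintro a b hab (h' | hb) ⟨y, hy, hya, hxy⟩
      · exact ⟨y, hy, hya.trans h', hxy⟩
      · exact ⟨b, hb, Conn.refl b, hxy.trans ((hya.mono Finset.sdiff_subset).trans hab)⟩
    intro a b hab
    have hc : Conn ω a b := Conn.of_mem hab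
    by_cases hR : Sum.inl (a, b) ∈ R
    · exact propext ⟨step a b hc (Or.inr (hRB a b hR).2),
        step b a hc.symm (Or.inr (hRB a b hR).1)⟩
    · have h' : Conn (ω \ R) a b := Conn.of_mem (Finset.mem_sdiff.2 ⟨hab, hR⟩)
      exact propext ⟨step a b hc (Or.inl h'), step b a hc.symm (Or.inl h'.symm)⟩

/-- Distinct clusters of `ω` stay distinct in `ω \ R`, which equals `(ω ∪ R) \ R`. Each of the three
paths to the field is cut at its last visit to `B`, so that it survives the removal of `R`. -/
lemma MeetsThree.trifurcation {V : Type*} [DecidableEq V] {ω R : Finset (Bond V)} {B : Set V} {S : Finset V}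
    (hS : ∀ x ∈ S, x ∈ B) (hRB : ∀ x y, Sum.inl (x, y) ∈ R → x ∈ B ∧ y ∈ B)
    (hRF : ∀ x, Sum.inr x ∉ R) (h : MeetsThree ω S) : Trifurcation (ω ∪ R) R B := by
  have key : ∀ x ∈ S, ConnField ω x → ∃ y ∈ B, ConnField (ω \ R) y ∧ Conn ω x y := by
    rintro x hx ⟨v, hv, hv'⟩
    obtain ⟨y, hy, hyv, hxy⟩ := exists_conn_sdiff hRB (hS x hx) hv
    exact ⟨y, hy, ⟨v, hyv, Finset.mem_sdiff.2 ⟨hv', hRF v⟩⟩, hxy⟩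
  obtain ⟨x₁, h₁, x₂, h₂, x₃, h₃, h12, h13, h23, f1, f2, f3⟩ := h
  obtain ⟨y₁, b1, g1, c1⟩ := key x₁ h₁ f1
  obtain ⟨y₂, b2, g2, c2⟩ := key x₂ h₂ f2
  obtain ⟨y₃, b3, g3, c3⟩ := key x₃ h₃ f3
  have hne : ∀ {a b a' b' : V}, Conn ω a a' → Conn ω b b' → ¬ Conn ω a b →
      ¬ Conn (ω \ R) a' b' := fun ha hb hab h' =>
    hab (ha.trans ((h'.mono Finset.sdiff_subset).trans hb.symm))
  rw [Trifurcation, Finset.union_sdiff_right]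
  exact ⟨y₁, b1, y₂, b2, y₃, b3, hne c1 c2 h12, hne c1 c3 h13, hne c2 c3 h23, g1, g2, g3⟩

/-- The relation splits `N` into at most two classes, of sizes `a` and `a'`, and `(a + a')² ≤ 2 (a²
+ a'²)`. -/
lemma sq_card_le_of_not_three {V : Type*} (r : V → V → Prop)
    (hsymm : ∀ x y, r x y → r y x) (htrans : ∀ x y z, r x y → r y z → r x z) (N : Finset V)
    (h : ¬ ∃ x₁ ∈ N, ∃ x₂ ∈ N, ∃ x₃ ∈ N, ¬ r x₁ x₂ ∧ ¬ r x₁ x₃ ∧ ¬ r x₂ x₃) :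
    (N.card : ℝ) ^ 2 ≤ 2 * ∑ x ∈ N, ∑ y ∈ N, if r x y then (1 : ℝ) else 0 := by
  rcases N.eq_empty_or_nonempty with rfl | ⟨x, hx⟩
  · simp
  set A := N.filter fun y => r x y
  set A' := N.filter fun y => ¬ r x y
  have hsum : ∀ f : V → ℝ, ∑ y ∈ N, f y = ∑ y ∈ A, f y + ∑ y ∈ A', f y :=
    fun f => (Finset.sum_filter_add_sum_filter_not N _ f).symm
  have h1 : ∀ C : Finset V, C ⊆ N → (∀ a ∈ C, ∀ b ∈ C, r a b) →
      (C.card : ℝ) ^ 2 ≤ ∑ a ∈ C, ∑ b ∈ N, if r a b then (1 : ℝ) else 0 := by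
    intro C hCN hC
    have : ∀ a ∈ C, (C.card : ℝ) ≤ ∑ b ∈ N, if r a b then (1 : ℝ) else 0 := by
      intro a ha
      calc (C.card : ℝ) = ∑ b ∈ C, if r a b then (1 : ℝ) else 0 := by
            rw [Finset.sum_congr rfl fun b hb => if_pos (hC a ha b hb)]; simp
        _ ≤ _ := Finset.sum_le_sum_of_subset_of_nonneg hCN fun b _ _ => by
            split_ifs <;> norm_num
    calc (C.card : ℝ) ^ 2 = ∑ a ∈ C, (C.card : ℝ) := by simp [sq]
      _ ≤ _ := Finset.sum_le_sum this
  have hA := h1 A (Finset.filter_subset _ _) fun a ha b hb =>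
    htrans _ _ _ (hsymm _ _ (Finset.mem_filter.1 ha).2) (Finset.mem_filter.1 hb).2
  have hA' := h1 A' (Finset.filter_subset _ _) fun a ha b hb => by
    by_contra hab
    exact h ⟨x, hx, a, (Finset.mem_filter.1 ha).1, b, (Finset.mem_filter.1 hb).1,
      (Finset.mem_filter.1 ha).2, (Finset.mem_filter.1 hb).2, hab⟩
  have hc : (N.card : ℝ) = A.card + A'.card := by
    have := hsum fun _ => 1
    simpa using this
  rw [hsum, hc]
  nlinarith [sq_nonneg ((A.card : ℝ) - A'.card)]

variable {V : Type*} [Fintype V] [DecidableEq V]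

/-- If the field changes the correlation of `x` and `y`, then `x` is connected to the field with a
positive probability. -/
lemma sum_mass_connField_ge {K : V → V → ℝ} {h : V → ℝ} (hK : ∀ x y, 0 ≤ K x y)
    (hh : ∀ x, 0 ≤ h x) {x y : V} (l : List (V × V)) (hl : ∀ p ∈ l, 0 < K p.1 p.2)
    (hprod : (l.map fun p => bondChar (Sum.inl p)).prod = siteChar x * siteChar y) :
    duplicateZ K h * ((isingExpect K h fun σ => spin (σ x) * spin (σ y))
        - isingExpect K 0 fun σ => spin (σ x) * spin (σ y))
      ≤ (4 ^ l.length * (l.map fun p => sourceConst (2 * K p.1 p.2)).prod) *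
        ∑ ω, if ConnField ω x then mass (bondCoupling (fun x y => 2 * K x y) h) ω else 0 := by
  set c := bondCoupling (fun x y => 2 * K x y) h with hc
  have hc0 : ∀ i, 0 ≤ c i := bondCoupling_nonneg (fun x y => by linarith [hK x y]) hh
  set L : List (Bond V) := l.map Sum.inl with hL
  have hLc : L.toFinset.card ≤ l.length := by
    simpa [hL] using L.toFinset_card_le
  have hLpos : ∀ i ∈ L, 0 < c i := by
    intro i hi
    obtain ⟨p, hp, rfl⟩ := List.mem_map.1 hi
    have := hl p hp
    simp only [hc, bondCoupling]; linarith
  have hsrc : (L.map fun i => sourceConst (c i)).prod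
      = (l.map fun p => sourceConst (2 * K p.1 p.2)).prod := by
    rw [hL, List.map_map]; rfl
  have hsrc0 : 0 ≤ (l.map fun p => sourceConst (2 * K p.1 p.2)).prod := by
    refine List.prod_nonneg fun a ha => ?_
    obtain ⟨p, hp, rfl⟩ := List.mem_map.1 ha
    exact sourceConst_nonneg (by linarith [hl p hp])
  set M := (l.map fun p => sourceConst (2 * K p.1 p.2)).prod with hM
  have hpow : ∀ E : ℕ, E ≤ l.length → (2 : ℝ) ^ E ≤ 2 ^ l.length := fun E hE =>
    pow_le_pow_right₀ one_le_two hE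
  rw [← sum_not_conn]
  -- Opening the path replaces the two sources by open bonds, and `x` stays connected to the field.
  -- One power `2 ^ l.length` comes from `agreeSum`, the other, below, from the multiplicity of `ω ↦
  -- ω ∪ L.toFinset`.
  have hpt : ∀ ω, (if Conn ω x y then 0 else (agreeSum ω fun _ => 1) *
        expansionWeight c ω (siteChar x * siteChar y))
      ≤ 2 ^ l.length * M * (if ConnField (ω ∪ L.toFinset) x then mass c (ω ∪ L.toFinset)
        else 0) := by
    intro ω
    have hnn : 0 ≤ 2 ^ l.length * M * (if ConnField (ω ∪ L.toFinset) x then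
        mass c (ω ∪ L.toFinset) else 0) := by
      refine mul_nonneg (by positivity) ?_
      split_ifs
      · exact mass_nonneg hc0 _
      · exact le_rfl
    split_ifs with h1 h2 h2
    · simpa [h2] using hnn
    · simp
    · have h3 := expansionWeight_mul_prod_le hc0 ω L hLpos 1
      rw [one_mul, hsrc, hL, List.map_map] at h3
      rw [← hprod]
      have h4 := agreeSum_le_union ω L.toFinset
      have h5 : 0 ≤ expansionWeight c ω (List.map (bondChar ∘ Sum.inl) l).prod :=
        expansionWeight_nonneg hc0 _ _
      have h6 : (agreeSum ω fun _ => 1) ≤ 2 ^ l.length * agreeSum (ω ∪ L.toFinset) fun _ => 1 :=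
        h4.trans (mul_le_mul_of_nonneg_right (hpow _ hLc) (agreeSum_one_nonneg _))
      have h7 := mul_le_mul h6 h3 h5 (mul_nonneg (by positivity) (agreeSum_one_nonneg _))
      refine h7.trans_eq ?_
      rw [mass]; ring
    · have h3 : ¬ ConnField ω x := fun h' => h2 (h'.mono Finset.subset_union_left)
      have h4 : expansionWeight c ω (siteChar x * siteChar y) = 0 := by
        by_contra h5
        exact h3 (connField_of_expansionWeight_ne_zero h1 h5)
      simp [h4]
  refine (Finset.sum_le_sum fun ω _ => hpt ω).trans ?_
  rw [← Finset.mul_sum]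
  have hg : ∀ ω, 0 ≤ (if ConnField ω x then mass c ω else 0) := fun ω => by
    split_ifs
    · exact mass_nonneg hc0 _
    · exact le_rfl
  have h8 := sum_union_le hg L.toFinset
  have h9 : ∑ ω, (if ConnField (ω ∪ L.toFinset) x then mass c (ω ∪ L.toFinset) else 0)
      ≤ 2 ^ l.length * ∑ ω, (if ConnField ω x then mass c ω else 0) :=
    h8.trans (mul_le_mul_of_nonneg_right (hpow _ hLc) (Finset.sum_nonneg fun ω _ => hg ω))
  calc _ ≤ 2 ^ l.length * M * (2 ^ l.length * ∑ ω, (if ConnField ω x then mass c ω else 0)) :=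
        mul_le_mul_of_nonneg_left h9 (by positivity)
    _ = _ := by
      rw [show (4 : ℝ) ^ l.length = 2 ^ l.length * 2 ^ l.length by rw [← mul_pow]; norm_num]
      ring

lemma isingExpect_pair_le_one (K : V → V → ℝ) (h : V → ℝ) (x y : V) :
    (isingExpect K h fun σ => spin (σ x) * spin (σ y)) ≤ 1 := by
  rw [isingExpect, expect, div_le_one (sum_boltzmann_pos _ _)]
  refine Finset.sum_le_sum fun σ _ => mul_le_of_le_one_left (boltzmann_pos _ _ _).le ?_
  rw [← spin_mul]
  exact spin_le_one _

lemma isingExpect_pair_nonneg {K : V → V → ℝ} {h : V → ℝ} (hK : ∀ x y, 0 ≤ K x y)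
    (hh : ∀ x, 0 ≤ h x) (x y : V) : 0 ≤ isingExpect K h fun σ => spin (σ x) * spin (σ y) := by
  have := expect_char_nonneg bondChar (bondCoupling_nonneg hK hh) (siteChar x * siteChar y)
  simpa [isingExpect, spin_mul] using this

/-- If the sites of `S` are connected to the field, but the average correlation in `S` without the
field is small, then `S` meets three clusters connected to the field. -/
lemma sum_mass_meetsThree_ge {K : V → V → ℝ} {h : V → ℝ} (hK : ∀ x y, 0 ≤ K x y)
    (hh : ∀ x, 0 ≤ h x) {S : Finset V} (hS : S.Nonempty) {p : ℝ} (hp : 0 < p)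
    (hperc : ∀ x ∈ S, p * duplicateZ K h
      ≤ ∑ ω, if ConnField ω x then mass (bondCoupling (fun x y => 2 * K x y) h) ω else 0)
    (hpair : ∑ x ∈ S, ∑ y ∈ S, (isingExpect K 0 fun σ => spin (σ x) * spin (σ y))
      ≤ p ^ 2 / 4 * (S.card : ℝ) ^ 2) :
    p / 4 * duplicateZ K h
      ≤ ∑ ω, if MeetsThree ω S then mass (bondCoupling (fun x y => 2 * K x y) h) ω else 0 := by
  set c := bondCoupling (fun x y => 2 * K x y) h with hc
  have hc0 : ∀ i, 0 ≤ c i := bondCoupling_nonneg (fun x y => by linarith [hK x y]) hh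
  set Z := duplicateZ K h
  have hZ : 0 < Z := duplicateZ_pos K h
  set n : ℝ := (S.card : ℝ) with hn
  have hn0 : 0 < n := Nat.cast_pos.2 hS.card_pos
  set N : Finset (Bond V) → ℝ := fun ω => ∑ x ∈ S, if ConnField ω x then 1 else 0 with hN
  set Q : Finset (Bond V) → ℝ := fun ω => ∑ x ∈ S, ∑ y ∈ S, if Conn ω x y then 1 else 0 with hQ
  have hQ0 : ∀ ω, 0 ≤ Q ω := fun ω => Finset.sum_nonneg fun x _ => Finset.sum_nonneg fun y _ => by
    split_ifs <;> norm_num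
  -- `N` counts the sites of `S` connected to the field and `Q` the connected ordered pairs in `S`.
  -- Without three clusters, `N² ≤ 2 Q`, whence `N ≤ p n / 2 + Q / (p n)`. On average `N` is at
  -- least `p n` and `Q / (p n)` at most `p n / 4`, which leaves `p n / 4` for the event of three
  -- clusters.
  have hpt : ∀ ω, N ω * mass c ω ≤ n * (if MeetsThree ω S then mass c ω else 0)
      + (p * n / 2) * mass c ω + (Q ω * mass c ω) / (p * n) := by
    intro ω
    have hm := mass_nonneg hc0 ω
    split_ifs with h3
    · have h4 : N ω ≤ n := by
        calc N ω ≤ ∑ x ∈ S, (1 : ℝ) :=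
              Finset.sum_le_sum fun x _ => by split_ifs <;> norm_num
          _ = n := by simp [hn]
      have h5 : N ω * mass c ω ≤ n * mass c ω := mul_le_mul_of_nonneg_right h4 hm
      have h6 : 0 ≤ (p * n / 2) * mass c ω := by positivity
      have h7 : 0 ≤ (Q ω * mass c ω) / (p * n) := by
        have := hQ0 ω; positivity
      linarith
    · have h4 : N ω ^ 2 ≤ 2 * Q ω := by
        have h5 := sq_card_le_of_not_three (Conn ω) (fun _ _ h => h.symm)
          (fun _ _ _ h h' => h.trans h') (S.filter fun x => ConnField ω x) (by
            rintro ⟨x₁, h₁, x₂, h₂, x₃, h₃, h12, h13, h23⟩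
            simp only [Finset.mem_filter] at h₁ h₂ h₃
            exact h3 ⟨x₁, h₁.1, x₂, h₂.1, x₃, h₃.1, h12, h13, h23, h₁.2, h₂.2, h₃.2⟩)
        have h6 : N ω = ((S.filter fun x => ConnField ω x).card : ℝ) := by
          simp [hN]
        rw [h6]
        refine h5.trans (mul_le_mul_of_nonneg_left ?_ zero_le_two)
        refine (Finset.sum_le_sum_of_subset_of_nonneg (Finset.filter_subset _ S) ?_).trans
          (Finset.sum_le_sum fun x _ =>
            Finset.sum_le_sum_of_subset_of_nonneg (Finset.filter_subset _ S) ?_)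
        · intro x _ _
          exact Finset.sum_nonneg fun y _ => by split_ifs <;> norm_num
        · intro y _ _
          split_ifs <;> norm_num
      have h7 : N ω ≤ p * n / 2 + Q ω / (p * n) := by
        have hpn : 0 < p * n := by positivity
        have h8 : N ω * (p * n) ≤ (p * n) ^ 2 / 2 + Q ω := by
          nlinarith [sq_nonneg (N ω - p * n)]
        have h9 : p * n / 2 + Q ω / (p * n) = ((p * n) ^ 2 / 2 + Q ω) / (p * n) := by
          field_simp
        rw [h9, le_div_iff₀ hpn]
        exact h8
      have := mul_le_mul_of_nonneg_right h7 hm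
      calc _ ≤ _ := this
        _ = _ := by ring
  have hsum := Finset.sum_le_sum fun ω (_ : ω ∈ Finset.univ) => hpt ω
  rw [Finset.sum_add_distrib, Finset.sum_add_distrib, ← Finset.mul_sum, ← Finset.mul_sum,
    ← Finset.sum_div, sum_mass] at hsum
  have hNsum : p * Z * n ≤ ∑ ω, N ω * mass c ω := by
    have : ∑ ω, N ω * mass c ω = ∑ x ∈ S, ∑ ω, if ConnField ω x then mass c ω else 0 := by
      rw [Finset.sum_comm]
      refine Finset.sum_congr rfl fun ω _ => ?_
      rw [hN, Finset.sum_mul]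
      exact Finset.sum_congr rfl fun x _ => by split_ifs <;> simp
    rw [this]
    calc p * Z * n = ∑ x ∈ S, p * Z := by simp [hn, mul_comm]
      _ ≤ _ := Finset.sum_le_sum hperc
  have hQsum : ∑ ω, Q ω * mass c ω ≤ Z * (p ^ 2 / 4 * n ^ 2) := by
    have : ∑ ω, Q ω * mass c ω = ∑ x ∈ S, ∑ y ∈ S, ∑ ω, if Conn ω x y then mass c ω else 0 := by
      have e1 : ∀ ω, Q ω * mass c ω = ∑ x ∈ S, ∑ y ∈ S, if Conn ω x y then mass c ω else 0 := by
        intro ω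
        rw [hQ, Finset.sum_mul]
        refine Finset.sum_congr rfl fun x _ => ?_
        rw [Finset.sum_mul]
        exact Finset.sum_congr rfl fun y _ => by split_ifs <;> simp
      rw [Finset.sum_congr rfl fun ω _ => e1 ω, Finset.sum_comm]
      exact Finset.sum_congr rfl fun x _ => Finset.sum_comm
    rw [this]
    refine le_trans ?_ (mul_le_mul_of_nonneg_left hpair hZ.le)
    rw [Finset.mul_sum]
    refine Finset.sum_le_sum fun x _ => ?_
    rw [Finset.mul_sum]
    refine Finset.sum_le_sum fun y _ => ?_
    rw [hc, sum_mass_conn]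
    refine mul_le_mul_of_nonneg_left ?_ hZ.le
    exact mul_le_of_le_one_right (isingExpect_pair_nonneg hK (fun _ => le_rfl) x y)
      (isingExpect_pair_le_one K h x y)
  have hQ' : (∑ ω, Q ω * mass c ω) / (p * n) ≤ Z * p * n / 4 := by
    rw [div_le_iff₀ (by positivity)]
    calc _ ≤ _ := hQsum
      _ = _ := by ring
  have hfin : n * (p / 4 * Z) ≤ n * ∑ ω, (if MeetsThree ω S then mass c ω else 0) := by
    nlinarith
  exact le_of_mul_le_mul_left hfin hn0

/-- Many disjoint blocks that all meet three clusters connected to the field need a strong field. -/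
lemma card_mul_le_sum_field {K : V → V → ℝ} {h : V → ℝ} (hK : ∀ x y, 0 ≤ K x y)
    (hh : ∀ x, 0 ≤ h x) {β : Type*} (T : Finset β) (B : β → Set V) (S : β → Finset V)
    (R : β → Finset (Bond V)) (hSB : ∀ t ∈ T, ∀ x ∈ S t, x ∈ B t) (hS : ∀ t ∈ T, (S t).Nonempty)
    (hRB : ∀ t ∈ T, ∀ x y, Sum.inl (x, y) ∈ R t → x ∈ B t ∧ y ∈ B t)
    (hRF : ∀ t ∈ T, ∀ x, Sum.inr x ∉ R t)
    (hconn : ∀ t ∈ T, ∀ x ∈ B t, ∀ y ∈ B t, Conn (R t) x y)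
    (hdisj : ∀ s ∈ T, ∀ t ∈ T, s ≠ t → Disjoint (B s) (B t)) {q p : ℝ}
    (hq : ∀ t ∈ T, q * 2 ^ (R t).card
      ≤ ∏ i ∈ R t, insertConst (bondCoupling (fun x y => 2 * K x y) h i) / 2)
    (hq0 : 0 ≤ q) (hp : 0 < p)
    (hperc : ∀ t ∈ T, ∀ x ∈ S t, p * duplicateZ K h
      ≤ ∑ ω, if ConnField ω x then mass (bondCoupling (fun x y => 2 * K x y) h) ω else 0)
    (hpair : ∀ t ∈ T, ∑ x ∈ S t, ∑ y ∈ S t, (isingExpect K 0 fun σ => spin (σ x) * spin (σ y))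
      ≤ p ^ 2 / 4 * ((S t).card : ℝ) ^ 2) :
    T.card * (q * (p / 4)) ≤ ∑ x, h x := by
  set c := bondCoupling (fun x y => 2 * K x y) h with hc
  have hc0 : ∀ i, 0 ≤ c i := bondCoupling_nonneg (fun x y => by linarith [hK x y]) hh
  set Z := duplicateZ K h
  have hZ : 0 < Z := duplicateZ_pos K h
  let F : β → Finset (Bond V) → Prop := fun t ω => R t ⊆ ω ∧ Trifurcation ω (R t) (B t)
  have h1 : ∀ t ∈ T, q * (p / 4) * Z ≤ ∑ ω, if F t ω then mass c ω else 0 := by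
    intro t ht
    have e1 := sum_mass_meetsThree_ge hK hh (hS t ht) hp (hperc t ht) (hpair t ht)
    have hg : ∀ ω, 0 ≤ (if F t ω then mass c ω else 0) := fun ω => by
      split_ifs
      · exact mass_nonneg hc0 _
      · exact le_rfl
    have e2 := sum_union_le hg (R t)
    -- Opening `R t` turns the three clusters into a trifurcation. Insertion tolerance pays for
    -- this, and the factor `2 ^ (R t).card` will cancel the multiplicity in `e2`.
    have e3 : q * 2 ^ (R t).card * ∑ ω, (if MeetsThree ω (S t) then mass c ω else 0)
        ≤ ∑ ω, if F t (ω ∪ R t) then mass c (ω ∪ R t) else 0 := by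
      rw [Finset.mul_sum]
      refine Finset.sum_le_sum fun ω _ => ?_
      split_ifs with h2 h3 h3
      · exact (mul_le_mul_of_nonneg_right (hq t ht) (mass_nonneg hc0 ω)).trans
          (mass_union_ge hc0 ω (R t))
      · exact absurd ⟨Finset.subset_union_right,
          h2.trifurcation (hSB t ht) (hRB t ht) (hRF t ht)⟩ h3
      · simpa using mass_nonneg hc0 _
      · simp
    have hpow : (0 : ℝ) < 2 ^ (R t).card := by positivity
    have e4 : 2 ^ (R t).card * (q * (p / 4) * Z)
        ≤ 2 ^ (R t).card * ∑ ω, (if F t ω then mass c ω else 0) := by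
      refine le_trans ?_ (e3.trans e2)
      have := mul_le_mul_of_nonneg_left e1 (mul_nonneg hq0 hpow.le)
      calc _ = q * 2 ^ (R t).card * (p / 4 * Z) := by ring
        _ ≤ _ := this
    exact le_of_mul_le_mul_left e4 hpow
  have h2 : ∀ ω, ∑ t ∈ T, (if F t ω then mass c ω else 0)
      ≤ ∑ x, if Sum.inr x ∈ ω then mass c ω else 0 := by
    intro ω
    have e1 := card_trifurcation_le (ω := ω) (T.filter fun t => F t ω) B R
      (fun t ht => hRB t (Finset.mem_filter.1 ht).1)
      (fun t ht => hRF t (Finset.mem_filter.1 ht).1)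
      (fun t ht => hconn t (Finset.mem_filter.1 ht).1)
      (fun s hs t ht => hdisj s (Finset.mem_filter.1 hs).1 t (Finset.mem_filter.1 ht).1)
      (fun t ht => (Finset.mem_filter.1 ht).2.1) (fun t ht => (Finset.mem_filter.1 ht).2.2)
    rw [← Finset.sum_filter, ← Finset.sum_filter, Finset.sum_const, Finset.sum_const,
      nsmul_eq_mul, nsmul_eq_mul]
    have e2 := Nat.cast_le (α := ℝ).2 e1
    refine mul_le_mul_of_nonneg_right ?_ (mass_nonneg hc0 ω)
    convert e2
  have h3 : T.card * (q * (p / 4) * Z) ≤ (∑ x, h x) * Z := by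
    calc T.card * (q * (p / 4) * Z) = ∑ t ∈ T, q * (p / 4) * Z := by simp
      _ ≤ ∑ t ∈ T, ∑ ω, (if F t ω then mass c ω else 0) := Finset.sum_le_sum h1
      _ = ∑ ω, ∑ t ∈ T, (if F t ω then mass c ω else 0) := Finset.sum_comm
      _ ≤ ∑ ω, ∑ x, (if Sum.inr x ∈ ω then mass c ω else 0) := Finset.sum_le_sum fun ω _ => h2 ω
      _ = ∑ x, ∑ ω, (if Sum.inr x ∈ ω then mass c ω else 0) := Finset.sum_comm
      _ ≤ ∑ x, h x * Z := Finset.sum_le_sum fun x _ => sum_mass_field_le K hh x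
      _ = _ := by rw [Finset.sum_mul]
  refine le_of_mul_le_mul_right ?_ hZ
  calc _ = T.card * (q * (p / 4) * Z) := by ring
    _ ≤ _ := h3

end Blocks

/-! ### Finite-volume Gibbs states: Ising form and consistency -/

section FiniteVolume

variable {d : ℕ} {J : Site d → Site d → ℝ}

lemma Admissible.summable_right (hJ : Admissible J) (x : Site d) : Summable fun y => J x y := by
  have : (fun y => J x y) = (fun y => J 0 y) ∘ Equiv.subRight x := by
    ext y; simp [hJ.transl x y]
  rw [this]
  exact (Equiv.subRight x).summable_iff.2 hJ.summable

lemma Admissible.add_right (hJ : Admissible J) (x y t : Site d) : J (x + t) (y + t) = J x y := by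
  rw [hJ.transl (x + t), hJ.transl x]; simp

/-- The pair couplings in the volume `Λ`, over ordered pairs. -/
noncomputable def volumePair (J : Site d → Site d → ℝ) (β : ℝ) (Λ : Finset (Site d)) (x y : Λ) : ℝ :=
  if x = y then 0 else β / 2 * J x y

/-- The field produced in the volume `Λ` by the boundary condition `τ`. -/
noncomputable def volumeField (J : Site d → Site d → ℝ) (β : ℝ) (Λ : Finset (Site d))
    (τ : Site d → ℝ) (x : Λ) : ℝ :=
  β * ∑' y : {y : Site d // y ∉ Λ}, J x y * τ y

lemma boltzmann_volume (J : Site d → Site d → ℝ) (β : ℝ) (Λ : Finset (Site d)) (τ : Site d → ℝ)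
    (σ : Λ → ℤˣ) : boltzmann bondChar (bondCoupling (volumePair J β Λ) (volumeField J β Λ τ)) σ
      = Real.exp (-β * hamiltonian J Λ τ σ) := by
  rw [boltzmann, Fintype.sum_sum_type, Fintype.sum_prod_type]
  congr 1
  have h1 : ∑ x : Λ, ∑ y : Λ, bondCoupling (volumePair J β Λ) (volumeField J β Λ τ) (Sum.inl (x, y)) *
      spin (bondChar (Sum.inl (x, y)) σ) = β * ((1 / 2 : ℝ) * ∑ x : Λ, ∑ y : Λ,
        if x = y then 0 else J x y * spin (σ x) * spin (σ y)) := by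
    simp only [Finset.mul_sum]
    refine Finset.sum_congr rfl fun x _ => Finset.sum_congr rfl fun y _ => ?_
    simp only [bondCoupling, volumePair, bondChar_inl_apply, spin_mul]
    split_ifs
    · simp
    · ring
  have h2 : ∑ x : Λ, bondCoupling (volumePair J β Λ) (volumeField J β Λ τ) (Sum.inr x) *
      spin (bondChar (Sum.inr x) σ)
      = β * ∑ x : Λ, ∑' y : {y : Site d // y ∉ Λ}, J x y * spin (σ x) * τ y := by
    rw [Finset.mul_sum]
    refine Finset.sum_congr rfl fun x _ => ?_
    simp only [bondCoupling, volumeField, bondChar_inr_apply]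
    rw [mul_assoc, ← tsum_mul_right]
    congr 1
    exact tsum_congr fun y => by ring
  rw [h1, h2, hamiltonian]
  ring

lemma gibbsExp_eq_isingExpect (J : Site d → Site d → ℝ) (β : ℝ) (Λ : Finset (Site d))
    (τ : Site d → ℝ) (f : (Λ → ℤˣ) → ℝ) :
    gibbsExp J β Λ τ f = isingExpect (volumePair J β Λ) (volumeField J β Λ τ) f := by
  simp only [gibbsExp, isingExpect, expect, boltzmann_volume]

lemma volumePair_nonneg (hJ : Admissible J) {β : ℝ} (hβ : 0 ≤ β) (Λ : Finset (Site d)) (x y : Λ) :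
    0 ≤ volumePair J β Λ x y := by
  rw [volumePair]
  split_ifs
  · exact le_rfl
  · exact mul_nonneg (by linarith) (hJ.ferro _ _)

lemma abs_volumeField_le (hJ : Admissible J) {β : ℝ} (hβ : 0 ≤ β) (Λ : Finset (Site d))
    {τ : Site d → ℝ} (hτ : ∀ y, |τ y| ≤ 1) (x : Λ) :
    |volumeField J β Λ τ x| ≤ volumeField J β Λ (fun _ => 1) x := by
  rw [volumeField, volumeField, abs_mul, abs_of_nonneg hβ]
  refine mul_le_mul_of_nonneg_left ?_ hβ
  have h1 : Summable fun y : {y : Site d // y ∉ Λ} => J x y * 1 := by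
    simp only [mul_one]
    exact (hJ.summable_right (x : Site d)).subtype fun y => y ∉ Λ
  refine tsum_of_norm_bounded (f := fun y : {y : Site d // y ∉ Λ} => J x y * τ y) h1.hasSum fun y => ?_
  rw [Real.norm_eq_abs, abs_mul, abs_of_nonneg (hJ.ferro _ _)]
  exact mul_le_mul_of_nonneg_left (hτ y) (hJ.ferro _ _)

lemma volumeField_one_nonneg (hJ : Admissible J) {β : ℝ} (hβ : 0 ≤ β) (Λ : Finset (Site d))
    (x : Λ) : 0 ≤ volumeField J β Λ (fun _ => 1) x :=
  (abs_nonneg _).trans (abs_volumeField_le hJ hβ Λ (τ := fun _ => 1) (by simp) x)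

lemma volumeField_zero (J : Site d → Site d → ℝ) (β : ℝ) (Λ : Finset (Site d)) :
    volumeField J β Λ (fun _ => 0) = 0 := by
  ext x; simp [volumeField]

lemma partition_pos (J : Site d → Site d → ℝ) (β : ℝ) (Λ : Finset (Site d)) (τ : Site d → ℝ) :
    0 < ∑ σ : Λ → ℤˣ, Real.exp (-β * hamiltonian J Λ τ σ) :=
  Finset.sum_pos (fun _ _ => Real.exp_pos _) ⟨1, Finset.mem_univ _⟩

lemma gibbsExp_mono (J : Site d → Site d → ℝ) (β : ℝ) (Λ : Finset (Site d)) (τ : Site d → ℝ)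
    {f g : (Λ → ℤˣ) → ℝ} (hfg : ∀ σ, f σ ≤ g σ) : gibbsExp J β Λ τ f ≤ gibbsExp J β Λ τ g :=
  div_le_div_of_nonneg_right (Finset.sum_le_sum fun σ _ =>
    mul_le_mul_of_nonneg_right (hfg σ) (Real.exp_pos _).le) (partition_pos J β Λ τ).le

lemma gibbsExp_const (J : Site d → Site d → ℝ) (β : ℝ) (Λ : Finset (Site d)) (τ : Site d → ℝ)
    (c : ℝ) : gibbsExp J β Λ τ (fun _ => c) = c := by
  rw [gibbsExp, ← Finset.mul_sum, mul_div_cancel_right₀ _ (partition_pos J β Λ τ).ne']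

lemma gibbsExp_sub (J : Site d → Site d → ℝ) (β : ℝ) (Λ : Finset (Site d)) (τ : Site d → ℝ)
    (f g : (Λ → ℤˣ) → ℝ) :
    gibbsExp J β Λ τ (fun σ => f σ - g σ) = gibbsExp J β Λ τ f - gibbsExp J β Λ τ g := by
  simp only [gibbsExp, sub_mul, Finset.sum_sub_distrib, sub_div]

lemma gibbsExp_sum (J : Site d → Site d → ℝ) (β : ℝ) (Λ : Finset (Site d)) (τ : Site d → ℝ)
    {ι : Type*} (s : Finset ι) (f : ι → (Λ → ℤˣ) → ℝ) :
    gibbsExp J β Λ τ (fun σ => ∑ i ∈ s, f i σ) = ∑ i ∈ s, gibbsExp J β Λ τ (f i) := by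
  simp only [gibbsExp, Finset.sum_mul, ← Finset.sum_div]
  rw [Finset.sum_comm]

@[simp] lemma glue_of_mem {Λ : Finset (Site d)} (σ : Λ → ℤˣ) (ω : Config d) {x : Site d}
    (hx : x ∈ Λ) : glue Λ σ ω x = σ ⟨x, hx⟩ := by simp [glue, hx]

@[simp] lemma glue_of_notMem {Λ : Finset (Site d)} (σ : Λ → ℤˣ) (ω : Config d) {x : Site d}
    (hx : x ∉ Λ) : glue Λ σ ω x = ω x := by simp [glue, hx]

/-- The interaction of the sites `x` and `y` in the configuration `ω`. -/
noncomputable def interaction (J : Site d → Site d → ℝ) (ω : Config d) (x y : Site d) : ℝ :=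
  if x = y then 0 else J x y * spin (ω x) * spin (ω y)

lemma interaction_symm (hJ : Admissible J) (ω : Config d) (x y : Site d) :
    interaction J ω x y = interaction J ω y x := by
  simp only [interaction, eq_comm (a := x), hJ.symm x y]
  split_ifs
  · rfl
  · ring

lemma summable_interaction (hJ : Admissible J) (ω : Config d) (x : Site d) :
    Summable (interaction J ω x) := by
  refine Summable.of_norm_bounded (hJ.summable_right x) fun y => ?_
  rw [Real.norm_eq_abs, interaction]
  split_ifs
  · simpa using hJ.ferro x y
  · rw [abs_mul, abs_mul, abs_spin, abs_spin, mul_one, mul_one, abs_of_nonneg (hJ.ferro x y)]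

/-- The energy in the volume `Λ` of the configuration `ω`. -/
noncomputable def energy (J : Site d → Site d → ℝ) (Λ : Finset (Site d)) (ω : Config d) : ℝ :=
  hamiltonian J Λ (fun y => spin (ω y)) fun x => ω x

/-- Writing the boundary term as full row sums minus the inner sums makes energies in different
volumes comparable. -/
lemma energy_eq (hJ : Admissible J) (Λ : Finset (Site d)) (ω : Config d) :
    energy J Λ ω = 1 / 2 * (∑ x ∈ Λ, ∑ y ∈ Λ, interaction J ω x y)
      - ∑ x ∈ Λ, ∑' y, interaction J ω x y := by
  have h1 : (∑ x : Λ, ∑ y : Λ, if x = y then 0 else J x y * spin (ω x) * spin (ω y))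
      = ∑ x ∈ Λ, ∑ y ∈ Λ, interaction J ω x y := by
    rw [← Finset.sum_coe_sort Λ]
    refine Finset.sum_congr rfl fun x _ => ?_
    rw [← Finset.sum_coe_sort Λ]
    refine Finset.sum_congr rfl fun y _ => ?_
    simp only [interaction, Subtype.ext_iff]
  have h2 : ∀ x : Λ, ∑' y : {y : Site d // y ∉ Λ}, J x y * spin (ω x) * spin (ω y)
      = ∑' y, interaction J ω x y - ∑ y ∈ Λ, interaction J ω x y := by
    intro x
    have := (summable_interaction hJ ω x).sum_add_tsum_subtype_compl Λ
    rw [← this, add_sub_cancel_left]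
    refine tsum_congr fun y => ?_
    have : (x : Site d) ≠ y := fun h => y.2 (h ▸ x.2)
    simp [interaction, this]
  rw [energy, hamiltonian, h1, Finset.sum_congr rfl fun x _ => h2 x, Finset.sum_sub_distrib,
    Finset.sum_coe_sort Λ fun x => ∑' y, interaction J ω x y,
    Finset.sum_coe_sort Λ fun x => ∑ y ∈ Λ, interaction J ω x y]
  ring

/-- The part of the energy in `Δ` that is not in the energy in `Λ ⊆ Δ` does not depend on the spins
in `Λ`. -/
lemma energy_sub_energy (hJ : Admissible J) {Λ Δ : Finset (Site d)} (h : Λ ⊆ Δ) {ω ω' : Config d}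
    (hω : ∀ x, x ∉ Λ → ω x = ω' x) : energy J Δ ω - energy J Λ ω = energy J Δ ω' - energy J Λ ω' := by
  have key : ∀ ω : Config d, energy J Δ ω - energy J Λ ω
      = 1 / 2 * (∑ x ∈ Δ \ Λ, ∑ y ∈ Δ \ Λ, interaction J ω x y)
        - ∑ x ∈ Δ \ Λ, ∑' y : {y : Site d // y ∉ Λ}, interaction J ω x y := by
    intro ω
    have h1 : ∀ f : Site d → ℝ, ∑ x ∈ Δ, f x = ∑ x ∈ Δ \ Λ, f x + ∑ x ∈ Λ, f x :=
      fun f => (Finset.sum_sdiff h).symm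
    have h2 : ∀ x, ∑' y, interaction J ω x y
        = ∑ y ∈ Λ, interaction J ω x y + ∑' y : {y : Site d // y ∉ Λ}, interaction J ω x y :=
      fun x => ((summable_interaction hJ ω x).sum_add_tsum_subtype_compl Λ).symm
    have h3 : ∑ x ∈ Λ, ∑ y ∈ Δ \ Λ, interaction J ω x y
        = ∑ x ∈ Δ \ Λ, ∑ y ∈ Λ, interaction J ω x y := by
      rw [Finset.sum_comm]
      exact Finset.sum_congr rfl fun x _ => Finset.sum_congr rfl fun y _ =>
        interaction_symm hJ ω y x
    have h4 : ∑ x ∈ Δ, ∑ y ∈ Δ, interaction J ω x y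
        = ∑ x ∈ Δ \ Λ, ∑ y ∈ Δ \ Λ, interaction J ω x y
          + 2 * ∑ x ∈ Δ \ Λ, ∑ y ∈ Λ, interaction J ω x y
          + ∑ x ∈ Λ, ∑ y ∈ Λ, interaction J ω x y := by
      rw [h1]
      simp only [fun x => h1 fun y => interaction J ω x y, Finset.sum_add_distrib, h3]
      ring
    have h5 : ∑ x ∈ Δ \ Λ, ∑' y, interaction J ω x y = ∑ x ∈ Δ \ Λ, ∑ y ∈ Λ, interaction J ω x y
        + ∑ x ∈ Δ \ Λ, ∑' y : {y : Site d // y ∉ Λ}, interaction J ω x y := by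
      rw [← Finset.sum_add_distrib]
      exact Finset.sum_congr rfl fun x _ => h2 x
    rw [energy_eq hJ, energy_eq hJ, h4, h1 fun x => ∑' y, interaction J ω x y, h5]
    ring
  have hi : ∀ x y, x ∉ Λ → y ∉ Λ → interaction J ω x y = interaction J ω' x y :=
    fun x y hx hy => by rw [interaction, interaction, hω x hx, hω y hy]
  rw [key, key]
  congr 1
  · congr 1
    exact Finset.sum_congr rfl fun x hx => Finset.sum_congr rfl fun y hy =>
      hi x y (Finset.mem_sdiff.1 hx).2 (Finset.mem_sdiff.1 hy).2
  · exact Finset.sum_congr rfl fun x hx => tsum_congr fun y =>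
      hi x y (Finset.mem_sdiff.1 hx).2 y.2

lemma hamiltonian_eq_energy (J : Site d → Site d → ℝ) (Λ : Finset (Site d)) (ω : Config d)
    (σ : Λ → ℤˣ) : hamiltonian J Λ (fun y => spin (ω y)) σ = energy J Λ (glue Λ σ ω) := by
  rw [energy, hamiltonian, hamiltonian]
  congr 1
  · simp
  · refine Finset.sum_congr rfl fun x _ => tsum_congr fun y => ?_
    simp [y.2]

/-- The resampling of the spins in `Λ`. -/
noncomputable def resample (J : Site d → Site d → ℝ) (β : ℝ) (Λ : Finset (Site d))
    (F : Config d → ℝ) (ω : Config d) : ℝ :=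
  gibbsExp J β Λ (fun y => spin (ω y)) fun σ => F (glue Λ σ ω)

/-- The quotient is the `w`-average of `f` over the orbit of `g` under `H`, and averaging over
orbits preserves the weighted total. For `gibbsExp_resample`, `G` and `H` are the configurations in
`Δ` and `Λ`, and `e` is extension by `1`. -/
lemma sum_resample_aux {G H : Type*} [CommGroup G] [Fintype G] [Group H] [Fintype H] (e : H →* G)
    {w : G → ℝ} (hw : ∀ g, 0 < w g) (f : G → ℝ) :
    ∑ g, (∑ u, f (e u * g) * w (e u * g)) / (∑ u, w (e u * g)) * w g = ∑ g, f g * w g := by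
  have hS : ∀ g v, ∑ u, w (e u * (e v * g)) = ∑ u, w (e u * g) := by
    intro g v
    rw [← Equiv.sum_comp (Equiv.mulRight v) fun u => w (e u * g)]
    simp [mul_assoc]
  have hSpos : ∀ g, 0 < ∑ u, w (e u * g) := fun g =>
    Finset.sum_pos (fun u _ => hw _) ⟨1, Finset.mem_univ _⟩
  calc ∑ g, (∑ u, f (e u * g) * w (e u * g)) / (∑ u, w (e u * g)) * w g
      = ∑ u, ∑ g, f (e u * g) * w (e u * g) / (∑ v, w (e v * (e u * g))) *
          w (e u⁻¹ * (e u * g)) := by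
        rw [Finset.sum_comm]
        refine Finset.sum_congr rfl fun g _ => ?_
        rw [Finset.sum_div, Finset.sum_mul]
        refine Finset.sum_congr rfl fun u _ => ?_
        rw [hS, ← mul_assoc (e u⁻¹), ← map_mul, inv_mul_cancel, map_one, one_mul]
    _ = ∑ u, ∑ g, f g * w g / (∑ v, w (e v * g)) * w (e u⁻¹ * g) :=
        Finset.sum_congr rfl fun u _ =>
          Equiv.sum_comp (Equiv.mulLeft (e u)) fun g =>
            f g * w g / (∑ v, w (e v * g)) * w (e u⁻¹ * g)
    _ = ∑ g, f g * w g / (∑ v, w (e v * g)) * ∑ u, w (e u⁻¹ * g) := by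
        rw [Finset.sum_comm]
        exact Finset.sum_congr rfl fun g _ => by rw [Finset.mul_sum]
    _ = ∑ g, f g * w g := by
        refine Finset.sum_congr rfl fun g _ => ?_
        have : ∑ u, w (e u⁻¹ * g) = ∑ u, w (e u * g) :=
          Equiv.sum_comp (Equiv.inv H) fun u => w (e u * g)
        rw [this, div_mul_cancel₀ _ (hSpos g).ne']

open Classical in
/-- The extension of the configurations in `Λ` to `Δ` by `1`. -/
noncomputable def extendOne (Λ Δ : Finset (Site d)) : (Λ → ℤˣ) →* (Δ → ℤˣ) where
  toFun u x := if h : (x : Site d) ∈ Λ then u ⟨x, h⟩ else 1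
  map_one' := by ext; simp
  map_mul' u v := by
    ext x
    by_cases h : (x : Site d) ∈ Λ <;> simp [h]

lemma glue_extendOne_mul {Λ Δ : Finset (Site d)} (h : Λ ⊆ Δ) (u : Λ → ℤˣ) (σ : Δ → ℤˣ)
    (ω : Config d) : glue Δ (extendOne Λ Δ u * σ) ω
      = glue Λ (u * fun x : Λ => σ ⟨x, h x.2⟩) (glue Δ σ ω) := by
  ext x
  by_cases hx : x ∈ Λ
  · rw [glue_of_mem _ _ (h hx), glue_of_mem _ _ hx]
    simp [extendOne, hx]
  · rw [glue_of_notMem _ _ hx]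
    by_cases hx' : x ∈ Δ
    · rw [glue_of_mem _ _ hx', glue_of_mem _ _ hx']
      simp [extendOne, hx]
    · rw [glue_of_notMem _ _ hx', glue_of_notMem _ _ hx']

/-- The finite volume Gibbs states are consistent. -/
lemma gibbsExp_resample (hJ : Admissible J) (β : ℝ) {Λ Δ : Finset (Site d)} (h : Λ ⊆ Δ)
    (η : Config d) (F : Config d → ℝ) :
    gibbsExp J β Δ (fun y => spin (η y)) (fun σ => resample J β Λ F (glue Δ σ η))
      = gibbsExp J β Δ (fun y => spin (η y)) fun σ => F (glue Δ σ η) := by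
  rw [gibbsExp, gibbsExp]
  congr 1
  rw [← sum_resample_aux (extendOne Λ Δ) (fun σ => Real.exp_pos _) fun σ => F (glue Δ σ η)]
  refine Finset.sum_congr rfl fun σ _ => ?_
  congr 1
  set ω := glue Δ σ η with hω
  set σ' : Λ → ℤˣ := fun x => σ ⟨x, h x.2⟩ with hσ'
  -- This part of the energy does not depend on the spins in `Λ`, so its exponential cancels in the
  -- conditional average.
  set C := energy J Δ ω - energy J Λ ω with hC
  have hE : ∀ u, Real.exp (-β * hamiltonian J Δ (fun y => spin (η y)) (extendOne Λ Δ u * σ))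
      = Real.exp (-β * C) * Real.exp (-β * hamiltonian J Λ (fun y => spin (ω y)) (u * σ')) := by
    intro u
    rw [← Real.exp_add, hamiltonian_eq_energy, hamiltonian_eq_energy, glue_extendOne_mul h, ← hω,
      ← hσ', ← mul_add, hC, energy_sub_energy hJ h (ω' := glue Λ (u * σ') ω)
        fun x hx => (glue_of_notMem _ _ hx).symm]
    congr 2
    ring
  rw [resample, gibbsExp]
  simp only [hE, glue_extendOne_mul h, ← hω, ← hσ', mul_left_comm _ (Real.exp (-β * C)),
    ← Finset.mul_sum]
  rw [mul_div_mul_left _ _ (Real.exp_pos _).ne']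
  have hshift : ∀ f : (Λ → ℤˣ) → ℝ, ∑ u, f (u * σ') = ∑ u, f u :=
    Equiv.sum_comp (Equiv.mulRight σ')
  rw [hshift fun ξ => F (glue Λ ξ ω) * Real.exp (-β * hamiltonian J Λ (fun y => spin (ω y)) ξ),
    hshift fun ξ => Real.exp (-β * hamiltonian J Λ (fun y => spin (ω y)) ξ)]

end FiniteVolume

/-! ### Monotonicity, limits and translation invariance of correlations -/

section Correlations

/-- Restriction along `i` is a surjective homomorphism, so its fibres have equal size, and this size
is the constant `c`. -/
lemma sum_comp_injective {V V' : Type*} [Fintype V] [Fintype V'] [DecidableEq V] [DecidableEq V']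
    {i : V → V'} (hi : Function.Injective i) :
    ∃ c : ℝ, 0 < c ∧ ∀ g : (V → ℤˣ) → ℝ, ∑ σ : V' → ℤˣ, g (σ ∘ i) = c * ∑ s, g s := by
  have h1 : ∀ (g : (V → ℤˣ) → ℝ) (u : V → ℤˣ),
      ∑ σ : V' → ℤˣ, g (u * (σ ∘ i)) = ∑ σ : V' → ℤˣ, g (σ ∘ i) := by
    intro g u
    rw [← Equiv.sum_comp (Equiv.mulLeft (Function.extend i u 1)) fun σ : V' → ℤˣ => g (σ ∘ i)]
    refine Finset.sum_congr rfl fun σ _ => ?_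
    congr 1
    ext x
    simp [hi.extend_apply]
  have h2 : (0 : ℝ) < Fintype.card (V → ℤˣ) := Nat.cast_pos.2 Fintype.card_pos
  have h3 : (0 : ℝ) < Fintype.card (V' → ℤˣ) := Nat.cast_pos.2 Fintype.card_pos
  refine ⟨Fintype.card (V' → ℤˣ) / Fintype.card (V → ℤˣ), by positivity, fun g => ?_⟩
  have h4 : Fintype.card (V → ℤˣ) * ∑ σ : V' → ℤˣ, g (σ ∘ i)
      = Fintype.card (V' → ℤˣ) * ∑ s, g s := by
    calc _ = ∑ u : V → ℤˣ, ∑ σ : V' → ℤˣ, g (u * (σ ∘ i)) := by simp [h1]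
      _ = ∑ σ : V' → ℤˣ, ∑ u : V → ℤˣ, g (u * (σ ∘ i)) := Finset.sum_comm
      _ = ∑ σ : V' → ℤˣ, ∑ u, g u :=
        Finset.sum_congr rfl fun σ _ => Equiv.sum_comp (Equiv.mulRight (σ ∘ i)) g
      _ = _ := by simp
  field_simp
  linarith

/-- An Ising model with interactions only between the images of the sites of another model. -/
lemma isingExpect_comp_injective {V V' : Type*} [Fintype V] [Fintype V'] [DecidableEq V]
    [DecidableEq V'] {i : V → V'} (hi : Function.Injective i) {K : V → V → ℝ} {h : V → ℝ}
    {K' : V' → V' → ℝ} {h' : V' → ℝ} (hK : ∀ x y, K' (i x) (i y) = K x y)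
    (hK0 : ∀ a b, (a ∉ Set.range i ∨ b ∉ Set.range i) → K' a b = 0) (hh : ∀ x, h' (i x) = h x)
    (hh0 : ∀ a, a ∉ Set.range i → h' a = 0) (f : (V → ℤˣ) → ℝ) :
    isingExpect K' h' (fun σ => f (σ ∘ i)) = isingExpect K h f := by
  have hb : ∀ σ : V' → ℤˣ, boltzmann bondChar (bondCoupling K' h') σ
      = boltzmann bondChar (bondCoupling K h) (σ ∘ i) := by
    intro σ
    rw [boltzmann, boltzmann]
    congr 1
    symm
    refine Finset.sum_of_injOn (Sum.map (Prod.map i i) i)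
      ((Sum.map_injective.2 ⟨hi.prodMap hi, hi⟩).injOn) (fun _ _ => by simp) ?_ ?_
    · rintro (⟨a, b⟩ | a) _ h0
      · have : a ∉ Set.range i ∨ b ∉ Set.range i := by
          by_contra! hcon
          obtain ⟨⟨x, rfl⟩, ⟨y, rfl⟩⟩ := hcon
          exact h0 ⟨Sum.inl (x, y), by simp, rfl⟩
        simp [bondCoupling, hK0 a b this]
      · have : a ∉ Set.range i := by
          rintro ⟨x, rfl⟩
          exact h0 ⟨Sum.inr x, by simp, rfl⟩
        simp [bondCoupling, hh0 a this]
    · rintro (⟨x, y⟩ | x) _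
      · simp [bondCoupling, hK]
      · simp [bondCoupling, hh]
  obtain ⟨c, hc, hsum⟩ := sum_comp_injective hi
  rw [isingExpect, isingExpect, expect, expect]
  simp only [hb]
  rw [hsum fun s => f s * boltzmann bondChar (bondCoupling K h) s, hsum,
    mul_div_mul_left _ _ hc.ne']

variable {d : ℕ} {J : Site d → Site d → ℝ}

/-- The translate of a finite volume. -/
def translate (t : Site d) (Λ : Finset (Site d)) : Finset (Site d) := Λ.map (addRightEmbedding t)

lemma mem_translate {t : Site d} {Λ : Finset (Site d)} {x : Site d} :
    x + t ∈ translate t Λ ↔ x ∈ Λ := by simp [translate]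

lemma mem_translate_iff {t : Site d} {Λ : Finset (Site d)} {x : Site d} :
    x ∈ translate t Λ ↔ x - t ∈ Λ := by
  rw [← mem_translate (t := t) (x := x - t), sub_add_cancel]

lemma tendsto_translate (t : Site d) : Tendsto (translate t) atTop atTop := by
  refine tendsto_atTop.2 fun Λ => ?_
  filter_upwards [eventually_ge_atTop (translate (-t) Λ)] with Δ hΔ x hx
  rw [mem_translate_iff]
  refine hΔ ?_
  rw [mem_translate_iff]
  simpa using hx

lemma gibbsExp_translate (hJ : Admissible J) (β c : ℝ) (t : Site d) (Λ : Finset (Site d))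
    (F : Config d → ℝ) :
    gibbsExp J β (translate t Λ) (fun _ => c) (fun σ => F (glue (translate t Λ) σ 1))
      = gibbsExp J β Λ (fun _ => c) fun σ => F fun x => glue Λ σ 1 (x - t) := by
  let i : Λ → translate t Λ := fun x => ⟨x + t, mem_translate.2 x.2⟩
  have hi : Function.Injective i := fun x y hxy =>
    Subtype.ext (add_right_cancel (congrArg Subtype.val hxy))
  have hsurj : ∀ a, a ∈ Set.range i := fun a =>
    ⟨⟨a - t, mem_translate_iff.1 a.2⟩, Subtype.ext (sub_add_cancel _ _)⟩
  have hglue : ∀ σ : translate t Λ → ℤˣ,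
      glue (translate t Λ) σ 1 = fun x => glue Λ (σ ∘ i) 1 (x - t) := by
    intro σ
    funext x
    by_cases hx : x ∈ translate t Λ
    · rw [glue_of_mem _ _ hx, glue_of_mem _ _ (mem_translate_iff.1 hx)]
      simp [i]
    · rw [glue_of_notMem _ _ hx, glue_of_notMem _ _ fun h => hx (mem_translate_iff.2 h)]
      rfl
  simp only [hglue]
  rw [gibbsExp_eq_isingExpect, gibbsExp_eq_isingExpect]
  refine isingExpect_comp_injective hi ?_ (fun a b h => ?_) ?_ (fun a h => absurd (hsurj a) h)
    fun s => F fun x => glue Λ s 1 (x - t)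
  · intro x y
    simp only [volumePair, hi.eq_iff]
    rw [hJ.add_right]
  · rcases h with h | h
    · exact absurd (hsurj a) h
    · exact absurd (hsurj b) h
  · intro x
    rw [volumeField, volumeField]
    congr 1
    let e : {y : Site d // y ∉ Λ} ≃ {y : Site d // y ∉ translate t Λ} :=
      (Equiv.addRight t).subtypeEquiv fun y => by simp [mem_translate]
    rw [← e.tsum_eq]
    refine tsum_congr fun y => ?_
    simp only [e, i, Equiv.subtypeEquiv_apply, Equiv.coe_addRight]
    rw [hJ.add_right]

/-- The magnetization at `x` in the volume `Λ` with plus boundary condition. -/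
noncomputable def plusSite (J : Site d → Site d → ℝ) (β : ℝ) (Λ : Finset (Site d)) (x : Site d) : ℝ :=
  gibbsExp J β Λ (fun _ => 1) fun σ => spin (glue Λ σ 1 x)

/-- The correlation of `x` and `y` in the volume `Λ` with free boundary condition. -/
noncomputable def freePair (J : Site d → Site d → ℝ) (β : ℝ) (Λ : Finset (Site d)) (x y : Site d) :
    ℝ := gibbsExp J β Λ (fun _ => 0) fun σ => spin (glue Λ σ 1 x) * spin (glue Λ σ 1 y)

lemma abs_bondCoupling_volume_le (hJ : Admissible J) {β : ℝ} (hβ : 0 ≤ β) (Λ : Finset (Site d))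
    {τ : Site d → ℝ} (hτ : ∀ y, |τ y| ≤ 1) :
    ∀ i, |bondCoupling (volumePair J β Λ) (volumeField J β Λ τ) i|
      ≤ bondCoupling (volumePair J β Λ) (volumeField J β Λ fun _ => 1) i
  | Sum.inl p => (abs_of_nonneg (volumePair_nonneg hJ hβ Λ p.1 p.2)).le
  | Sum.inr x => abs_volumeField_le hJ hβ Λ hτ x

/-- The plus field dominates in absolute value the field of any such `τ`, so the form of Griffiths'
inequality with signed couplings applies. -/
lemma gibbsExp_site_le_plusSite (hJ : Admissible J) {β : ℝ} (hβ : 0 ≤ β) {Λ : Finset (Site d)}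
    {τ : Site d → ℝ} (hτ : ∀ y, |τ y| ≤ 1) {x : Site d} (hx : x ∈ Λ) :
    gibbsExp J β Λ τ (fun σ => spin (σ ⟨x, hx⟩)) ≤ plusSite J β Λ x := by
  simp only [plusSite, glue_of_mem _ _ hx]
  rw [gibbsExp_eq_isingExpect, gibbsExp_eq_isingExpect]
  exact expect_char_le bondChar (abs_bondCoupling_volume_le hJ hβ Λ hτ) (siteChar ⟨x, hx⟩)

/-- The completion by plus spins gives the maximal value `1` outside `Λ`, so that `plusSite` is
antitone in `Λ` with no restriction on `x`. -/
lemma plusSite_of_notMem (J : Site d → Site d → ℝ) (β : ℝ) {Λ : Finset (Site d)} {x : Site d}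
    (hx : x ∉ Λ) : plusSite J β Λ x = 1 := by
  simp only [plusSite, glue_of_notMem _ _ hx, Pi.one_apply, spin_one, gibbsExp_const]

lemma plusSite_le_one (J : Site d → Site d → ℝ) (β : ℝ) (Λ : Finset (Site d)) (x : Site d) :
    plusSite J β Λ x ≤ 1 :=
  (gibbsExp_mono J β Λ _ fun _ => spin_le_one _).trans_eq (gibbsExp_const J β Λ _ 1)

lemma volume_bondCoupling_nonneg (hJ : Admissible J) {β : ℝ} (hβ : 0 ≤ β) (Λ : Finset (Site d)) :
    ∀ i, 0 ≤ bondCoupling (volumePair J β Λ) (volumeField J β Λ fun _ => 1) i :=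
  bondCoupling_nonneg (volumePair_nonneg hJ hβ Λ) (volumeField_one_nonneg hJ hβ Λ)

lemma plusSite_nonneg (hJ : Admissible J) {β : ℝ} (hβ : 0 ≤ β) (Λ : Finset (Site d)) (x : Site d) :
    0 ≤ plusSite J β Λ x := by
  by_cases hx : x ∈ Λ
  · simp only [plusSite, glue_of_mem _ _ hx]
    rw [gibbsExp_eq_isingExpect]
    exact expect_char_nonneg bondChar (volume_bondCoupling_nonneg hJ hβ Λ) (siteChar ⟨x, hx⟩)
  · rw [plusSite_of_notMem J β hx]; exact zero_le_one

lemma spin_one_config : (fun y => spin ((1 : Config d) y)) = fun _ => 1 := by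
  ext y; simp [spin_one]

/-- By consistency, the value in `Δ` is an average of values in `Λ` with random boundary spins, each
at most the plus value. -/
lemma plusSite_antitone (hJ : Admissible J) {β : ℝ} (hβ : 0 ≤ β) (x : Site d) :
    Antitone fun Λ => plusSite J β Λ x := by
  intro Λ Δ h
  by_cases hx : x ∈ Λ
  · have h1 := gibbsExp_resample hJ β h 1 fun ω => spin (ω x)
    rw [spin_one_config] at h1
    simp only [plusSite]
    rw [← h1]
    refine (gibbsExp_mono J β Δ _ fun σ => ?_).trans_eq
      (gibbsExp_const J β Δ _ (plusSite J β Λ x))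
    simp only [resample, glue_of_mem _ _ hx]
    exact gibbsExp_site_le_plusSite hJ hβ (fun y => (abs_spin _).le) hx
  · simp only [plusSite_of_notMem J β hx]
    exact plusSite_le_one J β Δ x

lemma plusSite_translate (hJ : Admissible J) (β : ℝ) (t : Site d) (Λ : Finset (Site d))
    (x : Site d) : plusSite J β (translate t Λ) (x + t) = plusSite J β Λ x := by
  rw [plusSite, gibbsExp_translate hJ β 1 t Λ fun ω => spin (ω (x + t)), plusSite]
  simp

/-- The plus magnetization at every site decreases to the spontaneous magnetization. -/
lemma tendsto_plusSite (hJ : Admissible J) {β : ℝ} (hβ : 0 ≤ β) (x : Site d) :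
    Tendsto (fun Λ => plusSite J β Λ x) atTop (nhds (spontaneousMagnetization J β)) := by
  have h1 : ∀ x, Tendsto (fun Λ => plusSite J β Λ x) atTop (nhds (⨅ Λ, plusSite J β Λ x)) :=
    fun x => tendsto_atTop_ciInf (plusSite_antitone hJ hβ x)
      ⟨0, by rintro _ ⟨Λ, rfl⟩; exact plusSite_nonneg hJ hβ Λ x⟩
  have h2 : spontaneousMagnetization J β = ⨅ Λ, plusSite J β Λ 0 := (h1 0).limUnder_eq
  have h3 := (h1 x).comp (tendsto_translate x)
  have h4 : (fun Λ => plusSite J β Λ x) ∘ translate x = fun Λ => plusSite J β Λ 0 := by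
    ext Λ
    have := plusSite_translate hJ β x Λ 0
    rwa [zero_add] at this
  rw [h4] at h3
  rw [h2, tendsto_nhds_unique (h1 0) h3]
  exact h1 x

lemma spontaneousMagnetization_le (hJ : Admissible J) {β : ℝ} (hβ : 0 ≤ β) (Λ : Finset (Site d))
    (x : Site d) : spontaneousMagnetization J β ≤ plusSite J β Λ x :=
  le_of_tendsto (tendsto_plusSite hJ hβ x)
    (by filter_upwards [eventually_ge_atTop Λ] with Δ hΔ using plusSite_antitone hJ hβ x hΔ)

lemma spontaneousMagnetization_nonneg (hJ : Admissible J) {β : ℝ} (hβ : 0 ≤ β) :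
    0 ≤ spontaneousMagnetization J β :=
  ge_of_tendsto (tendsto_plusSite hJ hβ 0) (Eventually.of_forall fun Λ => plusSite_nonneg hJ hβ Λ 0)

/-- By Griffiths' second inequality the correlation is at least the product of the two
magnetizations, each of which is at least its infinite-volume limit. -/
lemma sq_spontaneousMagnetization_le (hJ : Admissible J) {β : ℝ} (hβ : 0 ≤ β) {Λ : Finset (Site d)}
    (x y : Λ) : spontaneousMagnetization J β ^ 2
      ≤ isingExpect (volumePair J β Λ) (volumeField J β Λ fun _ => 1)
        fun σ => spin (σ x) * spin (σ y) := by
  have h1 : ∀ x : Λ, spontaneousMagnetization J β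
      ≤ isingExpect (volumePair J β Λ) (volumeField J β Λ fun _ => 1) fun σ => spin (σ x) := by
    intro x
    have := spontaneousMagnetization_le hJ hβ Λ x
    simp only [plusSite, glue_of_mem _ _ x.2] at this
    rwa [gibbsExp_eq_isingExpect] at this
  have h2 := expect_mul_le bondChar (volume_bondCoupling_nonneg hJ hβ Λ) (siteChar x) (siteChar y)
  rw [sq]
  exact (mul_le_mul (h1 x) (h1 y) (spontaneousMagnetization_nonneg hJ hβ)
    ((spontaneousMagnetization_nonneg hJ hβ).trans (h1 x))).trans h2

lemma freePair_eq (J : Site d → Site d → ℝ) (β : ℝ) {Λ : Finset (Site d)} (x y : Λ) :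
    freePair J β Λ x y = isingExpect (volumePair J β Λ) 0 fun σ => spin (σ x) * spin (σ y) := by
  rw [freePair, gibbsExp_eq_isingExpect, volumeField_zero]
  simp only [glue_of_mem _ _ x.2, glue_of_mem _ _ y.2]

/-- The free model in `Λ` is the free model in `Δ` with every coupling outside `Λ × Λ` set to zero,
and correlations increase with the couplings. -/
lemma freePair_mono (hJ : Admissible J) {β : ℝ} (hβ : 0 ≤ β) {Λ Δ : Finset (Site d)} (h : Λ ⊆ Δ)
    {x y : Site d} (hx : x ∈ Λ) (hy : y ∈ Λ) : freePair J β Λ x y ≤ freePair J β Δ x y := by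
  have e1 := freePair_eq J β (Λ := Λ) ⟨x, hx⟩ ⟨y, hy⟩
  have e2 := freePair_eq J β (Λ := Δ) ⟨x, h hx⟩ ⟨y, h hy⟩
  simp only at e1 e2
  rw [e1, e2]
  let i : Λ → Δ := fun x => ⟨x, h x.2⟩
  have hi : Function.Injective i := fun x y hxy =>
    Subtype.ext (congrArg (Subtype.val : Δ → Site d) hxy)
  classical
  let K' : Δ → Δ → ℝ := fun a b =>
    if a ∈ Set.range i ∧ b ∈ Set.range i then volumePair J β Δ a b else 0
  have e3 := isingExpect_comp_injective hi (K := volumePair J β Λ) (h := 0) (K' := K') (h' := 0)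
    (fun x y => by simp only [K', Set.mem_range_self, and_self, if_true, volumePair, hi.eq_iff, i])
    (fun a b hab => by
      simp only [K']; rw [if_neg]; tauto) (fun _ => rfl) (fun _ _ => rfl)
    fun σ => spin (σ ⟨x, hx⟩) * spin (σ ⟨y, hy⟩)
  rw [← e3]
  have e4 := expect_char_le bondChar (K := bondCoupling (volumePair J β Δ) 0)
    (K' := bondCoupling K' 0) ?_ (siteChar (i ⟨x, hx⟩) * siteChar (i ⟨y, hy⟩))
  · simp only [MonoidHom.mul_apply, spin_mul] at e4
    exact e4
  · rintro (⟨a, b⟩ | a)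
    · have := volumePair_nonneg hJ hβ Δ a b
      simp only [bondCoupling, K']
      split_ifs
      · exact (abs_of_nonneg this).le
      · simpa using this
    · simp [bondCoupling]

lemma freePair_le_one (J : Site d → Site d → ℝ) (β : ℝ) (Λ : Finset (Site d)) (x y : Site d) :
    freePair J β Λ x y ≤ 1 := by
  refine (gibbsExp_mono J β Λ _ fun σ => ?_).trans_eq (gibbsExp_const J β Λ _ 1)
  rw [← spin_mul]
  exact spin_le_one _

lemma tendsto_freePair (hJ : Admissible J) {β : ℝ} (hβ : 0 ≤ β) (x y : Site d) :
    Tendsto (fun Λ => freePair J β Λ x y) atTop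
      (nhds (freeExp J β fun ω => spin (ω x) * spin (ω y))) := by
  -- Monotonicity requires both sites in the volume, since sites outside it carry plus spins by
  -- default.
  have h1 : Monotone fun Λ : Finset (Site d) => freePair J β (Λ ∪ {x, y}) x y :=
    fun Λ Δ h => freePair_mono hJ hβ (Finset.union_subset_union_left h) (by simp) (by simp)
  have h2 := tendsto_atTop_ciSup h1 ⟨1, by rintro _ ⟨Λ, rfl⟩; exact freePair_le_one J β _ x y⟩
  have h3 : Tendsto (fun Λ => freePair J β Λ x y) atTop
      (nhds (⨆ Λ : Finset (Site d), freePair J β (Λ ∪ {x, y}) x y)) := by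
    refine h2.congr' ?_
    filter_upwards [eventually_ge_atTop {x, y}] with Λ hΛ
    rw [Finset.union_eq_left.2 hΛ]
  have h4 : freeExp J β (fun ω => spin (ω x) * spin (ω y)) = _ := h3.limUnder_eq
  rw [h4]
  exact h3

lemma freePair_le_freeExp (hJ : Admissible J) {β : ℝ} (hβ : 0 ≤ β) {Λ : Finset (Site d)}
    {x y : Site d} (hx : x ∈ Λ) (hy : y ∈ Λ) :
    freePair J β Λ x y ≤ freeExp J β fun ω => spin (ω x) * spin (ω y) :=
  ge_of_tendsto (tendsto_freePair hJ hβ x y)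
    (by filter_upwards [eventually_ge_atTop Λ] with Δ hΔ using freePair_mono hJ hβ hΔ hx hy)

lemma freeExp_pair_translate (hJ : Admissible J) {β : ℝ} (hβ : 0 ≤ β) (t x y : Site d) :
    (freeExp J β fun ω => spin (ω (x + t)) * spin (ω (y + t)))
      = freeExp J β fun ω => spin (ω x) * spin (ω y) := by
  have h1 := (tendsto_freePair hJ hβ (x + t) (y + t)).comp (tendsto_translate t)
  have h2 : (fun Λ => freePair J β Λ (x + t) (y + t)) ∘ translate t
      = fun Λ => freePair J β Λ x y := by
    ext Λ
    rw [Function.comp_apply, freePair,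
      gibbsExp_translate hJ β 0 t Λ fun ω => spin (ω (x + t)) * spin (ω (y + t)), freePair]
    simp
  rw [h2] at h1
  exact tendsto_nhds_unique h1 (tendsto_freePair hJ hβ x y)

end Correlations

/-! ### The block estimate in a volume of the lattice -/

section Magnetization

open scoped Classical

variable {d : ℕ} {J : Site d → Site d → ℝ}

lemma eq_of_eqvGen {α β : Type*} {r : α → α → Prop} {p : α → β} (hp : ∀ a b, r a b → p a = p b)
    {x y : α} (h : Relation.EqvGen r x y) : p x = p y := by
  induction h with
  | rel _ _ h => exact hp _ _ h
  | refl _ => rfl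
  | symm _ _ _ ih => exact ih.symm
  | trans _ _ _ _ _ ih ih' => exact ih.trans ih'

/-- The constant by which the connection probability dominates the change of a correlation. -/
noncomputable def pathConst (J : Site d → Site d → ℝ) (β : ℝ) (l : List (Site d × Site d)) : ℝ :=
  4 ^ l.length * (l.map fun p => sourceConst (2 * (β / 2 * J p.1 p.2))).prod

/-- Disjoint translates in `Λ` of a block in which the free correlations are small are bounded in
number by the boundary of `Λ`, if there is a spontaneous magnetization. -/
lemma card_mul_le_boundary (hJ : Admissible J) {β : ℝ} (hβ : 0 < β) {S B : Finset (Site d)}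
    {R₀ : Finset (Site d × Site d)} (hS : S.Nonempty) (hSB : S ⊆ B)
    (hR₀ : ∀ p ∈ R₀, p.1 ∈ B ∧ p.2 ∈ B ∧ p.1 ≠ p.2)
    (hconn : ∀ x ∈ B, ∀ y ∈ B, Relation.EqvGen (fun a b => (a, b) ∈ R₀) x y)
    {l : List (Site d × Site d)} {z : Site d} (hl : ∀ p ∈ l, p.1 ≠ p.2 ∧ 0 < J p.1 p.2)
    (htel : ∀ s : Site d → ℤˣ, (l.map fun p => s p.1 * s p.2).prod = s 0 * s z)
    (hlB : ∀ x ∈ S, ∀ p ∈ l, p.1 + x ∈ B ∧ p.2 + x ∈ B) (hzB : ∀ x ∈ S, z + x ∈ B) {p : ℝ}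
    (hp : 0 < p) (hpD : p * (pathConst J β l + 1) ≤ spontaneousMagnetization J β ^ 2
      - freeExp J β fun ω => spin (ω 0) * spin (ω z))
    (hpair : ∑ x ∈ S, ∑ y ∈ S, (freeExp J β fun ω => spin (ω x) * spin (ω y))
      ≤ p ^ 2 / 4 * (S.card : ℝ) ^ 2)
    {Λ A : Finset (Site d)} (hA : ∀ a ∈ A, ∀ b ∈ B, b + a ∈ Λ)
    (hdisj : ∀ a ∈ A, ∀ a' ∈ A, ∀ b ∈ B, ∀ b' ∈ B, b + a = b' + a' → a = a') :
    A.card * ((∏ e ∈ R₀, insertConst (2 * (β / 2 * J e.1 e.2)) / 2) / 2 ^ R₀.card * (p / 4))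
      ≤ β * ∑ x ∈ Λ, ∑' y : {y : Site d // y ∉ Λ}, J x y := by
  set K := volumePair J β Λ with hKdef
  set h := volumeField J β Λ fun _ => 1 with hhdef
  have hK : ∀ x y, 0 ≤ K x y := volumePair_nonneg hJ hβ.le Λ
  have hh : ∀ x, 0 ≤ h x := volumeField_one_nonneg hJ hβ.le Λ
  have hfield : ∑ x, h x = β * ∑ x ∈ Λ, ∑' y : {y : Site d // y ∉ Λ}, J x y := by
    rw [← Finset.sum_coe_sort Λ, Finset.mul_sum]
    exact Finset.sum_congr rfl fun x _ => by simp [hhdef, volumeField]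
  rw [← hfield]
  let Bt : Site d → Set Λ := fun a => {v | v.1 - a ∈ B}
  let St : Site d → Finset Λ := fun a => Finset.univ.filter fun v => v.1 - a ∈ S
  let isIn : Site d → Bond Λ → Prop := fun a i =>
    match i with
    | Sum.inl e => (e.1.1 - a, e.2.1 - a) ∈ R₀
    | Sum.inr _ => False
  let Rt : Site d → Finset (Bond Λ) := fun a => Finset.univ.filter (isIn a)
  have hRmem : ∀ a (x y : Λ), Sum.inl (x, y) ∈ Rt a ↔ (x.1 - a, y.1 - a) ∈ R₀ := fun a x y => by
    simp [Rt, isIn]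
  have hRmem' : ∀ a (x : Λ), Sum.inr x ∉ Rt a := fun a x => by simp [Rt, isIn]
  have hSmem : ∀ a (x : Λ), x ∈ St a ↔ x.1 - a ∈ S := fun a x => by simp [St]
  let ι : ∀ a ∈ A, ∀ b ∈ S, Λ := fun a ha b hb => ⟨b + a, hA a ha b (hSB hb)⟩
  have hScard : ∀ a ∈ A, (St a).card = S.card := by
    intro a ha
    symm
    refine Finset.card_bij (fun b hb => ι a ha b hb) (fun b hb => ?_) (fun b hb b' hb' hbb => ?_)
      fun v hv => ?_
    · rw [hSmem]; simpa [ι] using hb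
    · exact add_right_cancel (congrArg Subtype.val hbb)
    · exact ⟨v.1 - a, (hSmem a v).1 hv, Subtype.ext (sub_add_cancel _ _)⟩
  have hSsum : ∀ a ∈ A, ∀ f : Site d → ℝ, ∑ x ∈ St a, f x.1 = ∑ x ∈ S, f (x + a) := by
    intro a ha f
    symm
    refine Finset.sum_bij (fun b hb => ι a ha b hb) (fun b hb => ?_) (fun b hb b' hb' hbb => ?_)
      (fun v hv => ?_) fun b hb => rfl
    · rw [hSmem]; simpa [ι] using hb
    · exact add_right_cancel (congrArg Subtype.val hbb)
    · exact ⟨v.1 - a, (hSmem a v).1 hv, Subtype.ext (sub_add_cancel _ _)⟩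
  let ε : ∀ a ∈ A, ∀ e ∈ R₀, Bond Λ := fun a ha e he =>
    Sum.inl (⟨e.1 + a, hA a ha _ (hR₀ e he).1⟩, ⟨e.2 + a, hA a ha _ (hR₀ e he).2.1⟩)
  have hε1 : ∀ a ha e he, ε a ha e he ∈ Rt a := fun a ha e he => by
    rw [hRmem]; simpa using he
  have hε2 : ∀ a ha e he e' he', ε a ha e he = ε a ha e' he' → e = e' := by
    intro a ha e he e' he' hee
    have := Sum.inl_injective hee
    exact Prod.ext (add_right_cancel (congrArg (fun q : Λ × Λ => q.1.1) this))
      (add_right_cancel (congrArg (fun q : Λ × Λ => q.2.1) this))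
  have hε3 : ∀ a ha, ∀ i ∈ Rt a, ∃ e he, ε a ha e he = i := by
    rintro a ha (⟨x, y⟩ | x) hi
    · exact ⟨_, (hRmem a x y).1 hi, by simp [ε]⟩
    · exact absurd hi (hRmem' a x)
  have hRcard : ∀ a ∈ A, (Rt a).card = R₀.card := fun a ha =>
    (Finset.card_bij (fun e he => ε a ha e he) (fun e he => hε1 a ha e he)
      (fun e he e' he' => hε2 a ha e he e' he') (hε3 a ha)).symm
  have hRprod : ∀ a ∈ A, ∏ i ∈ Rt a, insertConst (bondCoupling (fun x y => 2 * K x y) h i) / 2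
      = ∏ e ∈ R₀, insertConst (2 * (β / 2 * J e.1 e.2)) / 2 := by
    intro a ha
    symm
    refine Finset.prod_bij (fun e he => ε a ha e he) (fun e he => hε1 a ha e he)
      (fun e he e' he' => hε2 a ha e he e' he') (hε3 a ha) fun e he => ?_
    have hne : e.1 + a ≠ e.2 + a := fun h' => (hR₀ e he).2.2 (add_right_cancel h')
    simp only [ε, bondCoupling, hKdef, volumePair, Subtype.mk.injEq, if_neg hne, hJ.add_right]
  have hins : ∀ k : ℝ, 0 ≤ insertConst k := fun k => le_min zero_le_one (by
    linarith [Real.one_le_cosh k])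
  refine card_mul_le_sum_field hK hh A Bt St Rt ?_ ?_ ?_ (fun a _ => hRmem' a) ?_ ?_ ?_ ?_ hp ?_ ?_
  · intro a _ x hx
    exact hSB ((hSmem a x).1 hx)
  · intro a ha
    rw [← Finset.card_pos, hScard a ha]
    exact hS.card_pos
  · intro a _ x y hxy
    have := hR₀ _ ((hRmem a x y).1 hxy)
    exact ⟨this.1, this.2.1⟩
  · intro a ha x hx y hy
    have key := eq_of_eqvGen (p := fun v => ∃ hv : v + a ∈ Λ, Conn (Rt a) x ⟨v + a, hv⟩) ?_
      (hconn _ hx _ hy)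
    · obtain ⟨hv, hv'⟩ := (eq_iff_iff.1 key).1
        ⟨by simp, by convert Conn.refl x; exact sub_add_cancel _ _⟩
      convert hv'
      exact (sub_add_cancel _ _).symm
    · intro u v huv
      have hu : u + a ∈ Λ := hA a ha _ (hR₀ _ huv).1
      have hv : v + a ∈ Λ := hA a ha _ (hR₀ _ huv).2.1
      have hc : Conn (Rt a) ⟨u + a, hu⟩ ⟨v + a, hv⟩ :=
        Conn.of_mem ((hRmem a _ _).2 (by simpa using huv))
      exact propext ⟨fun ⟨_, h'⟩ => ⟨hv, h'.trans hc⟩, fun ⟨_, h'⟩ => ⟨hu, h'.trans hc.symm⟩⟩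
  · intro a ha a' ha' hne
    refine Set.disjoint_left.2 fun v hv hv' => hne ?_
    exact hdisj a ha a' ha' _ hv _ hv' (by rw [sub_add_cancel, sub_add_cancel])
  · intro a ha
    rw [hRprod a ha, hRcard a ha, div_mul_cancel₀ _ (by positivity)]
  · exact div_nonneg (Finset.prod_nonneg fun e _ => by linarith [hins (2 * (β / 2 * J e.1 e.2))])
      (by positivity)
  · intro a ha x hx
    have hxS := (hSmem a x).1 hx
    have hmem : ∀ q ∈ l, q.1 + x.1 ∈ Λ ∧ q.2 + x.1 ∈ Λ := by
      intro q hq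
      have := hlB _ hxS q hq
      have h1 := hA a ha _ this.1
      have h2 := hA a ha _ this.2
      rw [add_assoc, sub_add_cancel] at h1 h2
      exact ⟨h1, h2⟩
    have hzx : z + x.1 ∈ Λ := by
      have := hA a ha _ (hzB _ hxS)
      rwa [add_assoc, sub_add_cancel] at this
    let L : List (Λ × Λ) := l.attach.map fun q =>
      (⟨q.1.1 + x.1, (hmem q.1 q.2).1⟩, ⟨q.1.2 + x.1, (hmem q.1 q.2).2⟩)
    have hLK : ∀ q : {q // q ∈ l}, K ⟨q.1.1 + x.1, (hmem q.1 q.2).1⟩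
        ⟨q.1.2 + x.1, (hmem q.1 q.2).2⟩ = β / 2 * J q.1.1 q.1.2 := by
      intro q
      have hne : q.1.1 + x.1 ≠ q.1.2 + x.1 := fun h' => (hl q.1 q.2).1 (add_right_cancel h')
      simp only [hKdef, volumePair, Subtype.mk.injEq, if_neg hne, hJ.add_right]
    have h1 := sum_mass_connField_ge hK hh (x := x) (y := ⟨z + x.1, hzx⟩) L ?_ ?_
    · have hM : 4 ^ L.length * (L.map fun q => sourceConst (2 * K q.1 q.2)).prod
          = pathConst J β l := by
        rw [pathConst]
        congr 1
        · simp [L]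
        · simp only [L, List.map_map]
          conv_rhs => rw [← List.attach_map_subtype_val l, List.map_map]
          congr 1
          refine List.map_congr_left fun q _ => ?_
          simp only [Function.comp_apply]
          rw [hLK q]
      rw [hM] at h1
      -- In the volume the plus correlation is at least `m*²` and the free one at most its
      -- infinite-volume value, so the gap assumed in `hpD` is available at every translate.
      have h2 := sq_spontaneousMagnetization_le hJ hβ.le x ⟨z + x.1, hzx⟩
      have h3 := freePair_le_freeExp hJ hβ.le x.2 hzx
      have h4 := freePair_eq J β x ⟨z + x.1, hzx⟩
      have h5 := freeExp_pair_translate hJ hβ.le x.1 0 z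
      rw [zero_add] at h5
      simp only at h4
      rw [h4, h5] at h3
      set P := ∑ ω, if ConnField ω x then mass (bondCoupling (fun x y => 2 * K x y) h) ω else 0
      have hP : 0 ≤ P := Finset.sum_nonneg fun ω _ => by
        split_ifs
        · exact mass_nonneg (bondCoupling_nonneg (fun x y => by linarith [hK x y]) hh) ω
        · exact le_rfl
      have hM0 : 0 ≤ pathConst J β l := by
        refine mul_nonneg (by positivity) (List.prod_nonneg fun a ha => ?_)
        obtain ⟨q, hq, rfl⟩ := List.mem_map.1 ha
        have := (hl q hq).2
        exact sourceConst_nonneg (by positivity)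
      have hZ := duplicateZ_pos K h
      have h6 : p * (pathConst J β l + 1) * duplicateZ K h ≤ pathConst J β l * P := by
        refine le_trans ?_ h1
        rw [mul_comm]
        exact mul_le_mul_of_nonneg_left (by linarith) hZ.le
      have h7 : (pathConst J β l + 1) * (p * duplicateZ K h) ≤ (pathConst J β l + 1) * P := by
        linarith
      exact le_of_mul_le_mul_left h7 (by linarith)
    · intro q hq
      obtain ⟨q', -, rfl⟩ := List.mem_map.1 hq
      simp only
      rw [hLK q']
      have := (hl q'.1 q'.2).2
      positivity
    · refine MonoidHom.ext fun s => ?_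
      -- The telescoping identity is stated on `ℤ^d`; it is used for `s`, shifted by `x` and
      -- completed by `1`.
      have h2 := htel fun v => if hv : v + x.1 ∈ Λ then s ⟨v + x.1, hv⟩ else 1
      have h3 : (L.map fun q => bondChar (Sum.inl q)).prod s
          = ((L.map fun q => bondChar (Sum.inl q)).map (MonoidHom.eval s)).prod :=
        map_list_prod (MonoidHom.eval s) _
      rw [h3, List.map_map, List.map_map, MonoidHom.mul_apply]
      rw [← List.attach_map_subtype_val l, List.map_map] at h2
      convert h2 using 2
      · refine List.map_congr_left fun q _ => ?_
        simp [hmem q.1 q.2]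
      · simp
      · simp [hzx]
  · intro a ha
    rw [hScard a ha]
    refine le_trans ?_ hpair
    have h1 : ∀ x y : Λ, (isingExpect K 0 fun σ => spin (σ x) * spin (σ y))
        ≤ freeExp J β fun ω => spin (ω x.1) * spin (ω y.1) := fun x y => by
      rw [hKdef, ← freePair_eq]
      exact freePair_le_freeExp hJ hβ.le x.2 y.2
    refine (Finset.sum_le_sum fun x _ => Finset.sum_le_sum fun y _ => h1 x y).trans_eq ?_
    rw [Finset.sum_congr rfl fun (x : Λ) _ => hSsum a ha fun y =>
        freeExp J β fun ω => spin (ω x.1) * spin (ω y),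
      hSsum a ha fun x => ∑ y ∈ S, freeExp J β fun ω => spin (ω x) * spin (ω (y + a))]
    exact Finset.sum_congr rfl fun x _ => Finset.sum_congr rfl fun y _ =>
      freeExp_pair_translate hJ hβ.le a x y

end Magnetization

/-! ### Cubes, boundary estimates and vanishing of the magnetization -/

section Boxes

variable {d : ℕ} {J : Site d → Site d → ℝ}

/-- The cube `[0, N)^d`. -/
noncomputable def cube (d N : ℕ) : Finset (Site d) := Fintype.piFinset fun _ => Finset.Ico (0 : ℤ) N

lemma mem_cube {N : ℕ} {x : Site d} : x ∈ cube d N ↔ ∀ i, 0 ≤ x i ∧ x i < N := by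
  simp [cube]

lemma card_cube (N : ℕ) : (cube d N).card = N ^ d := by
  simp [cube]

/-- The number of sites of the cube that a translation moves out of the cube. -/
noncomputable def exitCount (N : ℕ) (v : Site d) : ℕ := ((cube d N).filter fun x => x + v ∉ cube d N).card

lemma exitCount_le (N : ℕ) (v : Site d) : exitCount N v ≤ N ^ d :=
  (Finset.card_filter_le _ _).trans_eq (card_cube N)

/-- In coordinate `i` the points that stay form an interval of length `N - |v i|`. -/
lemma le_stayCount {N : ℕ} {v : Site d} (hN : ∀ i, |v i| ≤ N) :
    ∏ i, ((N : ℝ) - |(v i : ℝ)|) ≤ ((cube d N).filter fun x => x + v ∈ cube d N).card := by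
  have h1 : (Fintype.piFinset fun i => Finset.Ico (max 0 (-v i)) (min (N : ℤ) (N - v i)))
      ⊆ (cube d N).filter fun x => x + v ∈ cube d N := by
    intro x hx
    simp only [Fintype.mem_piFinset, Finset.mem_Ico] at hx
    simp only [Finset.mem_filter, mem_cube, Pi.add_apply]
    exact ⟨fun i => by have := hx i; omega, fun i => by have := hx i; omega⟩
  refine le_trans ?_ (Nat.cast_le.2 (Finset.card_le_card h1))
  rw [Fintype.card_piFinset, Nat.cast_prod]
  refine Finset.prod_le_prod (fun i _ => ?_) fun i _ => ?_
  · have := hN i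
    have h2 : ((|v i| : ℤ) : ℝ) ≤ ((N : ℤ) : ℝ) := by exact_mod_cast this
    push_cast at h2
    linarith
  · rw [Int.card_Ico]
    have h2 : (N : ℤ) - |v i| ≤ ((min (N : ℤ) (N - v i) - max 0 (-v i)).toNat : ℤ) := by
      have := hN i
      rw [Int.abs_eq_natAbs] at this ⊢
      omega
    exact_mod_cast h2

lemma tendsto_exitCount (v : Site d) :
    Tendsto (fun N : ℕ => (exitCount N v : ℝ) / (N : ℝ) ^ d) atTop (nhds 0) := by
  have h1 : Tendsto (fun N : ℕ => 1 - ∏ i, (1 - |(v i : ℝ)| / (N : ℝ))) atTop (nhds 0) := by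
    have h2 : Tendsto (fun N : ℕ => ∏ i, (1 - |(v i : ℝ)| / (N : ℝ))) atTop
        (nhds (∏ _i : Fin d, (1 - 0))) :=
      tendsto_finsetProd _ fun i _ =>
        tendsto_const_nhds.sub (tendsto_const_div_atTop_nhds_zero_nat _)
    simpa using (tendsto_const_nhds (x := (1 : ℝ))).sub h2
  refine tendsto_of_tendsto_of_tendsto_of_le_of_le' tendsto_const_nhds h1
    (Eventually.of_forall fun N => by positivity) ?_
  have h3 : ∀ᶠ N : ℕ in atTop, ∀ i, |v i| ≤ N := by
    rw [eventually_all]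
    intro i
    filter_upwards [eventually_ge_atTop (v i).natAbs] with N hN
    rw [Int.abs_eq_natAbs]
    omega
  filter_upwards [h3, eventually_gt_atTop 0] with N hN hpos
  have hN0 : (0 : ℝ) < N := Nat.cast_pos.2 hpos
  have h4 := le_stayCount hN
  have h5 : (exitCount N v : ℝ) + ((cube d N).filter fun x => x + v ∈ cube d N).card
      = (N : ℝ) ^ d := by
    have := Finset.card_filter_add_card_filter_not (s := cube d N) fun x => x + v ∈ cube d N
    rw [card_cube, add_comm] at this
    exact_mod_cast this
  have h6 : ∏ i, (1 - |(v i : ℝ)| / (N : ℝ)) = (∏ i, ((N : ℝ) - |(v i : ℝ)|)) / (N : ℝ) ^ d := by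
    rw [show (N : ℝ) ^ d = ∏ _i : Fin d, (N : ℝ) by simp, ← Finset.prod_div_distrib]
    refine Finset.prod_congr rfl fun i _ => ?_
    field_simp
  rw [h6, div_le_iff₀ (by positivity), sub_mul, div_mul_cancel₀ _ (by positivity)]
  linarith

/-- The sum is grouped by the displacement `v = y - x`, each `v` counted once for every site that it
moves out of the cube. -/
lemma boundary_sum_eq (hJ : Admissible J) (N : ℕ) :
    ∑ x ∈ cube d N, ∑' y : {y : Site d // y ∉ cube d N}, J x y
      = ∑' v, J 0 v * exitCount N v := by
  classical
  have h1 : ∀ x, ∑' y : {y : Site d // y ∉ cube d N}, J x y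
      = ∑' v, if x + v ∉ cube d N then J 0 v else 0 := by
    intro x
    have e1 : ∑' y : {y : Site d // y ∉ cube d N}, J x y
        = ∑' y, Set.indicator {y | y ∉ cube d N} (J x) y := tsum_subtype {y | y ∉ cube d N} (J x)
    rw [e1, ← (Equiv.addLeft x).tsum_eq]
    refine tsum_congr fun v => ?_
    rw [Set.indicator_apply, Equiv.coe_addLeft, hJ.transl x]
    simp
  have h2 : ∀ x ∈ cube d N, Summable fun v => if x + v ∉ cube d N then J 0 v else 0 := by
    intro x _
    refine Summable.of_nonneg_of_le (fun v => ?_) (fun v => ?_) hJ.summable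
    · split_ifs
      · exact le_rfl
      · exact hJ.ferro 0 v
    · split_ifs
      · exact hJ.ferro 0 v
      · exact le_rfl
  rw [Finset.sum_congr rfl fun x _ => h1 x, ← Summable.tsum_finsetSum h2]
  refine tsum_congr fun v => ?_
  rw [← Finset.sum_filter, Finset.sum_const, nsmul_eq_mul, mul_comm, exitCount]

/-- Dominated convergence over displacements, with dominating function `J 0`: each fixed
displacement moves a vanishing fraction of the sites out of the cube. This covers couplings of
infinite range. -/
lemma tendsto_boundary_sum (hJ : Admissible J) :
    Tendsto (fun N : ℕ => (∑ x ∈ cube d N, ∑' y : {y : Site d // y ∉ cube d N}, J x y) /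
      (N : ℝ) ^ d) atTop (nhds 0) := by
  have h1 : ∀ N : ℕ, (∑ x ∈ cube d N, ∑' y : {y : Site d // y ∉ cube d N}, J x y) / (N : ℝ) ^ d
      = ∑' v, J 0 v * (exitCount N v / (N : ℝ) ^ d) := by
    intro N
    rw [boundary_sum_eq hJ, ← tsum_div_const]
    exact tsum_congr fun v => by ring
  simp only [h1]
  have h2 := tendsto_tsum_of_dominated_convergence (𝓕 := atTop)
    (f := fun (N : ℕ) v => J 0 v * (exitCount N v / (N : ℝ) ^ d)) (g := fun _ => 0) hJ.summable
    (fun v => by simpa using (tendsto_exitCount v).const_mul (J 0 v))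
    (Eventually.of_forall fun N v => by
      have h3 : (exitCount N v : ℝ) / (N : ℝ) ^ d ≤ 1 :=
        div_le_one_of_le₀ (by exact_mod_cast exitCount_le N v) (by positivity)
      have h4 : 0 ≤ (exitCount N v : ℝ) / (N : ℝ) ^ d := by positivity
      rw [Real.norm_eq_abs, abs_of_nonneg (mul_nonneg (hJ.ferro 0 v) h4)]
      exact mul_le_of_le_one_right (hJ.ferro 0 v) h3)
  simpa using h2

/-- A path of positive couplings from `0` to `z`. -/
lemma exists_path (hJ : Admissible J) (z : Site d) : ∃ l : List (Site d × Site d),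
    (∀ p ∈ l, p.1 ≠ p.2 ∧ 0 < J p.1 p.2) ∧
    (∀ s : Site d → ℤˣ, (l.map fun p => s p.1 * s p.2).prod = s 0 * s z) ∧
    (∀ p ∈ l, Relation.EqvGen (fun a b => (a, b) ∈ l) 0 p.1) ∧
    Relation.EqvGen (fun a b => (a, b) ∈ l) 0 z := by
  induction hJ.aperiodic z with
  | refl => exact ⟨[], by simp, fun s => by simp [Int.units_mul_self], by simp,
      Relation.EqvGen.refl _⟩
  | tail _ hbc ih =>
    rename_i b c _
    obtain ⟨l, h1, h2, h3, h4⟩ := ih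
    by_cases hne : b = c
    · subst hne
      exact ⟨l, h1, h2, h3, h4⟩
    · have hm : ∀ {x y}, Relation.EqvGen (fun a b => (a, b) ∈ l) x y →
          Relation.EqvGen (fun a b' => (a, b') ∈ (b, c) :: l) x y := fun h =>
        Relation.EqvGen.mono (fun _ _ h => List.mem_cons_of_mem _ h) _ _ h
      refine ⟨(b, c) :: l, ?_, fun s => ?_, ?_, ?_⟩
      · intro p hp
        rcases List.mem_cons.1 hp with rfl | hp
        · exact ⟨hne, hbc⟩
        · exact h1 p hp
      · rw [List.map_cons, List.prod_cons, h2,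
          show s b * s c * (s 0 * s b) = s 0 * s c * (s b * s b) by
            rw [mul_comm (s b), mul_mul_mul_comm, mul_comm (s c)],
          Int.units_mul_self, mul_one]
      · intro p hp
        rcases List.mem_cons.1 hp with rfl | hp
        · exact hm h4
        · exact hm (h3 p hp)
      · exact (hm h4).trans _ _ _ (Relation.EqvGen.rel _ _ List.mem_cons_self)

/-- Every finite set is contained in a finite set that is connected by positive couplings. -/
lemma exists_connected_block (hJ : Admissible J) (W : Finset (Site d)) :
    ∃ (B : Finset (Site d)) (R : Finset (Site d × Site d)), W ⊆ B ∧
      (∀ p ∈ R, p.1 ∈ B ∧ p.2 ∈ B ∧ p.1 ≠ p.2) ∧ (∀ p ∈ R, 0 < J p.1 p.2) ∧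
      ∀ x ∈ B, ∀ y ∈ B, Relation.EqvGen (fun a b => (a, b) ∈ R) x y := by
  choose l h1 _ h3 h4 using fun z => exists_path hJ z
  set R := W.biUnion fun w => (l w).toFinset with hR
  have hRm : ∀ p, p ∈ R ↔ ∃ w ∈ W, p ∈ l w := fun p => by simp [hR]
  have hm : ∀ w ∈ W, ∀ {x y}, Relation.EqvGen (fun a b => (a, b) ∈ l w) x y →
      Relation.EqvGen (fun a b => (a, b) ∈ R) x y := fun w hw _ _ h =>
    Relation.EqvGen.mono (fun _ _ h => (hRm _).2 ⟨w, hw, h⟩) _ _ h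
  refine ⟨W ∪ (R.image Prod.fst ∪ R.image Prod.snd), R, Finset.subset_union_left, ?_, ?_, ?_⟩
  · intro p hp
    refine ⟨?_, ?_, ?_⟩
    · exact Finset.mem_union_right _ (Finset.mem_union_left _ (Finset.mem_image_of_mem _ hp))
    · exact Finset.mem_union_right _ (Finset.mem_union_right _ (Finset.mem_image_of_mem _ hp))
    · obtain ⟨w, _, hw⟩ := (hRm p).1 hp
      exact (h1 w p hw).1
  · intro p hp
    obtain ⟨w, _, hw⟩ := (hRm p).1 hp
    exact (h1 w p hw).2
  · have h0 : ∀ x ∈ W ∪ (R.image Prod.fst ∪ R.image Prod.snd),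
        Relation.EqvGen (fun a b => (a, b) ∈ R) 0 x := by
      intro x hx
      rcases Finset.mem_union.1 hx with hx | hx
      · exact hm x hx (h4 x)
      · rcases Finset.mem_union.1 hx with hx | hx
        · obtain ⟨p, hp, rfl⟩ := Finset.mem_image.1 hx
          obtain ⟨w, hw, hpw⟩ := (hRm p).1 hp
          exact hm w hw (h3 w p hpw)
        · obtain ⟨p, hp, rfl⟩ := Finset.mem_image.1 hx
          obtain ⟨w, hw, hpw⟩ := (hRm p).1 hp
          exact (hm w hw (h3 w p hpw)).trans _ _ _ (Relation.EqvGen.rel _ _ hp)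
    exact fun x hx y hy => ((h0 x hx).symm _ _).trans _ _ _ (h0 y hy)

/-- Translates of a finite set that fill a positive proportion of large cubes. -/
lemma exists_disjoint_translates (B : Finset (Site d)) : ∃ L : ℕ, 0 < L ∧ ∀ n : ℕ,
    ∃ A : Finset (Site d), A.card = n ^ d ∧ (∀ a ∈ A, ∀ b ∈ B, b + a ∈ cube d (n * L)) ∧
      ∀ a ∈ A, ∀ a' ∈ A, ∀ b ∈ B, ∀ b' ∈ B, b + a = b' + a' → a = a' := by
  obtain ⟨k, hk⟩ : ∃ k : ℕ, ∀ b ∈ B, ∀ i, |b i| ≤ k := by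
    refine ⟨B.sup fun b => Finset.univ.sup fun i => (b i).natAbs, fun b hb i => ?_⟩
    have h1 : (b i).natAbs ≤ Finset.univ.sup fun i => (b i).natAbs :=
      Finset.le_sup (f := fun i => (b i).natAbs) (Finset.mem_univ i)
    have h2 := Finset.le_sup (f := fun b : Site d => Finset.univ.sup fun i => (b i).natAbs) hb
    rw [Int.abs_eq_natAbs]
    exact_mod_cast h1.trans h2
  -- The block fits in a cell of side `2 k + 1` centred at the translation vector, so integer
  -- division recovers the cell and the translates are disjoint.
  have hquot : ∀ b ∈ B, ∀ (t : Site d) i,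
      (b i + ((2 * k + 1) * t i + k)) / (2 * k + 1 : ℤ) = t i := by
    intro b hb t i
    have := abs_le.1 (hk b hb i)
    rw [show b i + ((2 * (k : ℤ) + 1) * t i + k) = (b i + k) + (2 * k + 1) * t i by ring,
      Int.add_mul_ediv_left _ _ (by omega), Int.ediv_eq_zero_of_lt (by omega) (by omega), zero_add]
  refine ⟨2 * k + 1, by omega, fun n => ?_⟩
  let o : Site d → Site d := fun t i => (2 * k + 1) * t i + k
  have ho : Function.Injective o := by
    intro t t' h
    funext i
    have := congrFun h i
    simp only [o, add_left_inj] at this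
    exact mul_left_cancel₀ (by omega) this
  refine ⟨(cube d n).image o, ?_, ?_, ?_⟩
  · rw [Finset.card_image_of_injective _ ho, card_cube]
  · intro a ha b hb
    obtain ⟨t, ht, rfl⟩ := Finset.mem_image.1 ha
    rw [mem_cube] at ht ⊢
    intro i
    have h1 := abs_le.1 (hk b hb i)
    have h2 := ht i
    simp only [Pi.add_apply, o]
    push_cast
    have h3 : (2 * (k : ℤ) + 1) * t i ≤ (2 * k + 1) * (n - 1) :=
      mul_le_mul_of_nonneg_left (by omega) (by omega)
    have h4 : 0 ≤ (2 * (k : ℤ) + 1) * t i := mul_nonneg (by omega) h2.1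
    constructor
    · linarith
    · linarith
  · intro a ha a' ha' b hb b' hb' h
    obtain ⟨t, -, rfl⟩ := Finset.mem_image.1 ha
    obtain ⟨t', -, rfl⟩ := Finset.mem_image.1 ha'
    congr 1
    funext i
    have := congrFun h i
    simp only [Pi.add_apply, o] at this
    rw [← hquot b hb t i, this, hquot b' hb' t' i]

lemma exists_average_lt (J : Site d → Site d → ℝ) {β : ℝ} (h : modifiedLRO J β = 0) {ε : ℝ}
    (hε : 0 < ε) : ∃ S : Finset (Site d), S.Nonempty ∧
      ∑ x ∈ S, ∑ y ∈ S, (freeExp J β fun ω => spin (ω x) * spin (ω y)) < ε * (S.card : ℝ) ^ 2 := by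
  have h1 := Real.sqrt_eq_zero'.1 h
  have : Nonempty {B : Finset (Site d) // B.Nonempty} := ⟨⟨{0}, by simp⟩⟩
  obtain ⟨⟨S, hS⟩, hlt⟩ := exists_lt_of_ciInf_lt (h1.trans_lt hε)
  refine ⟨S, hS, ?_⟩
  have hpos : (0 : ℝ) < S.card := Nat.cast_pos.2 hS.card_pos
  simp only at hlt
  rw [one_div_mul_eq_div, div_lt_iff₀ (by positivity)] at hlt
  exact hlt

/-- Without long range order in the free state there is no spontaneous magnetization. -/
theorem spontaneousMagnetization_eq_zero_of_pos (hJ : Admissible J) {β : ℝ} (hβ : 0 < β)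
    (h : modifiedLRO J β = 0) : spontaneousMagnetization J β = 0 := by
  by_contra hne
  set m := spontaneousMagnetization J β with hm
  have hm0 : 0 < m := lt_of_le_of_ne (spontaneousMagnetization_nonneg hJ hβ.le) (Ne.symm hne)
  -- If all free correlations were at least `m ^ 2`, so would be all their averages.
  obtain ⟨z, hz⟩ : ∃ z, (freeExp J β fun ω => spin (ω 0) * spin (ω z)) < m ^ 2 := by
    by_contra! hcon
    obtain ⟨S, hS, hlt⟩ := exists_average_lt J h (pow_pos hm0 2)
    have h1 : ∀ x y, m ^ 2 ≤ freeExp J β fun ω => spin (ω x) * spin (ω y) := by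
      intro x y
      have := freeExp_pair_translate hJ hβ.le x 0 (y - x)
      rw [zero_add, sub_add_cancel] at this
      rw [this]
      exact hcon _
    have h2 : m ^ 2 * (S.card : ℝ) ^ 2 ≤ ∑ x ∈ S, ∑ y ∈ S,
        (freeExp J β fun ω => spin (ω x) * spin (ω y)) := by
      calc m ^ 2 * (S.card : ℝ) ^ 2 = ∑ x ∈ S, ∑ y ∈ S, m ^ 2 := by
            simp only [Finset.sum_const, nsmul_eq_mul]; ring
        _ ≤ _ := Finset.sum_le_sum fun x _ => Finset.sum_le_sum fun y _ => h1 x y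
    linarith
  set D := m ^ 2 - freeExp J β fun ω => spin (ω 0) * spin (ω z) with hD
  have hD0 : 0 < D := sub_pos.2 hz
  obtain ⟨l, hl, htel, -, -⟩ := exists_path hJ z
  have hM : 0 ≤ pathConst J β l := by
    refine mul_nonneg (by positivity) (List.prod_nonneg fun a ha => ?_)
    obtain ⟨q, hq, rfl⟩ := List.mem_map.1 ha
    have := (hl q hq).2
    exact sourceConst_nonneg (by positivity)
  -- This lower bound on the connection probability is fixed before `S`, whose average correlation
  -- has to be below `p ^ 2 / 4`.
  set p := D / (pathConst J β l + 1) with hp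
  have hp0 : 0 < p := by positivity
  obtain ⟨S, hS, hlt⟩ := exists_average_lt J h (show 0 < p ^ 2 / 4 by positivity)
  -- The block has to contain, for each `x ∈ S`, the path from `x` to `z + x`, so that the path
  -- stays in every volume containing the block.
  let W : Finset (Site d) := S ∪ S.image (fun x => z + x) ∪
    (S.biUnion fun x => (l.map fun q => q.1 + x).toFinset ∪ (l.map fun q => q.2 + x).toFinset)
  obtain ⟨B, R, hWB, hR, hRJ, hconn⟩ := exists_connected_block hJ W
  obtain ⟨L, hL, hA⟩ := exists_disjoint_translates B
  set q := (∏ e ∈ R, insertConst (2 * (β / 2 * J e.1 e.2)) / 2) / 2 ^ R.card * (p / 4) with hq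
  have hq0 : 0 < q := by
    refine mul_pos (div_pos (Finset.prod_pos fun e he => ?_) (by positivity)) (by positivity)
    have := hRJ e he
    exact half_pos (insertConst_pos (by positivity))
  -- The left side has the order of the volume of the cube and `q` does not depend on `n`; the right
  -- side is a boundary term.
  have hbound : ∀ n : ℕ, (n : ℝ) ^ d * q ≤ β * ∑ x ∈ cube d (n * L),
      ∑' y : {y : Site d // y ∉ cube d (n * L)}, J x y := by
    intro n
    obtain ⟨A, hcard, hA1, hA2⟩ := hA n
    have := card_mul_le_boundary hJ hβ (S := S) (B := B) (R₀ := R) hS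
      (fun x hx => hWB (by simp [W, hx])) hR hconn hl htel
      (fun x hx e he => ⟨hWB ?_, hWB ?_⟩) (fun x hx => hWB ?_) hp0
      (by rw [hp, div_mul_cancel₀ _ (by linarith)]) hlt.le hA1 hA2
    · rw [hcard, Nat.cast_pow] at this
      exact this
    · refine Finset.mem_union_right _ (Finset.mem_biUnion.2 ⟨x, hx, ?_⟩)
      simp only [Finset.mem_union, List.mem_toFinset, List.mem_map]
      exact Or.inl ⟨e, he, rfl⟩
    · refine Finset.mem_union_right _ (Finset.mem_biUnion.2 ⟨x, hx, ?_⟩)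
      simp only [Finset.mem_union, List.mem_toFinset, List.mem_map]
      exact Or.inr ⟨e, he, rfl⟩
    · exact Finset.mem_union_left _ (Finset.mem_union_right _ (Finset.mem_image_of_mem _ hx))
  have hLpos : (0 : ℝ) < L := Nat.cast_pos.2 hL
  have hlim : Tendsto (fun n : ℕ => β * ((∑ x ∈ cube d (n * L),
      ∑' y : {y : Site d // y ∉ cube d (n * L)}, J x y) / ((n * L : ℕ) : ℝ) ^ d)) atTop
      (nhds (β * 0)) :=
    ((tendsto_boundary_sum hJ).comp (tendsto_id.atTop_mul_const' hL)).const_mul β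
  rw [mul_zero] at hlim
  have hge : ∀ᶠ n : ℕ in atTop, q / (L : ℝ) ^ d ≤ β * ((∑ x ∈ cube d (n * L),
      ∑' y : {y : Site d // y ∉ cube d (n * L)}, J x y) / ((n * L : ℕ) : ℝ) ^ d) := by
    filter_upwards [eventually_gt_atTop 0] with n hn
    have hn0 : (0 : ℝ) < n := Nat.cast_pos.2 hn
    rw [← mul_div_assoc, Nat.cast_mul, mul_pow, div_le_div_iff₀ (by positivity) (by positivity)]
    have := mul_le_mul_of_nonneg_right (hbound n) (show (0 : ℝ) ≤ (L : ℝ) ^ d by positivity)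
    linarith
  have := ge_of_tendsto hlim hge
  have h2 : 0 < q / (L : ℝ) ^ d := by positivity
  linarith

/-- There is no spontaneous magnetization at infinite temperature. -/
lemma spontaneousMagnetization_zero (hJ : Admissible J) : spontaneousMagnetization J 0 = 0 := by
  refine le_antisymm ?_ (spontaneousMagnetization_nonneg hJ le_rfl)
  refine (spontaneousMagnetization_le hJ le_rfl {0} 0).trans_eq ?_
  have h0 : (0 : Site d) ∈ ({0} : Finset (Site d)) := Finset.mem_singleton_self 0
  simp only [plusSite, glue_of_mem _ _ h0, gibbsExp, neg_zero, zero_mul, Real.exp_zero, mul_one]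
  rw [div_eq_zero_iff]
  left
  have h1 := Equiv.sum_comp (Equiv.neg (({0} : Finset (Site d)) → ℤˣ)) fun σ => spin (σ ⟨0, h0⟩)
  simp only [Equiv.neg_apply, Pi.neg_apply, spin_neg, Finset.sum_neg_distrib] at h1
  linarith

/-- An infimum of positive `β` is only known to be nonnegative, so `β = 0` is included; there the
spins are independent and symmetric. -/
theorem spontaneousMagnetization_eq_zero (hJ : Admissible J) {β : ℝ} (hβ : 0 ≤ β)
    (h : modifiedLRO J β = 0) : spontaneousMagnetization J β = 0 := by
  rcases hβ.eq_or_lt with rfl | hβ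
  · exact spontaneousMagnetization_zero hJ
  · exact spontaneousMagnetization_eq_zero_of_pos hJ hβ h

end Boxes

/-! ### Continuity of the Gibbs kernels and existence of Gibbs states -/

section Topology

instance : DiscreteMeasurableSpace ℤˣ :=
  ⟨fun s => ⟨Units.val '' s, MeasurableSet.of_discrete, Set.preimage_image_eq _ Units.val_injective⟩⟩

instance : BorelSpace ℤˣ := by
  constructor
  refine le_antisymm (fun s _ => ?_) fun s _ => MeasurableSet.of_discrete
  exact MeasurableSpace.measurableSet_generateFrom (isOpen_discrete s)

variable {d : ℕ} {J : Site d → Site d → ℝ}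

lemma continuous_spin : Continuous spin := continuous_of_discreteTopology

lemma continuous_spin_apply (x : Site d) : Continuous fun ω : Config d => spin (ω x) :=
  continuous_spin.comp (continuous_apply x)

lemma continuous_glue (Λ : Finset (Site d)) (σ : Λ → ℤˣ) :
    Continuous fun ω : Config d => glue Λ σ ω := by
  refine continuous_pi fun x => ?_
  by_cases hx : x ∈ Λ
  · simp only [glue_of_mem _ _ hx]
    exact continuous_const
  · simp only [glue_of_notMem _ _ hx]
    exact continuous_apply x

lemma continuous_hamiltonian (hJ : Admissible J) (Λ : Finset (Site d)) (σ : Λ → ℤˣ) :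
    Continuous fun ω : Config d => hamiltonian J Λ (fun y => spin (ω y)) σ := by
  refine continuous_const.sub (continuous_finsetSum _ fun x _ => ?_)
  refine continuous_tsum (u := fun y : {y : Site d // y ∉ Λ} => J x y)
    (fun y => continuous_const.mul (continuous_spin_apply _))
    ((hJ.summable_right (x : Site d)).subtype fun y => y ∉ Λ) fun y ω => ?_
  rw [Real.norm_eq_abs, abs_mul, abs_mul, abs_spin, abs_spin, mul_one, mul_one,
    abs_of_nonneg (hJ.ferro _ _)]

/-- The probability of `σ` in the finite volume Gibbs state in `Λ` with boundary condition `ω`. -/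
noncomputable def gibbsProb (J : Site d → Site d → ℝ) (β : ℝ) (Λ : Finset (Site d)) (σ : Λ → ℤˣ)
    (ω : Config d) : ℝ :=
  Real.exp (-β * hamiltonian J Λ (fun y => spin (ω y)) σ) /
    ∑ σ : Λ → ℤˣ, Real.exp (-β * hamiltonian J Λ (fun y => spin (ω y)) σ)

lemma gibbsProb_nonneg (J : Site d → Site d → ℝ) (β : ℝ) (Λ : Finset (Site d)) (σ : Λ → ℤˣ)
    (ω : Config d) : 0 ≤ gibbsProb J β Λ σ ω :=
  div_nonneg (Real.exp_pos _).le (partition_pos J β Λ _).le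

lemma continuous_gibbsProb (hJ : Admissible J) (β : ℝ) (Λ : Finset (Site d)) (σ : Λ → ℤˣ) :
    Continuous (gibbsProb J β Λ σ) := by
  have h : ∀ σ, Continuous fun ω : Config d =>
      Real.exp (-β * hamiltonian J Λ (fun y => spin (ω y)) σ) := fun σ =>
    Real.continuous_exp.comp (continuous_const.mul (continuous_hamiltonian hJ Λ σ))
  exact (h σ).div (continuous_finsetSum _ fun σ _ => h σ) fun ω => (partition_pos J β Λ _).ne'

lemma gibbsExp_eq_sum (J : Site d → Site d → ℝ) (β : ℝ) (Λ : Finset (Site d)) (ω : Config d)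
    (f : (Λ → ℤˣ) → ℝ) :
    gibbsExp J β Λ (fun y => spin (ω y)) f = ∑ σ, f σ * gibbsProb J β Λ σ ω := by
  simp only [gibbsExp, gibbsProb, Finset.sum_div, mul_div_assoc]

lemma continuous_resample (hJ : Admissible J) (β : ℝ) (Λ : Finset (Site d)) {F : Config d → ℝ}
    (hF : Continuous F) : Continuous (resample J β Λ F) := by
  have : resample J β Λ F = fun ω => ∑ σ, F (glue Λ σ ω) * gibbsProb J β Λ σ ω := by
    ext ω; exact gibbsExp_eq_sum J β Λ ω _
  rw [this]
  exact continuous_finsetSum _ fun σ _ =>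
    (hF.comp (continuous_glue Λ σ)).mul (continuous_gibbsProb hJ β Λ σ)

lemma integrable_of_continuous {μ : Measure (Config d)} [IsFiniteMeasure μ] {F : Config d → ℝ}
    (hF : Continuous F) : Integrable F μ :=
  (BoundedContinuousFunction.mkOfCompact ⟨F, hF⟩).integrable μ

/-- The measure obtained from `μ` by resampling the spins in `Λ`. -/
noncomputable def resampleMeasure (J : Site d → Site d → ℝ) (β : ℝ) (Λ : Finset (Site d))
    (μ : Measure (Config d)) : Measure (Config d) :=
  Measure.sum fun σ : Λ → ℤˣ =>
    (μ.withDensity fun ω => ENNReal.ofReal (gibbsProb J β Λ σ ω)).map (glue Λ σ)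

/-- Realizing the resampled state as a measure lets the DLR equations pass from continuous to
bounded measurable observables, since continuous functions determine a finite measure. -/
lemma integral_resampleMeasure (hJ : Admissible J) (β : ℝ) (Λ : Finset (Site d))
    (μ : Measure (Config d)) [IsFiniteMeasure μ] {F : Config d → ℝ} (hF : Measurable F)
    (hb : ∃ C : ℝ, ∀ ω, |F ω| ≤ C) :
    ∫ ω, F ω ∂(resampleMeasure J β Λ μ) = ∫ ω, resample J β Λ F ω ∂μ := by
  obtain ⟨C, hC⟩ := hb
  have hint : ∀ σ, Integrable (fun ω => F (glue Λ σ ω) * gibbsProb J β Λ σ ω) μ := fun σ =>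
    (integrable_of_continuous (continuous_gibbsProb hJ β Λ σ)).bdd_mul
      (hF.comp (continuous_glue Λ σ).measurable).aestronglyMeasurable
      (Eventually.of_forall fun ω => hC _)
  have hdens : ∀ σ, Measurable fun ω => ENNReal.ofReal (gibbsProb J β Λ σ ω) := fun σ =>
    (continuous_gibbsProb hJ β Λ σ).measurable.ennreal_ofReal
  have h1 : ∀ σ, ∫ ω, F ω ∂((μ.withDensity fun ω =>
      ENNReal.ofReal (gibbsProb J β Λ σ ω)).map (glue Λ σ))
        = ∫ ω, F (glue Λ σ ω) * gibbsProb J β Λ σ ω ∂μ := by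
    intro σ
    rw [integral_map (continuous_glue Λ σ).measurable.aemeasurable hF.aestronglyMeasurable,
      integral_withDensity_eq_integral_toReal_smul (hdens σ)
        (Eventually.of_forall fun ω => ENNReal.ofReal_lt_top)]
    refine integral_congr_ae (Eventually.of_forall fun ω => ?_)
    simp only [smul_eq_mul]
    rw [ENNReal.toReal_ofReal (gibbsProb_nonneg J β Λ σ ω), mul_comm]
  have hfin : ∀ σ, IsFiniteMeasure (μ.withDensity fun ω =>
      ENNReal.ofReal (gibbsProb J β Λ σ ω)) := fun σ =>
    isFiniteMeasure_withDensity_ofReal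
      (integrable_of_continuous (continuous_gibbsProb hJ β Λ σ)).2
  rw [resampleMeasure, Measure.sum_fintype, integral_finsetSum_measure]
  · rw [Finset.sum_congr rfl fun σ _ => h1 σ, ← integral_finsetSum _ fun σ _ => hint σ]
    refine integral_congr_ae (Eventually.of_forall fun ω => ?_)
    exact (gibbsExp_eq_sum J β Λ ω _).symm
  · intro σ _
    exact Integrable.of_bound hF.aestronglyMeasurable C (Eventually.of_forall hC)

/-- It is enough to check the DLR equations for continuous observables. -/
lemma isGibbsState_of_continuous (hJ : Admissible J) {β : ℝ} {μ : ProbabilityMeasure (Config d)}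
    (h : ∀ (Λ : Finset (Site d)) (F : Config d → ℝ), Continuous F →
      ∫ ω, resample J β Λ F ω ∂(μ : Measure (Config d)) = ∫ ω, F ω ∂(μ : Measure (Config d))) :
    IsGibbsState J β μ := by
  intro Λ F hF hb
  have hfin : IsFiniteMeasure (resampleMeasure J β Λ (μ : Measure (Config d))) := by
    have hfin : ∀ σ, IsFiniteMeasure ((μ : Measure (Config d)).withDensity fun ω =>
        ENNReal.ofReal (gibbsProb J β Λ σ ω)) := fun σ =>
      isFiniteMeasure_withDensity_ofReal
        (integrable_of_continuous (continuous_gibbsProb hJ β Λ σ)).2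
    rw [resampleMeasure, Measure.sum_fintype]
    infer_instance
  have heq : resampleMeasure J β Λ (μ : Measure (Config d)) = μ := by
    refine ext_of_forall_integral_eq_of_IsFiniteMeasure fun f => ?_
    rw [integral_resampleMeasure hJ β Λ _ f.continuous.measurable
      ⟨‖f‖, fun ω => f.norm_coe_le_norm ω⟩, h Λ f f.continuous]
  have := integral_resampleMeasure hJ β Λ (μ : Measure (Config d)) hF hb
  rw [heq] at this
  exact this.symm

/-- The finite volume Gibbs state with plus boundary condition, as a measure on all
configurations. -/
noncomputable def plusMeasure (J : Site d → Site d → ℝ) (β : ℝ) (Λ : Finset (Site d)) :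
    Measure (Config d) :=
  ∑ σ : Λ → ℤˣ, ENNReal.ofReal (gibbsProb J β Λ σ 1) • Measure.dirac (glue Λ σ 1)

instance (J : Site d → Site d → ℝ) (β : ℝ) (Λ : Finset (Site d)) :
    IsProbabilityMeasure (plusMeasure J β Λ) := by
  constructor
  simp only [plusMeasure, Measure.coe_finsetSum, Finset.sum_apply, Measure.smul_apply,
    measure_univ, smul_eq_mul, mul_one]
  rw [← ENNReal.ofReal_sum_of_nonneg fun σ _ => gibbsProb_nonneg J β Λ σ 1]
  simp only [gibbsProb, ← Finset.sum_div]
  rw [div_self (partition_pos J β Λ _).ne', ENNReal.ofReal_one]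

lemma integral_plusMeasure (J : Site d → Site d → ℝ) (β : ℝ) (Λ : Finset (Site d))
    {F : Config d → ℝ} (hF : Continuous F) :
    ∫ ω, F ω ∂(plusMeasure J β Λ)
      = gibbsExp J β Λ (fun y => spin ((1 : Config d) y)) fun σ => F (glue Λ σ 1) := by
  rw [plusMeasure, integral_finsetSum_measure, gibbsExp_eq_sum]
  · refine Finset.sum_congr rfl fun σ _ => ?_
    rw [integral_smul_measure, integral_dirac, ENNReal.toReal_ofReal (gibbsProb_nonneg J β Λ σ 1),
      smul_eq_mul, mul_comm]
  · intro σ _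
    exact (integrable_of_continuous hF).smul_measure ENNReal.ofReal_ne_top

/-- Gibbs states exist. -/
theorem exists_isGibbsState (hJ : Admissible J) (β : ℝ) :
    ∃ μ : ProbabilityMeasure (Config d), IsGibbsState J β μ := by
  let m : Finset (Site d) → ProbabilityMeasure (Config d) := fun Λ => ⟨plusMeasure J β Λ, inferInstance⟩
  -- The space of probability measures is compact, so the plus states converge along an ultrafilter
  -- finer than `atTop`. Consistency passes to the limit because resampling preserves continuity.
  let u : Ultrafilter (Finset (Site d)) := Ultrafilter.of atTop
  obtain ⟨μ, -, hμ⟩ := isCompact_univ.ultrafilter_le_nhds (u.map m) (by simp)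
  have hu : (u : Filter (Finset (Site d))) ≤ atTop := Ultrafilter.of_le atTop
  have hlim : ∀ F : Config d → ℝ, Continuous F → Tendsto (fun Δ => ∫ ω, F ω ∂(plusMeasure J β Δ)) u
      (nhds (∫ ω, F ω ∂(μ : Measure (Config d)))) := by
    intro F hF
    have h1 : Tendsto m u (nhds μ) := hμ
    have h2 := ProbabilityMeasure.tendsto_iff_forall_integral_tendsto.1 h1
      (BoundedContinuousFunction.mkOfCompact ⟨F, hF⟩)
    exact h2
  refine ⟨μ, isGibbsState_of_continuous hJ fun Λ F hF => ?_⟩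
  refine tendsto_nhds_unique (hlim _ (continuous_resample hJ β Λ hF)) ((hlim F hF).congr' ?_)
  filter_upwards [hu (eventually_ge_atTop Λ)] with Δ hΔ
  rw [integral_plusMeasure J β Δ hF, integral_plusMeasure J β Δ (continuous_resample hJ β Λ hF),
    gibbsExp_resample hJ β hΔ]

end Topology

/-! ### Uniqueness of the Gibbs state without magnetization -/

section Uniqueness

variable {d : ℕ} {J : Site d → Site d → ℝ}

lemma spin_le_spin {a b : ℤˣ} (h : a ≤ b) : spin a ≤ spin b := by
  have : (a : ℤ) ≤ b := h
  exact Int.cast_le.2 this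

lemma spin_inf_sup_cases (a b : ℤˣ) : (spin (a ⊓ b) = spin a ∧ spin (a ⊔ b) = spin b ∧
    spin a ≤ spin b) ∨ (spin (a ⊓ b) = spin b ∧ spin (a ⊔ b) = spin a ∧ spin b ≤ spin a) := by
  rcases le_total a b with h | h
  · left
    rw [inf_eq_left.2 h, sup_eq_right.2 h]
    exact ⟨rfl, rfl, spin_le_spin h⟩
  · right
    rw [inf_eq_right.2 h, sup_eq_left.2 h]
    exact ⟨rfl, rfl, spin_le_spin h⟩

/-- The condition of Holley's inequality for two Ising models with ordered fields. -/
lemma boltzmann_mul_le_inf_sup {V : Type*} [Fintype V] {K : V → V → ℝ} {h h' : V → ℝ}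
    (hK : ∀ x y, 0 ≤ K x y) (hh : ∀ x, h x ≤ h' x) (a b : V → ℤˣ) :
    boltzmann bondChar (bondCoupling K h) a * boltzmann bondChar (bondCoupling K h') b
      ≤ boltzmann bondChar (bondCoupling K h) (a ⊓ b)
        * boltzmann bondChar (bondCoupling K h') (a ⊔ b) := by
  simp only [boltzmann, ← Real.exp_add, ← Finset.sum_add_distrib]
  refine Real.exp_le_exp.2 (Finset.sum_le_sum fun i _ => ?_)
  rcases i with ⟨x, y⟩ | x
  · simp only [bondCoupling, bondChar_inl_apply, spin_mul, Pi.inf_apply, Pi.sup_apply]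
    rw [← mul_add, ← mul_add]
    refine mul_le_mul_of_nonneg_left ?_ (hK x y)
    rcases spin_inf_sup_cases (a x) (b x) with ⟨h1, h2, h3⟩ | ⟨h1, h2, h3⟩ <;>
      rcases spin_inf_sup_cases (a y) (b y) with ⟨h4, h5, h6⟩ | ⟨h4, h5, h6⟩ <;>
      rw [h1, h2, h4, h5] <;> nlinarith [mul_nonneg (sub_nonneg.2 h3) (sub_nonneg.2 h6)]
  · simp only [bondCoupling, bondChar_inr_apply, Pi.inf_apply, Pi.sup_apply]
    rcases spin_inf_sup_cases (a x) (b x) with ⟨h1, h2, h3⟩ | ⟨h1, h2, h3⟩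
    · rw [h1, h2]
    · rw [h1, h2]
      nlinarith [mul_nonneg (sub_nonneg.2 h3) (sub_nonneg.2 (hh x))]

/-- The expectations of increasing observables increase with the boundary condition. -/
lemma gibbsExp_le_of_monotone (hJ : Admissible J) {β : ℝ} (hβ : 0 ≤ β) (Λ : Finset (Site d))
    {τ : Site d → ℝ} (hτ : ∀ y, |τ y| ≤ 1) {f : (Λ → ℤˣ) → ℝ} (hf : Monotone f) :
    gibbsExp J β Λ τ f ≤ gibbsExp J β Λ (fun _ => 1) f := by
  -- `holley` requires a nonnegative observable; adding `C` achieves this and shifts both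
  -- expectations equally.
  set C := ∑ σ, |f σ| with hC
  have hnn : 0 ≤ fun σ => f σ + C := fun σ => by
    have h1 := Finset.single_le_sum (f := fun σ => |f σ|) (fun σ _ => abs_nonneg _)
      (Finset.mem_univ σ)
    have h2 := neg_abs_le (f σ)
    change 0 ≤ f σ + C
    linarith
  have hfield : ∀ x, volumeField J β Λ τ x ≤ volumeField J β Λ (fun _ => 1) x := fun x =>
    (le_abs_self _).trans (abs_volumeField_le hJ hβ Λ hτ x)
  set w := boltzmann bondChar (bondCoupling (volumePair J β Λ) (volumeField J β Λ τ)) with hw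
  set w' := boltzmann bondChar (bondCoupling (volumePair J β Λ) (volumeField J β Λ fun _ => 1))
    with hw'
  have hZ : 0 < ∑ σ, w σ := sum_boltzmann_pos _ _
  have hZ' : 0 < ∑ σ, w' σ := sum_boltzmann_pos _ _
  have key := holley (μ := fun σ => f σ + C) (f := fun σ => w σ / ∑ σ, w σ)
    (g := fun σ => w' σ / ∑ σ, w' σ) hnn
    (fun σ => div_nonneg (boltzmann_pos _ _ σ).le hZ.le)
    (fun σ => div_nonneg (boltzmann_pos _ _ σ).le hZ'.le)
    (fun σ σ' h => add_le_add_left (hf h) C)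
    (by rw [← Finset.sum_div, ← Finset.sum_div, div_self hZ.ne', div_self hZ'.ne'])
    (fun a b => by
      rw [div_mul_div_comm, div_mul_div_comm]
      exact div_le_div_of_nonneg_right
        (boltzmann_mul_le_inf_sup (volumePair_nonneg hJ hβ Λ) hfield a b) (by positivity))
  have e : ∀ v : (Λ → ℤˣ) → ℝ, 0 < ∑ σ, v σ → ∑ σ, (f σ + C) * (v σ / ∑ σ, v σ)
      = (∑ σ, f σ * v σ) / (∑ σ, v σ) + C := by
    intro v hv
    simp only [add_mul, Finset.sum_add_distrib, ← Finset.mul_sum, ← mul_div_assoc,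
      ← Finset.sum_div]
    rw [add_div, mul_div_cancel_right₀ _ hv.ne']
  rw [e w hZ, e w' hZ'] at key
  rw [gibbsExp_eq_isingExpect, gibbsExp_eq_isingExpect]
  exact le_of_add_le_add_right key

open Classical in
/-- The indicator of the configurations that are `1` on `A`. -/
noncomputable def plusIndicator (A : Finset (Site d)) (ω : Config d) : ℝ :=
  if ∀ x ∈ A, ω x = 1 then 1 else 0

lemma eq_one_of_le {a b : ℤˣ} (h : a ≤ b) (ha : a = 1) : b = 1 := by
  subst ha
  rcases Int.units_eq_one_or b with rfl | rfl
  · rfl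
  · exact absurd h (by decide)

lemma plusIndicator_mono (A : Finset (Site d)) : Monotone (plusIndicator A) := by
  intro ω ω' h
  unfold plusIndicator
  split_ifs with h1 h2 h2
  · exact le_rfl
  · exact absurd (fun x hx => eq_one_of_le (h x) (h1 x hx)) h2
  · exact zero_le_one
  · exact le_rfl

/-- When the indicator jumps from `0` to `1`, some spin of `A` turns from minus to plus and raises
the sum by at least `1`. With `plusIndicator_mono`, the change of the indicator's expectation is
controlled by one-site magnetizations. -/
lemma sum_sub_plusIndicator_mono (A : Finset (Site d)) :
    Monotone fun ω : Config d => ∑ x ∈ A, (1 + spin (ω x)) / 2 - plusIndicator A ω := by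
  intro ω ω' h
  have hterm : ∀ x ∈ A, 0 ≤ (1 + spin (ω' x)) / 2 - (1 + spin (ω x)) / 2 := fun x _ => by
    linarith [spin_le_spin (h x)]
  have hsum : ∑ x ∈ A, ((1 + spin (ω' x)) / 2 - (1 + spin (ω x)) / 2)
      = ∑ x ∈ A, (1 + spin (ω' x)) / 2 - ∑ x ∈ A, (1 + spin (ω x)) / 2 :=
    Finset.sum_sub_distrib _ _
  have h0 := Finset.sum_nonneg hterm
  simp only [plusIndicator]
  split_ifs with h1 h2 h2
  · linarith
  · exact absurd (fun x hx => eq_one_of_le (h x) (h1 x hx)) h2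
  · push Not at h1
    obtain ⟨x, hx, hx1⟩ := h1
    have h3 := Finset.single_le_sum hterm hx
    have h4 : spin (ω' x) = 1 := by rw [h2 x hx, spin_one]
    have h5 : spin (ω x) = -1 := by
      rw [(Int.units_eq_one_or _).resolve_left hx1, spin_neg, spin_one]
    rw [h4, h5] at h3
    linarith
  · linarith

lemma glue_mono (Λ : Finset (Site d)) (ω : Config d) : Monotone fun σ => glue Λ σ ω := by
  intro σ σ' h x
  by_cases hx : x ∈ Λ
  · simpa [hx] using h ⟨x, hx⟩
  · simp [hx]

lemma gibbsExp_neg (J : Site d → Site d → ℝ) (β : ℝ) (Λ : Finset (Site d)) (τ : Site d → ℝ)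
    (f : (Λ → ℤˣ) → ℝ) :
    gibbsExp J β Λ τ f = gibbsExp J β Λ (fun y => -τ y) fun σ => f (-σ) := by
  have h : ∀ σ, hamiltonian J Λ τ (-σ) = hamiltonian J Λ (fun y => -τ y) σ := by
    intro σ
    simp [hamiltonian, spin_neg]
  rw [gibbsExp, gibbsExp, ← Equiv.sum_comp (Equiv.neg (Λ → ℤˣ)),
    ← Equiv.sum_comp (Equiv.neg (Λ → ℤˣ)) fun σ => Real.exp (-β * hamiltonian J Λ τ σ)]
  simp only [Equiv.neg_apply, h]

lemma neg_plusSite_le (hJ : Admissible J) {β : ℝ} (hβ : 0 ≤ β) {Λ : Finset (Site d)}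
    {τ : Site d → ℝ} (hτ : ∀ y, |τ y| ≤ 1) {x : Site d} (hx : x ∈ Λ) :
    -plusSite J β Λ x ≤ gibbsExp J β Λ τ fun σ => spin (σ ⟨x, hx⟩) := by
  have h1 := gibbsExp_site_le_plusSite hJ hβ (τ := fun y => -τ y) (fun y => by simpa using hτ y) hx
  have h2 := gibbsExp_sub J β Λ (fun y => -τ y) (fun _ => 0) fun σ => spin (σ ⟨x, hx⟩)
  rw [gibbsExp_neg J β Λ τ]
  simp only [Pi.neg_apply, spin_neg]
  simp only [zero_sub, gibbsExp_const] at h2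
  linarith

/-- The influence of the boundary condition is bounded by the plus magnetization. -/
lemma abs_resample_plusIndicator_sub_le (hJ : Admissible J) {β : ℝ} (hβ : 0 ≤ β)
    {A Λ : Finset (Site d)} (hA : A ⊆ Λ) (ω : Config d) :
    |resample J β Λ (plusIndicator A) ω - resample J β Λ (plusIndicator A) 1|
      ≤ ∑ x ∈ A, plusSite J β Λ x := by
  have hτ : ∀ y, |spin (ω y)| ≤ 1 := fun y => (abs_spin _).le
  have hind : ∀ η : Config d, (fun σ => plusIndicator A (glue Λ σ η))
      = fun σ => plusIndicator A (glue Λ σ 1) := by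
    intro η
    ext σ
    unfold plusIndicator
    congr 1
    refine propext (forall₂_congr fun x hx => ?_)
    rw [glue_of_mem _ _ (hA hx), glue_of_mem _ _ (hA hx)]
  have h1 := gibbsExp_le_of_monotone hJ hβ Λ hτ (f := fun σ => plusIndicator A (glue Λ σ 1))
    ((plusIndicator_mono A).comp (glue_mono Λ 1))
  have h2 := gibbsExp_le_of_monotone hJ hβ Λ hτ
    ((sum_sub_plusIndicator_mono A).comp (glue_mono Λ 1))
  simp only [Function.comp_def] at h2
  rw [gibbsExp_sub, gibbsExp_sub, gibbsExp_sum, gibbsExp_sum] at h2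
  have h3 : ∀ τ : Site d → ℝ, ∀ x ∈ A, gibbsExp J β Λ τ (fun σ => (1 + spin (glue Λ σ 1 x)) / 2)
      = (1 + gibbsExp J β Λ τ fun σ => spin (glue Λ σ 1 x)) / 2 := by
    intro τ x _
    have e := gibbsExp_sum J β Λ τ (Finset.univ : Finset Bool)
      fun b σ => if b then (1 / 2 : ℝ) else 1 / 2 * spin (glue Λ σ 1 x)
    simp only [Fintype.sum_bool, if_true, Bool.false_eq_true, if_false, gibbsExp_const] at e
    have e2 : gibbsExp J β Λ τ (fun σ => 1 / 2 * spin (glue Λ σ 1 x))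
        = 1 / 2 * gibbsExp J β Λ τ fun σ => spin (glue Λ σ 1 x) := by
      rw [gibbsExp, gibbsExp, ← mul_div_assoc, Finset.mul_sum]
      simp only [mul_assoc]
    rw [e2] at e
    rw [add_div, ← one_div_mul_eq_div (2 : ℝ) (gibbsExp _ _ _ _ _), ← e]
    congr 1
    ext σ
    ring
  -- Every boundary condition gives a magnetization at least minus the plus one, so each halved
  -- difference is at most `plusSite`.
  have h4 : ∑ x ∈ A, gibbsExp J β Λ (fun _ => 1) (fun σ => (1 + spin (glue Λ σ 1 x)) / 2)
      - ∑ x ∈ A, gibbsExp J β Λ (fun y => spin (ω y)) (fun σ => (1 + spin (glue Λ σ 1 x)) / 2)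
      ≤ ∑ x ∈ A, plusSite J β Λ x := by
    rw [← Finset.sum_sub_distrib]
    refine Finset.sum_le_sum fun x hx => ?_
    rw [h3 _ x hx, h3 _ x hx]
    have h5 := neg_plusSite_le hJ hβ hτ (hA hx)
    have h6 : gibbsExp J β Λ (fun _ => 1) (fun σ => spin (glue Λ σ 1 x)) = plusSite J β Λ x := rfl
    have h7 : gibbsExp J β Λ (fun y => spin (ω y)) (fun σ => spin (glue Λ σ 1 x))
        = gibbsExp J β Λ (fun y => spin (ω y)) fun σ => spin (σ ⟨x, hA hx⟩) := by
      simp only [glue_of_mem _ _ (hA hx)]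
    rw [h6, h7]
    linarith
  have h8 : resample J β Λ (plusIndicator A) 1
      = gibbsExp J β Λ (fun _ => 1) fun σ => plusIndicator A (glue Λ σ 1) := by
    rw [resample, spin_one_config]
  have h9 : resample J β Λ (plusIndicator A) ω
      = gibbsExp J β Λ (fun y => spin (ω y)) fun σ => plusIndicator A (glue Λ σ 1) := by
    rw [resample, hind ω]
  rw [h8, h9, abs_sub_comm, abs_of_nonneg (sub_nonneg.2 h1)]
  linarith

lemma measurableSet_plus (A : Finset (Site d)) :
    MeasurableSet {ω : Config d | ∀ x ∈ A, ω x = 1} := by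
  have : {ω : Config d | ∀ x ∈ A, ω x = 1} = ⋂ x ∈ A, (fun ω => ω x) ⁻¹' {1} := by
    ext ω; simp
  rw [this]
  exact A.measurableSet_biInter fun x _ => measurable_pi_apply x MeasurableSet.of_discrete

lemma plusIndicator_eq (A : Finset (Site d)) :
    plusIndicator A = Set.indicator {ω : Config d | ∀ x ∈ A, ω x = 1} 1 := by
  ext ω
  simp [plusIndicator, Set.indicator_apply]

lemma continuous_plusIndicator (A : Finset (Site d)) : Continuous (plusIndicator A) := by
  have : plusIndicator A = fun ω => ∏ x ∈ A, (1 + spin (ω x)) / 2 := by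
    ext ω
    unfold plusIndicator
    split_ifs with h
    · rw [Finset.prod_congr rfl fun x hx => by rw [h x hx, spin_one]]
      norm_num
    · push Not at h
      obtain ⟨x, hx, hx1⟩ := h
      refine (Finset.prod_eq_zero hx ?_).symm
      rw [(Int.units_eq_one_or _).resolve_left hx1, spin_neg, spin_one]
      norm_num
  rw [this]
  exact continuous_finsetProd _ fun x _ =>
    (continuous_const.add (continuous_spin_apply x)).div_const 2

lemma abs_plusIndicator_le (A : Finset (Site d)) (ω : Config d) : |plusIndicator A ω| ≤ 1 := by
  unfold plusIndicator
  split_ifs <;> simp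

/-- Probability measures that agree on the events of plus spins are equal. -/
lemma probabilityMeasure_ext {μ ν : ProbabilityMeasure (Config d)}
    (h : ∀ A : Finset (Site d), ∫ ω, plusIndicator A ω ∂(μ : Measure (Config d))
      = ∫ ω, plusIndicator A ω ∂(ν : Measure (Config d))) : μ = ν := by
  classical
  -- The events "plus on `A`" form a π-system, by unions of the sets `A`, and generate the product
  -- σ-algebra.
  set C : Set (Set (Config d)) := Set.range fun A : Finset (Site d) => {ω | ∀ x ∈ A, ω x = 1}
  refine Subtype.ext (@ext_of_generate_finite _ _ (μ : Measure (Config d)) ν C ?_ ?_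
    inferInstance ?_ (by simp))
  · refine le_antisymm ?_ (MeasurableSpace.generateFrom_le ?_)
    · refine iSup_le fun x => ?_
      rw [← measurable_iff_comap_le]
      refine @measurable_to_countable' ℤˣ (Config d) _ _ (MeasurableSpace.generateFrom C)
        (fun ω => ω x) fun a => ?_
      have h1 : MeasurableSet[MeasurableSpace.generateFrom C] ((fun ω : Config d => ω x) ⁻¹' {1}) :=
        MeasurableSpace.measurableSet_generateFrom ⟨{x}, by ext ω; simp⟩
      rcases Int.units_eq_one_or a with rfl | rfl
      · exact h1
      · have h2 : (fun ω : Config d => ω x) ⁻¹' {-1} = ((fun ω : Config d => ω x) ⁻¹' {1})ᶜ := by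
          ext ω
          rcases Int.units_eq_one_or (ω x) with h | h <;> simp [h]
        rw [h2]
        exact h1.compl
    · rintro _ ⟨A, rfl⟩
      exact measurableSet_plus A
  · rintro _ ⟨A, rfl⟩ _ ⟨A', rfl⟩ _
    refine ⟨A ∪ A', ?_⟩
    ext ω
    simp only [Set.mem_ofPred_eq, Finset.mem_union, Set.mem_inter_iff]
    exact ⟨fun h => ⟨fun x hx => h x (Or.inl hx), fun x hx => h x (Or.inr hx)⟩,
      fun h x hx => hx.elim (h.1 x) (h.2 x)⟩
  · rintro _ ⟨A, rfl⟩
    have h1 := h A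
    rw [plusIndicator_eq, integral_indicator_one (measurableSet_plus A),
      integral_indicator_one (measurableSet_plus A)] at h1
    exact (measureReal_eq_measureReal_iff).1 h1

/-- Without spontaneous magnetization there is at most one Gibbs state. -/
theorem isGibbsState_unique (hJ : Admissible J) {β : ℝ} (hβ : 0 ≤ β)
    (hm : spontaneousMagnetization J β = 0) {μ ν : ProbabilityMeasure (Config d)}
    (hμ : IsGibbsState J β μ) (hν : IsGibbsState J β ν) : μ = ν := by
  refine probabilityMeasure_ext fun A => ?_
  have hlim : Tendsto (fun Λ => ∑ x ∈ A, plusSite J β Λ x) atTop (nhds 0) := by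
    have := tendsto_finsetSum A fun x _ => tendsto_plusSite hJ hβ x
    simpa [hm] using this
  -- By the DLR equations, the probability under `μ` is an average of finite-volume probabilities,
  -- all close to the one with plus boundary condition.
  have hconv : ∀ μ : ProbabilityMeasure (Config d), IsGibbsState J β μ → ∀ Λ, A ⊆ Λ →
      |∫ ω, plusIndicator A ω ∂(μ : Measure (Config d)) - resample J β Λ (plusIndicator A) 1|
        ≤ ∑ x ∈ A, plusSite J β Λ x := by
    intro μ hμ Λ hA
    have h1 : ∫ ω, resample J β Λ (plusIndicator A) ω ∂(μ : Measure (Config d))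
        = ∫ ω, plusIndicator A ω ∂(μ : Measure (Config d)) :=
      hμ Λ (plusIndicator A) (continuous_plusIndicator A).measurable
        ⟨1, fun ω => abs_plusIndicator_le A ω⟩
    have h2 : resample J β Λ (plusIndicator A) 1
        = ∫ _ω, resample J β Λ (plusIndicator A) 1 ∂(μ : Measure (Config d)) := by simp
    have h3 : Integrable (resample J β Λ (plusIndicator A)) (μ : Measure (Config d)) :=
      integrable_of_continuous (continuous_resample hJ β Λ (continuous_plusIndicator A))
    rw [← h1, h2, ← integral_sub h3 (integrable_const _)]
    have h4 := norm_integral_le_of_norm_le_const (μ := (μ : Measure (Config d)))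
      (f := fun ω => resample J β Λ (plusIndicator A) ω - resample J β Λ (plusIndicator A) 1)
      (C := ∑ x ∈ A, plusSite J β Λ x)
      (Eventually.of_forall fun ω => abs_resample_plusIndicator_sub_le hJ hβ hA ω)
    simpa using h4
  have hle : ∀ᶠ Λ : Finset (Site d) in atTop,
      |∫ ω, plusIndicator A ω ∂(μ : Measure (Config d))
        - ∫ ω, plusIndicator A ω ∂(ν : Measure (Config d))|
        ≤ 2 * ∑ x ∈ A, plusSite J β Λ x := by
    filter_upwards [eventually_ge_atTop A] with Λ hΛ
    have h1 := abs_le.1 (hconv μ hμ Λ hΛ)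
    have h2 := abs_le.1 (hconv ν hν Λ hΛ)
    rw [abs_le]
    constructor <;> linarith [h1.1, h1.2, h2.1, h2.2]
  have h0 := ge_of_tendsto (hlim.const_mul 2) hle
  rw [mul_zero] at h0
  exact sub_eq_zero.1 (abs_nonpos_iff.1 h0)

end Uniqueness

end IsingZd

theorem theorem1 {d : ℕ} (J : IsingZd.Site d → IsingZd.Site d → ℝ) (hJ : IsingZd.Admissible J)
    (βc : ℝ) (hβc : IsingZd.IsCriticalBeta J βc) (hLRO : IsingZd.modifiedLRO J βc = 0) :
    IsingZd.spontaneousMagnetization J βc = 0 ∧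
      ∃! μ : MeasureTheory.ProbabilityMeasure (IsingZd.Config d), IsingZd.IsGibbsState J βc μ := by
  have hβ : 0 ≤ βc := hβc.2 fun β hβ => hβ.1.le
  have hm := IsingZd.spontaneousMagnetization_eq_zero hJ hβ hLRO
  obtain ⟨μ, hμ⟩ := IsingZd.exists_isGibbsState hJ βc
  exact ⟨hm, μ, hμ, fun ν hν => IsingZd.isGibbsState_unique hJ hβ hm hν hμ⟩
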